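/- **Setting.** Let $X\subset\mathbb C^n$ be a bounded domain with smooth boundary $M=\partial X$, let $k\ge 1$ be an integer, and let $\nu$ be the outward unit normal of $M$, $J$ the complex structure, $dx$ Lebesgue measure and $d\mu$ the surface measure of $M$. Let $Z_i=\sqrt2\,\partial/\partial z_i$ be the standard unitary frame of $T^{1,0}\mathbb C^n$; for real $u\in C^\infty(\overline X)$ write $u_i=Z_iu$, $u_{\bar j}=\overline{Z_j}u$, $u_{i\bar j}=\overline{Z_j}Z_iu$ and $D^{1,1}u=(u_{i\bar j})$. For $m\times m$ matrices let $$\sigma_k(A_1,\dots,A_k)=\tfrac1{k!}\,\delta^{i_1\cdots i_k}_{j_1\cdots j_k}(A_1)_{i_1\bar j_1}\cdots(A_k)_{i_k\bar j_k},\qquad T_{k}(A)_{j\bar i}=\tfrac1{k!}\,\delta^{i i_1\cdots i_k}_{j j_1\cdots j_k}A_{i_1\bar j_1}\cdots A_{i_k\bar j_k},$$ where $\delta$ is the generalized Kronecker delta and repeated indices are summed, and let $\sigma_k(A)=\sigma_k(A,\dots,A)$. Let $L(Y,Y')=(\nabla_Y\nu,Y')$ be the second fundamental form of $M$, $\mathcal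 H=\{Y\in TM:(Y,J\nu)=0\}$, $T^{1,0}M=\{Y-\sqrt{-1}JY:Y\in\mathcal H\}$, and let $L|_{\mathcal H}$, $D^{1,1}u|_{\mathcal H}$ be the restrictions of $L$ and of the complex Hessian to $T^{1,0}M\times\overline{T^{1,0}M}$, written as matrices in a unitary frame of $T^{1,0}M$. Define $$\mathcal E_{k+1}(u)=-\int_X u\,\sigma_k(D^{1,1}u)\,dx+\frac1{k^2(k+1)}\sum_{i=2}^{k+1}S_i(u),$$ $$S_i(u)=(-1)^i\frac{k(k+1)}2\binom{k}{i-1}\oint_M u\,u_\nu^{\,i-1}\,\sigma_{k-1}\bigl(\underbrace{L|_{\mathcal H},\dots,L|_{\mathcal H}}_{i-2},\underbrace{D^{1,1}u|_{\mathcal H},\dots,D^{1,1}u|_{\mathcal H}}_{k+1-i}\bigr)\,d\mu .$$ Let $\Gamma_k^+$ be the set of $u\in C^\infty(\overline X)$ such that, at every point of $X$, the elementary symmetric functions of degrees $1,\dots,k$ of the eigenvalues of $D^{1,1}u$ are positive. **Proposition 5.2.** Let $u,v\in C^\infty(\overline X)$ be real-valued with $v|_M=0$. Then $t\mapsto\mathcal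 E_{k+1}(u+tv)$ is $C^2$ on $\mathbb R$, the function $v_iv_{\bar j}T_{k-1}(D^{1,1}u)_{j\bar i}$ is integrable on $X$, and $$\frac{d^2}{dt^2}\Big|_{t=0}\mathcal E_{k+1}(u+tv)=(k+1)\int_X v_i\,v_{\bar j}\,T_{k-1}(D^{1,1}u)_{j\bar i}\,dx .$$ In particular, if $u\in\Gamma_k^+$, then $$\frac{d^2}{dt^2}\Big|_{t=0}\mathcal E_{k+1}(u+tv)\ge 0 .$$ Consequently, if $s\subset\mathbb R$ is convex and $u+tv\in\Gamma_k^+$ for all $t\in s$, then $t\mapsto\mathcal E_{k+1}(u+tv)$ is convex on $s$. -/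

import Mathlib

open MeasureTheory Set
open scoped ContDiff

noncomputable section

namespace HessianEnergy

/-- `ℂⁿ` with its Euclidean norm; as a real inner product space it is `ℝ²ⁿ`. The complex structure
`J` is multiplication by `Complex.I`. -/
abbrev Cn (n : ℕ) : Type := EuclideanSpace ℂ (Fin n)

/-! ### Elementary symmetric functions and Newton transformations of matrices -/

section Algebra

variable {ι : Type} [Fintype ι] [DecidableEq ι]

/-- Generalized Kronecker delta `δ^{i₁ ⋯ i_m}_{j₁ ⋯ j_m}`: the sign of the permutation that takes
`(i₁, …, i_m)` to `(j₁, …, j_m)` if these are tuples of distinct indices that differ by a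
permutation, and zero otherwise. -/
def genDelta {m : ℕ} (I J : Fin m → ι) : ℂ :=
  (Matrix.of fun a b : Fin m => if I a = J b then (1 : ℂ) else 0).det

/-- Polarized `σ_k(A₁, …, A_k) = (1/k!) δ^{i₁ ⋯ i_k}_{j₁ ⋯ j_k} (A₁)_{i₁ j₁} ⋯ (A_k)_{i_k j_k}`. -/
def sigmaPol {k : ℕ} (A : Fin k → Matrix ι ι ℂ) : ℂ :=
  (1 / (k.factorial : ℂ)) *
    ∑ I : Fin k → ι, ∑ J : Fin k → ι, genDelta I J * ∏ l, A l (I l) (J l)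

/-- `σ_k(A) = σ_k(A, …, A)`. -/
def sigma (k : ℕ) (A : Matrix ι ι ℂ) : ℂ :=
  sigmaPol fun _ : Fin k => A

/-- Newton transformation tensor
`T_k(A)_{j i} = (1/k!) δ^{i i₁ ⋯ i_k}_{j j₁ ⋯ j_k} A_{i₁ j₁} ⋯ A_{i_k j_k}`. -/
def newton (k : ℕ) (A : Matrix ι ι ℂ) : Matrix ι ι ℂ :=
  Matrix.of fun j i => (1 / (k.factorial : ℂ)) *
    ∑ I : Fin k → ι, ∑ J : Fin k → ι,
      genDelta (Fin.cons i I : Fin (k + 1) → ι) (Fin.cons j J) * ∏ l, A (I l) (J l)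

/-- The cone `Γ_k⁺` of Hermitian matrices: the elementary symmetric functions of degrees
`1, …, k` of the eigenvalues are positive. -/
def gammaCone (ι : Type) [Fintype ι] [DecidableEq ι] (k : ℕ) : Set (Matrix ι ι ℂ) :=
  {A | ∃ hA : A.IsHermitian, ∀ j, 1 ≤ j → j ≤ k →
    0 < ∑ s ∈ Finset.powersetCard j Finset.univ, ∏ i ∈ s, hA.eigenvalues i}

end Algebra

/-! ### Forms and derivatives in unitary frames -/

section Calculus

variable {n : ℕ}

/-- For a real bilinear form `B`, the value `B(Z, W̄)` of its complex bilinear extension at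
`Z = (Y - √-1 J Y) / √2` and `W̄ = (Y' + √-1 J Y') / √2`. -/
def mixedPart (B : Cn n → Cn n → ℝ) (Y Y' : Cn n) : ℂ :=
  (1 / 2 : ℂ) * ((B Y Y' + B (Complex.I • Y) (Complex.I • Y') : ℝ) +
    Complex.I * (B Y (Complex.I • Y') - B (Complex.I • Y) Y' : ℝ))

/-- The matrix `B(Z_i, Z̄_j)` in the frame `Z_i = (e_i - √-1 J e_i) / √2`. -/
def mixedMatrix {ι : Type} (B : Cn n → Cn n → ℝ) (e : ι → Cn n) : Matrix ι ι ℂ :=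
  Matrix.of fun i j => mixedPart B (e i) (e j)

/-- The standard basis of `ℂⁿ`. The corresponding unitary frame of `T^{1,0}ℂⁿ` is
`Z_i = (e_i - √-1 J e_i) / √2 = √2 ∂/∂z_i`. -/
def stdVec (i : Fin n) : Cn n := EuclideanSpace.single i (1 : ℂ)

/-- Real Hessian `∇²u` at `x` of a function on the closure of `X` (derivatives up to the
boundary). -/
def hess (X : Set (Cn n)) (u : Cn n → ℝ) (x Y Y' : Cn n) : ℝ :=
  fderivWithin ℝ (fderivWithin ℝ u (closure X)) (closure X) x Y Y'

/-- The complex Hessian matrix `D^{1,1}u = (u_{i j̄})`. -/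
def complexHessian (X : Set (Cn n)) (u : Cn n → ℝ) (x : Cn n) : Matrix (Fin n) (Fin n) ℂ :=
  mixedMatrix (hess X u x) stdVec

/-- `u_i = Z_i u`. -/
def dZ (X : Set (Cn n)) (u : Cn n → ℝ) (i : Fin n) (x : Cn n) : ℂ :=
  (1 / (Real.sqrt 2 : ℂ)) * ((fderivWithin ℝ u (closure X) x (stdVec i) : ℝ) -
    Complex.I * (fderivWithin ℝ u (closure X) x (Complex.I • stdVec i) : ℝ))

/-- `u_{ī} = Z̄_i u`. -/
def dZbar (X : Set (Cn n)) (u : Cn n → ℝ) (i : Fin n) (x : Cn n) : ℂ :=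
  (1 / (Real.sqrt 2 : ℂ)) * ((fderivWithin ℝ u (closure X) x (stdVec i) : ℝ) +
    Complex.I * (fderivWithin ℝ u (closure X) x (Complex.I • stdVec i) : ℝ))

/-- `C^∞(X̄)`: smooth functions on the closure of `X`, with all derivatives up to the boundary. -/
def SmoothOnClosure (X : Set (Cn n)) (u : Cn n → ℝ) : Prop :=
  ContDiffOn ℝ ∞ u (closure X)

/-- The elliptic cone `Γ_k⁺` of functions: those `u ∈ C^∞(X̄)` with `D^{1,1}u ∈ Γ_k⁺` in `X`. -/
def ellipticCone (X : Set (Cn n)) (k : ℕ) : Set (Cn n → ℝ) :=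
  {u | SmoothOnClosure X u ∧ ∀ x ∈ X, complexHessian X u x ∈ gammaCone (Fin n) k}

end Calculus

/-! ### Smooth domains and the geometry of their boundaries -/

section Geometry

variable {n : ℕ}

/-- `ρ`, smooth on the open set `U ∋ p`, defines `X` near `p`: `X ∩ U = {ρ < 0}`, `∇ρ(p) ≠ 0`. -/
structure IsLocalDefiningFunction (X : Set (Cn n)) (p : Cn n) (U : Set (Cn n))
    (ρ : Cn n → ℝ) : Prop where
  isOpen : IsOpen U
  mem : p ∈ U
  smooth : ContDiffOn ℝ ∞ ρ U
  inter_eq : X ∩ U = {x ∈ U | ρ x < 0}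
  gradient_ne : gradient ρ p ≠ 0

/-- A bounded domain in `ℂⁿ` with smooth boundary. -/
structure IsSmoothBoundedDomain (X : Set (Cn n)) : Prop where
  isOpen : IsOpen X
  isConnected : IsConnected X
  isBounded : Bornology.IsBounded X
  exists_defining : ∀ p ∈ frontier X, ∃ U ρ, IsLocalDefiningFunction X p U ρ

/-- The outward unit normal `ν` at a boundary point: the normalized gradient of a local defining
function (it does not depend on the function). -/
def outwardNormal (X : Set (Cn n)) (p : Cn n) : Cn n :=
  Classical.epsilon fun ν => ∃ U ρ, IsLocalDefiningFunction X p U ρ ∧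
    ν = ‖gradient ρ p‖⁻¹ • gradient ρ p

/-- Second fundamental form `L(Y, Y') = (∇_Y ν, Y')` of `M = ∂X`, for `Y`, `Y'` tangent to `M`.
The derivative is the one along `M`, so it is determined on tangent vectors. -/
def secondFundamentalForm (X : Set (Cn n)) (p Y Y' : Cn n) : ℝ :=
  inner ℝ (fderivWithin ℝ (outwardNormal X) (frontier X) p Y) Y'

/-- The complex tangent space `𝓗_p = {Y ∈ T_pM : (Y, Jν) = 0}`, that is, the vectors that are
orthogonal to `ν` and to `Jν`, as a complex subspace of `ℂⁿ`. -/
def complexTangent (X : Set (Cn n)) (p : Cn n) : Submodule ℂ (Cn n) :=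
  (Submodule.span ℂ {outwardNormal X p})ᗮ

/-- A complex orthonormal basis `e_α` of `𝓗_p`; the vectors `Z_α = (e_α - √-1 J e_α) / √2` form a
unitary frame of `T^{1,0}M` at `p`. -/
def tangentFrame (X : Set (Cn n)) (p : Cn n)
    (α : Fin (Module.finrank ℂ (complexTangent X p))) : Cn n :=
  (stdOrthonormalBasis ℂ (complexTangent X p) α : complexTangent X p)

/-- `L|_𝓗` as a matrix in the unitary frame. -/
def leviMatrix (X : Set (Cn n)) (p : Cn n) :
    Matrix (Fin (Module.finrank ℂ (complexTangent X p)))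
      (Fin (Module.finrank ℂ (complexTangent X p))) ℂ :=
  mixedMatrix (secondFundamentalForm X p) (tangentFrame X p)

/-- `D^{1,1}u|_𝓗` as a matrix in the unitary frame. -/
def tangentHessian (X : Set (Cn n)) (u : Cn n → ℝ) (p : Cn n) :
    Matrix (Fin (Module.finrank ℂ (complexTangent X p)))
      (Fin (Module.finrank ℂ (complexTangent X p))) ℂ :=
  mixedMatrix (hess X u p) (tangentFrame X p)

/-- Normal derivative `u_ν`. -/
def normalDeriv (X : Set (Cn n)) (u : Cn n → ℝ) (p : Cn n) : ℝ :=
  fderivWithin ℝ u (closure X) p (outwardNormal X p)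

/-- Surface measure `dμ` of `M = ∂X`: the `(2n-1)`-dimensional Hausdorff measure, normalized to be
Lebesgue measure on `(2n-1)`-dimensional subspaces. -/
def surfaceMeasure (X : Set (Cn n)) : Measure (Cn n) :=
  (Measure.euclideanHausdorffMeasure (2 * n - 1)).restrict (frontier X)

end Geometry

/-! ### The energy functional -/

section Energy

variable {n : ℕ}

/-- The boundary functional, for `2 ≤ i ≤ k + 1`,
`S_i(u) = (-1)^i k(k+1)/2 binom(k, i-1) ∮_M u u_ν^{i-1} σ_{k-1}(L|_𝓗, …, L|_𝓗, D^{1,1}u|_𝓗, …)`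
with `i - 2` entries `L|_𝓗` and `k + 1 - i` entries `D^{1,1}u|_𝓗`. (The value of `σ_{k-1}` is real,
since the matrices are Hermitian.) -/
def boundaryTerm (X : Set (Cn n)) (k i : ℕ) (u : Cn n → ℝ) : ℝ :=
  (-1) ^ i * ((k : ℝ) * (k + 1) / 2) * (k.choose (i - 1) : ℝ) *
    ∫ p, u p * normalDeriv X u p ^ (i - 1) *
      (sigmaPol fun l : Fin (k - 1) =>
        if (l : ℕ) < i - 2 then leviMatrix X p else tangentHessian X u p).re ∂(surfaceMeasure X)

/-- `𝓔_{k+1}(u) = -∫_X u σ_k(D^{1,1}u) dx + 1/(k²(k+1)) ∑_{i=2}^{k+1} S_i(u)`. -/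
def energy (X : Set (Cn n)) (k : ℕ) (u : Cn n → ℝ) : ℝ :=
  -(∫ x in X, u x * (sigma k (complexHessian X u x)).re) +
    1 / ((k : ℝ) ^ 2 * (k + 1)) * ∑ i ∈ Finset.Icc 2 (k + 1), boundaryTerm X k i u

/-- The integrand `v_i v_{j̄} T_{k-1}(D^{1,1}u)_{j ī}`, summed over `i` and `j`. -/
def variationDensity (X : Set (Cn n)) (k : ℕ) (u v : Cn n → ℝ) (x : Cn n) : ℂ :=
  ∑ i, ∑ j, dZ X v i x * dZbar X v j x * newton (k - 1) (complexHessian X u x) j i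

end Energy

end HessianEnergy

end

/-!
# The second variation of the complex Hessian energy

Write `u_t = u + t v`. The function `v` vanishes on `M = ∂X`, so differentiating the identity
`v_{Y'} = v_ν (ν, Y')` along `M` shows that the Hessian of `v` on tangent vectors is `v_ν L`
(`hess_eq_normalDeriv_mul`, `tangentHessian_eq_smul`). Hence `D^{1,1}u_t|_𝓗` moves in the direction
`v_ν L|_𝓗`, the derivative of each boundary term `S_i` is a combination of two consecutive integrals
`∮ u v_ν (u_t)_ν^j σ_{k-1}(L|_𝓗, …, L|_𝓗, D^{1,1}u_t|_𝓗, …)`, with `j` entries `L|_𝓗`, and the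
binomial weights make the sum telescope to `½ ∮ u v_ν σ_{k-1}(D^{1,1}u_t|_𝓗)`
(`hasDerivAt_sum_boundaryTerm`).

In the interior, the derivative of `σ_k(D^{1,1}u_t)` is `v_{i j̄} T_{k-1}(D^{1,1}u_t)_{j ī}`. The
Newton tensor of a complex Hessian is divergence free (`sum_dbar_newton_eq_zero`), because the
Kronecker delta is antisymmetric while `Z̄_j u_{p q̄}` is symmetric in `j` and `q`. Two applications
of Green's formula (`integral_newton_green`) therefore move both derivatives from `v` to `u_t`. By
Euler's identity this produces `k ∫ v σ_k(D^{1,1}u_t)`, and the boundary flux is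
`½ ∮ u v_ν σ_{k-1}(D^{1,1}u_t|_𝓗)`: contracting `T_{k-1}` twice with the normal gives `σ_{k-1}` of
the restriction to `𝓗` (`sigmaPol_compression`, `sum_normal_mul_dZ_mul_newton`). This flux cancels
the variation of the boundary terms, and the first variation is `-(k + 1) ∫ v σ_k(D^{1,1}u_t)`
(`hasDerivAt_energy`). One more integration by parts, now without a boundary term, gives the second
variation `(k + 1) ∫ v_i v_{j̄} T_{k-1}(D^{1,1}u_t)_{j ī}` (`hasDerivAt_integral_mul_sigma`).

On the cone `Γ_k⁺` the tensor `T_{k-1}` is nonnegative (`newton_nonneg`). In a basis of eigenvectors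
its diagonal entries are the elementary symmetric functions of degree `k - 1` of all eigenvalues but
one, and these are positive (`elemSymm_erase_pos`) by Newton's inequality, which follows from
Laguerre's inequality for real-rooted polynomials and Rolle's theorem. Convexity is then the second
derivative test.

The analytic foundation is the divergence theorem with the Hausdorff measure as surface measure
(`HasUnitNormal.integral_fderiv`). Locally the boundary is a graph in any direction `e` that points
outwards (`HasUnitNormal.exists_isLocalGraph`), and the area formula for such a graph
(`IsLocalGraph.withDensity_eq_map`) is obtained by comparing the Hausdorff measure of small pieces
with that of their projections along `e`, which is `(e, ν)` times as large up to a factor close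
to `1`.
Fubini's theorem along `e` gives the flux formula in the direction `e`. Every direction is a linear
combination of two outward ones, and a partition of unity concludes.
-/

noncomputable section

namespace HessianEnergy

/-! ### Hausdorff measure and projection along a direction -/

section Hypersurface

open Module Topology
open scoped NNReal ENNReal

variable {E : Type*} [NormedAddCommGroup E] [InnerProductSpace ℝ E]

/-- The orthogonal projection of `E` along the unit vector `e`, as a map from `E` to itself. -/
def projAlong (e : E) : E →ₗ[ℝ] E where
  toFun x := x - inner ℝ e x • e
  map_add' x y := by simp only [inner_add_right, add_smul]; abel
  map_smul' c x := by simp only [inner_smul_right, smul_sub, smul_smul, RingHom.id_apply]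

lemma projAlong_apply (e x : E) : projAlong e x = x - inner ℝ e x • e := rfl

lemma inner_projAlong {e : E} (he : ‖e‖ = 1) (x : E) : inner ℝ e (projAlong e x) = 0 := by
  simp [projAlong_apply, inner_sub_right, inner_smul_right, he]

lemma norm_projAlong_sq {e : E} (he : ‖e‖ = 1) (x : E) :
    ‖projAlong e x‖ ^ 2 = ‖x‖ ^ 2 - inner ℝ e x ^ 2 := by
  rw [projAlong_apply, norm_sub_sq_real, inner_smul_right, norm_smul, he, real_inner_comm]
  simp only [Real.norm_eq_abs, mul_one, sq_abs]
  ring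

lemma norm_projAlong_le {e : E} (he : ‖e‖ = 1) (x : E) : ‖projAlong e x‖ ≤ ‖x‖ := by
  have := norm_projAlong_sq he x
  nlinarith [norm_nonneg (projAlong e x), norm_nonneg x, sq_nonneg (inner ℝ e x)]

lemma projAlong_add_smul {e : E} (he : ‖e‖ = 1) (x : E) (s : ℝ) :
    projAlong e (x + s • e) = projAlong e x := by
  simp [projAlong_apply, inner_add_right, inner_smul_right, he, add_smul]

lemma projAlong_of_inner_eq_zero {e x : E} (h : inner ℝ e x = 0) : projAlong e x = x := by
  simp [projAlong_apply, h]

/-- On `ν^⊥` the projection along `e` contracts lengths at most by the factor `⟪e, ν⟫`. -/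
lemma mul_norm_le_norm_projAlong {e ν t : E} (he : ‖e‖ = 1) (hν : ‖ν‖ = 1)
    (ht : inner ℝ ν t = 0) : |inner ℝ e ν| * ‖t‖ ≤ ‖projAlong e t‖ := by
  set c := inner ℝ e ν with hc
  have h1 : inner ℝ e t = inner ℝ (projAlong ν e) t := by
    rw [projAlong_apply, inner_sub_left, inner_smul_left, ht]; simp
  have h2 : inner ℝ e t ^ 2 ≤ (1 - c ^ 2) * ‖t‖ ^ 2 := by
    have := abs_real_inner_le_norm (projAlong ν e) t
    have h3 := norm_projAlong_sq hν e
    rw [he, real_inner_comm, ← hc] at h3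
    rw [h1, ← sq_abs]
    calc _ ≤ (‖projAlong ν e‖ * ‖t‖) ^ 2 := by gcongr
      _ = _ := by rw [mul_pow, h3]; ring
  have h4 := norm_projAlong_sq he t
  apply abs_le_of_sq_le_sq' _ (norm_nonneg _) |>.2
  rw [mul_pow, sq_abs, h4]
  linarith

variable [FiniteDimensional ℝ E]

omit [FiniteDimensional ℝ E] in
lemma mem_orthogonal_span {e x : E} : x ∈ (ℝ ∙ e)ᗮ ↔ inner ℝ e x = 0 :=
  Submodule.mem_orthogonal_singleton_iff_inner_right

lemma finrank_orthogonal_unit {e : E} (he : ‖e‖ = 1) :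
    finrank ℝ (ℝ ∙ e)ᗮ = finrank ℝ E - 1 := by
  have h0 : e ≠ 0 := by rintro rfl; simp at he
  have h1 := (ℝ ∙ e).finrank_add_finrank_orthogonal
  rw [finrank_span_singleton h0] at h1
  omega

/-- The projection along `e`, restricted to the hyperplane `ν^⊥`, multiplies volumes
by `|⟪e, ν⟫|`. -/
lemma normDet_projAlong {e ν : E} (he : ‖e‖ = 1) (hν : ‖ν‖ = 1) :
    (projAlong e ∘ₗ ((ℝ ∙ ν)ᗮ).subtype).normDet = |inner ℝ e ν| := by
  set T := (ℝ ∙ ν)ᗮ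
  set f := projAlong e ∘ₗ T.subtype with hf
  have hmem : projAlong ν e ∈ T := mem_orthogonal_span.2 (inner_projAlong hν e)
  let w : T := ⟨projAlong ν e, hmem⟩
  have hw (t : T) : inner ℝ w t = inner ℝ e (t : E) := by
    have h : (w : E) = e - inner ℝ ν e • ν := rfl
    rw [Submodule.coe_inner, h, inner_sub_left, inner_smul_left, mem_orthogonal_span.1 t.2]
    simp
  have h1 : LinearMap.adjoint f ∘ₗ f =
      LinearMap.transvection (-(innerₗ T w)) w := by
    refine LinearMap.ext fun t => ext_inner_left ℝ fun s => ?_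
    rw [LinearMap.comp_apply, LinearMap.adjoint_inner_right]
    simp only [hf, LinearMap.comp_apply, Submodule.subtype_apply, projAlong_apply,
      LinearMap.transvection.apply, LinearMap.neg_apply, innerₗ_apply_apply, inner_sub_left,
      inner_sub_right, inner_add_right, inner_smul_left, inner_smul_right, hw, real_inner_comm,
      real_inner_self_eq_norm_sq, he]
    have h5 : inner ℝ (s : E) (w : E) = inner ℝ e (s : E) := by
      rw [real_inner_comm, ← Submodule.coe_inner, hw]
    rw [Submodule.coe_inner]
    simp [h5]
    ring
  have h2 := LinearMap.normDet_sq f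
  rw [h1, LinearMap.transvection.det] at h2
  have h3 : (1 : ℝ) + (-(innerₗ T w)) w = inner ℝ e ν ^ 2 := by
    simp only [LinearMap.neg_apply, innerₗ_apply_apply]
    rw [real_inner_self_eq_norm_sq, Submodule.coe_norm, norm_projAlong_sq hν, he,
      real_inner_comm]
    ring
  rw [h3] at h2
  have h4 : f.normDet ^ 2 = inner ℝ e ν ^ 2 := by exact_mod_cast h2
  rw [← abs_of_nonneg f.normDet_nonneg]
  exact (sq_eq_sq_iff_abs_eq_abs _ _).1 h4

section Measure

variable [MeasurableSpace E] [BorelSpace E]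

lemma hausdorffMeasure_projAlong_image {e ν : E} (he : ‖e‖ = 1) (hν : ‖ν‖ = 1) {S : Set E}
    (hS : ∀ x ∈ S, inner ℝ ν x = 0) :
    μHE[finrank ℝ E - 1] (projAlong e '' S) =
      ENNReal.ofReal |inner ℝ e ν| * μHE[finrank ℝ E - 1] S := by
  set T := (ℝ ∙ ν)ᗮ
  have hST : S = T.subtype '' (T.subtype ⁻¹' S) := by
    rw [Set.image_preimage_eq_of_subset]
    intro x hx
    exact ⟨⟨x, mem_orthogonal_span.2 (hS x hx)⟩, rfl⟩
  have hT : Isometry T.subtype := T.subtypeₗᵢ.isometry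
  have h1 := LinearMap.euclideanHausdorffMeasure_image
    (projAlong e ∘ₗ ((ℝ ∙ ν)ᗮ).subtype) (T.subtype ⁻¹' S)
  rw [normDet_projAlong he hν, finrank_orthogonal_unit hν] at h1
  rw [LinearMap.coe_comp, image_comp, ← hST] at h1
  rw [h1, ← hT.euclideanHausdorffMeasure_image, ← hST]

omit [InnerProductSpace ℝ E] [FiniteDimensional ℝ E] in
/-- If `f` is Lipschitz relative to `g` on `S`, the Hausdorff measure of `f '' S` is controlled
by that of `g '' S`. -/
lemma hausdorffMeasure_image_le_of_norm_le {α : Type*} {f g : α → E} {S : Set α} {K : ℝ}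
    (hK : 0 ≤ K) (h : ∀ x ∈ S, ∀ y ∈ S, ‖f x - f y‖ ≤ K * ‖g x - g y‖) (m : ℕ) :
    μHE[m] (f '' S) ≤ ENNReal.ofReal (K ^ m) * μHE[m] (g '' S) := by
  rcases S.eq_empty_or_nonempty with rfl | ⟨a₀, -⟩
  · simp
  have : Nonempty α := ⟨a₀⟩
  have hinv : ∀ x ∈ S, f (Function.invFunOn g S (g x)) = f x := by
    intro x hx
    have h1 := Function.invFunOn_mem (f := g) (s := S) (b := g x) ⟨x, hx, rfl⟩
    have h2 := Function.invFunOn_eq (f := g) (s := S) (b := g x) ⟨x, hx, rfl⟩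
    have h3 := h _ h1 x hx
    rw [h2, sub_self, norm_zero, mul_zero] at h3
    exact sub_eq_zero.1 (norm_le_zero_iff.1 h3)
  have himg : f '' S = (f ∘ Function.invFunOn g S) '' (g '' S) := by
    rw [image_image]
    exact image_congr fun x hx => (hinv x hx).symm
  have hL : LipschitzOnWith ⟨K, hK⟩ (f ∘ Function.invFunOn g S) (g '' S) := by
    apply LipschitzOnWith.of_dist_le_mul
    rintro _ ⟨x, hx, rfl⟩ _ ⟨y, hy, rfl⟩
    simp only [Function.comp_apply, hinv x hx, hinv y hy, dist_eq_norm]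
    exact h x hx y hy
  have h1 := hL.hausdorffMeasure_image_le (d := m) (by positivity)
  rw [himg]
  simp only [Measure.euclideanHausdorffMeasure_def, Measure.smul_apply,
    Measure.nnreal_smul_coe_apply]
  rw [mul_left_comm]
  gcongr
  refine h1.trans_eq ?_
  congr 1
  rw [ENNReal.rpow_natCast, ENNReal.ofReal_pow hK, ENNReal.ofReal_eq_coe_nnreal hK]
  rfl

/-- A set whose chords are almost orthogonal to `ν` has nearly the measure that its projection
along `e` predicts, namely `μ(projAlong e '' S) ≈ ⟪e, ν⟫ μ(S)`. -/
lemma hausdorffMeasure_projAlong_image_bounds {e ν : E} (he : ‖e‖ = 1) (hν : ‖ν‖ = 1)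
    {δ κ : ℝ} (hδ : 0 ≤ δ) (hδ1 : δ < 1) (hc : 0 < inner ℝ e ν)
    (hκ : κ = δ / (inner ℝ e ν * (1 - δ))) (hκ1 : κ < 1) {S : Set E}
    (hS : ∀ x ∈ S, ∀ y ∈ S, |inner ℝ ν (x - y)| ≤ δ * ‖x - y‖) :
    μHE[finrank ℝ E - 1] (projAlong e '' S) ≤
      ENNReal.ofReal ((1 + κ) ^ (finrank ℝ E - 1)) *
        (ENNReal.ofReal (inner ℝ e ν) * μHE[finrank ℝ E - 1] S) ∧
    ENNReal.ofReal (inner ℝ e ν) * μHE[finrank ℝ E - 1] S ≤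
      ENNReal.ofReal (((1 - δ)⁻¹ * (1 - κ)⁻¹) ^ (finrank ℝ E - 1)) *
        μHE[finrank ℝ E - 1] (projAlong e '' S) := by
  set m := finrank ℝ E - 1
  set c := inner ℝ e ν with hc'
  -- `projAlong ν` is a near isometry on `S`, and on its image, which lies in `ν^⊥`, the map
  -- `projAlong e` scales measures by `c`; finally, `projAlong e ∘ projAlong ν` is close to
  -- `projAlong e` on the chords of `S`
  have hκ0 : 0 ≤ κ := by rw [hκ]; exact div_nonneg hδ (mul_nonneg hc.le (by linarith))
  have hP : μHE[m] (projAlong e '' (projAlong ν '' S)) =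
      ENNReal.ofReal c * μHE[m] (projAlong ν '' S) := by
    have := hausdorffMeasure_projAlong_image (S := projAlong ν '' S) he hν (by
      rintro _ ⟨x, -, rfl⟩; exact inner_projAlong hν x)
    rwa [abs_of_pos hc] at this
  have hdec (z : E) : z = projAlong ν z + inner ℝ ν z • ν := by simp [projAlong_apply]
  have hb (x) (hx : x ∈ S) (y) (hy : y ∈ S) :
      ‖x - y‖ ≤ (1 - δ)⁻¹ * ‖projAlong ν (x - y)‖ := by
    have h1 : ‖x - y‖ ≤ ‖projAlong ν (x - y)‖ + δ * ‖x - y‖ := by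
      conv_lhs => rw [hdec (x - y)]
      refine (norm_add_le _ _).trans ?_
      rw [norm_smul, hν, mul_one, Real.norm_eq_abs]
      gcongr
      exact hS x hx y hy
    rw [le_inv_mul_iff₀ (by linarith)]
    linarith
  have hpp (x) (hx : x ∈ S) (y) (hy : y ∈ S) :
      δ * ‖x - y‖ ≤ κ * ‖projAlong e (projAlong ν (x - y))‖ := by
    have h1 := mul_norm_le_norm_projAlong he hν (inner_projAlong hν (x - y))
    rw [← hc', abs_of_pos hc] at h1
    have h2 := hb x hx y hy
    calc δ * ‖x - y‖ ≤ δ * ((1 - δ)⁻¹ * ‖projAlong ν (x - y)‖) := by gcongr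
      _ = κ * (c * ‖projAlong ν (x - y)‖) := by
        rw [hκ]; have : 1 - δ ≠ 0 := by linarith
        field_simp
      _ ≤ _ := by gcongr
  have hdiff (x) (hx : x ∈ S) (y) (hy : y ∈ S) :
      ‖projAlong e (x - y) - projAlong e (projAlong ν (x - y))‖ ≤ δ * ‖x - y‖ := by
    have h1 : projAlong e (x - y) - projAlong e (projAlong ν (x - y)) =
        inner ℝ ν (x - y) • projAlong e ν := by
      rw [← map_sub, ← map_smul]
      congr 1
      rw [projAlong_apply]; abel
    rw [h1, norm_smul, Real.norm_eq_abs]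
    have h2 := norm_projAlong_le he ν
    rw [hν] at h2
    calc _ ≤ (δ * ‖x - y‖) * 1 := by gcongr; exact hS x hx y hy
      _ = _ := mul_one _
  constructor
  · calc μHE[m] (projAlong e '' S)
        ≤ ENNReal.ofReal ((1 + κ) ^ m) *
          μHE[m] ((fun x => projAlong e (projAlong ν x)) '' S) := by
          refine hausdorffMeasure_image_le_of_norm_le (by linarith) (fun x hx y hy => ?_) m
          have h1 := hpp x hx y hy
          have h2 := hdiff x hx y hy
          simp only [← map_sub]
          have h3 := norm_sub_norm_le (projAlong e (x - y)) (projAlong e (projAlong ν (x - y)))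
          linarith
      _ = ENNReal.ofReal ((1 + κ) ^ m) *
          (ENNReal.ofReal c * μHE[m] (projAlong ν '' S)) := by
          rw [← hP, image_image]
      _ ≤ _ := by
          gcongr _ * (_ * ?_)
          have := hausdorffMeasure_image_le_of_norm_le (f := projAlong ν) (g := id) (S := S)
            (K := 1) zero_le_one (fun x _ y _ => by
              simpa [← map_sub] using norm_projAlong_le hν (x - y)) m
          simpa only [one_pow, ENNReal.ofReal_one, one_mul, image_id] using this
  · have hδ2 : 0 ≤ (1 - δ)⁻¹ := inv_nonneg.2 (by linarith)
    have hκ2 : 0 ≤ (1 - κ)⁻¹ := inv_nonneg.2 (by linarith)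
    calc ENNReal.ofReal c * μHE[m] S
        ≤ ENNReal.ofReal c * (ENNReal.ofReal ((1 - δ)⁻¹ ^ m) * μHE[m] (projAlong ν '' S)) := by
          gcongr
          have := hausdorffMeasure_image_le_of_norm_le (f := id) (g := projAlong ν) (S := S)
            hδ2 (fun x hx y hy => by
              simpa [← map_sub] using hb x hx y hy) m
          simpa using this
      _ = ENNReal.ofReal ((1 - δ)⁻¹ ^ m) *
            μHE[m] ((fun x => projAlong e (projAlong ν x)) '' S) := by
          rw [mul_left_comm, ← hP, image_image]
      _ ≤ ENNReal.ofReal ((1 - δ)⁻¹ ^ m) *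
            (ENNReal.ofReal ((1 - κ)⁻¹ ^ m) * μHE[m] (projAlong e '' S)) := by
          gcongr
          refine hausdorffMeasure_image_le_of_norm_le hκ2 (fun x hx y hy => ?_) m
          have h1 := hpp x hx y hy
          have h2 := hdiff x hx y hy
          simp only [← map_sub]
          rw [le_inv_mul_iff₀ (by linarith)]
          have h3 := norm_sub_norm_le (projAlong e (projAlong ν (x - y))) (projAlong e (x - y))
          rw [norm_sub_rev] at h3
          linarith
      _ = _ := by
          rw [← mul_assoc, ← ENNReal.ofReal_mul (by positivity), ← mul_pow]

/-- The bounds of `hausdorffMeasure_projAlong_image_bounds` with a prescribed ratio `η > 1`. -/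
lemma exists_hausdorffMeasure_projAlong_image_bounds {e ν : E} (he : ‖e‖ = 1) (hν : ‖ν‖ = 1)
    (hc : 0 < inner ℝ e ν) {η : ℝ} (hη : 1 < η) :
    ∃ δ : ℝ, 0 < δ ∧ ∀ S : Set E, (∀ x ∈ S, ∀ y ∈ S, |inner ℝ ν (x - y)| ≤ δ * ‖x - y‖) →
      μHE[finrank ℝ E - 1] (projAlong e '' S) ≤
        ENNReal.ofReal η * (ENNReal.ofReal (inner ℝ e ν) * μHE[finrank ℝ E - 1] S) ∧
      ENNReal.ofReal (inner ℝ e ν) * μHE[finrank ℝ E - 1] S ≤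
        ENNReal.ofReal η * μHE[finrank ℝ E - 1] (projAlong e '' S) := by
  set m := finrank ℝ E - 1
  set c := inner ℝ e ν
  have hκ : ContinuousAt (fun δ : ℝ => δ / (c * (1 - δ))) 0 := by
    apply ContinuousAt.div (by fun_prop) (by fun_prop); simpa using hc.ne'
  have h1 : ∀ᶠ δ : ℝ in 𝓝 0, δ / (c * (1 - δ)) < 1 :=
    hκ.eventually_lt continuousAt_const (by simp)
  have h2 : ∀ᶠ δ : ℝ in 𝓝 0, (1 + δ / (c * (1 - δ))) ^ m < η :=
    ContinuousAt.eventually_lt (by fun_prop) continuousAt_const (by simpa using hη)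
  have h3 : ∀ᶠ δ : ℝ in 𝓝 0, ((1 - δ)⁻¹ * (1 - δ / (c * (1 - δ)))⁻¹) ^ m < η := by
    refine ContinuousAt.eventually_lt ?_ continuousAt_const (by simpa using hη)
    refine ((ContinuousAt.inv₀ (by fun_prop) (by simp)).mul
      (ContinuousAt.inv₀ (by fun_prop) (by simp))).pow m
  have h4 : ∀ᶠ δ : ℝ in 𝓝 0, δ < 1 := eventually_lt_nhds one_pos
  obtain ⟨δ, ⟨⟨⟨⟨g1, g2⟩, g3⟩, g4⟩, hδ⟩⟩ :=
    ((((h1.and h2).and h3).and h4).filter_mono nhdsWithin_le_nhds |>.and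
      (self_mem_nhdsWithin (s := Ioi (0 : ℝ)))).exists
  refine ⟨δ, hδ, fun S hS => ?_⟩
  obtain ⟨b1, b2⟩ := hausdorffMeasure_projAlong_image_bounds he hν (le_of_lt hδ) g4 hc rfl g1 hS
  refine ⟨b1.trans ?_, b2.trans ?_⟩ <;> gcongr

end Measure

/-- Two measures compare on a set as soon as they compare near each of its points. -/
lemma measure_le_of_forall_exists_nhds {X : Type*} [TopologicalSpace X]
    [SecondCountableTopology X] [MeasurableSpace X] [OpensMeasurableSpace X] {α β : Measure X}
    {M : Set X}
    (h : ∀ x ∈ M, ∃ W ∈ 𝓝 x, ∀ S, MeasurableSet S → S ⊆ W → S ⊆ M → α S ≤ β S)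
    {S : Set X} (hS : MeasurableSet S) (hSM : S ⊆ M) : α S ≤ β S := by
  have h' : ∀ x ∈ M, ∃ W, IsOpen W ∧ x ∈ W ∧
      ∀ S, MeasurableSet S → S ⊆ W → S ⊆ M → α S ≤ β S := by
    intro x hx
    obtain ⟨W, hW, hWS⟩ := h x hx
    obtain ⟨V, hVW, hV, hxV⟩ := mem_nhds_iff.1 hW
    exact ⟨V, hV, hxV, fun S h1 h2 h3 => hWS S h1 (h2.trans hVW) h3⟩
  choose! W hWo hxW hW using h'
  obtain ⟨t, htM, htc, hcov⟩ := TopologicalSpace.countable_cover_nhdsWithin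
    (f := W) (s := M) fun x hx => mem_nhdsWithin_of_mem_nhds ((hWo x hx).mem_nhds (hxW x hx))
  rcases t.eq_empty_or_nonempty with rfl | hne
  · have : S = ∅ := by
      have := hSM.trans hcov
      simpa using this
    simp [this]
  obtain ⟨x, hx⟩ := htc.exists_eq_range hne
  have hxt (i : ℕ) : x i ∈ M := htM (hx ▸ mem_range_self i)
  have hcov' : S ⊆ ⋃ i, W (x i) := by
    refine (hSM.trans hcov).trans ?_
    rw [hx]; simp
  -- cut `S` into countably many disjoint pieces, each inside one of the neighbourhoods
  set D := disjointed fun i => W (x i)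
  have hDm (i) : MeasurableSet (S ∩ D i) :=
    hS.inter (MeasurableSet.disjointed (fun i => (hWo _ (hxt i)).measurableSet) i)
  have hdisj : Pairwise (Function.onFun Disjoint fun i => S ∩ D i) := fun i j hij =>
    ((disjoint_disjointed _) hij).mono inter_subset_right inter_subset_right
  have hU : S = ⋃ i, S ∩ D i := by
    rw [← inter_iUnion, iUnion_disjointed, inter_eq_left.2 hcov']
  rw [hU, measure_iUnion hdisj hDm, measure_iUnion hdisj hDm]
  refine ENNReal.tsum_le_tsum fun i => hW _ (hxt i) _ (hDm i) ?_ (inter_subset_left.trans hSM)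
  exact inter_subset_right.trans (disjointed_subset _ i)

end Hypersurface

/-! ### Hypersurfaces as local graphs -/

section LocalGraph

open Module Topology
open scoped NNReal ENNReal

variable {E : Type*} [NormedAddCommGroup E] [InnerProductSpace ℝ E]

/-- `X` has a `C¹` boundary with outward unit normal `ν`: near each boundary point, `X` is the
sublevel set `{ρ < 0}` of a `C¹` function without critical points, and `ν = ∇ρ / |∇ρ|` along the
boundary. -/
def HasUnitNormal [CompleteSpace E] (X : Set E) (ν : E → E) : Prop :=
  ∀ p ∈ frontier X, ∃ (U : Set E) (ρ : E → ℝ), IsOpen U ∧ p ∈ U ∧ ContDiffOn ℝ 1 ρ U ∧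
    X ∩ U = {x ∈ U | ρ x < 0} ∧
    ∀ q ∈ U, gradient ρ q ≠ 0 ∧ (q ∈ frontier X → ν q = ‖gradient ρ q‖⁻¹ • gradient ρ q)

omit [InnerProductSpace ℝ E] in
lemma defining_eq_zero_of_mem_frontier {X U : Set E} {ρ : E → ℝ} (hX : IsOpen X) (hU : IsOpen U)
    (hρ : ContinuousOn ρ U) (h : X ∩ U = {x ∈ U | ρ x < 0}) {q : E} (hq : q ∈ frontier X)
    (hqU : q ∈ U) : ρ q = 0 := by
  rw [hX.frontier_eq] at hq
  have hc : ContinuousAt ρ q := hρ.continuousAt (hU.mem_nhds hqU)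
  apply le_antisymm
  · by_contra! hlt
    have h1 : ∀ᶠ x in 𝓝 q, 0 < ρ x ∧ x ∈ U :=
      (hc.eventually (lt_mem_nhds hlt)).and (hU.mem_nhds hqU)
    obtain ⟨x, ⟨hx1, hx2⟩, hx3⟩ := mem_closure_iff_nhds.1 hq.1 _ h1
    have : x ∈ X ∩ U := ⟨hx3, hx2⟩
    rw [h] at this
    exact lt_asymm hx1 this.2
  · by_contra! hlt
    have : q ∈ X ∩ U := by rw [h]; exact ⟨hqU, hlt⟩
    exact hq.2 this.1

variable [CompleteSpace E]

lemma inner_gradient (ρ : E → ℝ) (p y : E) : inner ℝ (gradient ρ p) y = fderiv ℝ ρ p y := by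
  rw [gradient, InnerProductSpace.toDual_symm_apply]

lemma HasUnitNormal.norm_eq_one {X : Set E} {ν : E → E} (h : HasUnitNormal X ν) {q : E}
    (hq : q ∈ frontier X) : ‖ν q‖ = 1 := by
  obtain ⟨U, ρ, -, hqU, -, -, h1⟩ := h q hq
  obtain ⟨h2, h3⟩ := h1 q hqU
  rw [h3 hq, norm_smul, norm_inv, norm_norm, inv_mul_cancel₀ (norm_ne_zero_iff.2 h2)]

lemma HasUnitNormal.continuousOn {X : Set E} {ν : E → E} (h : HasUnitNormal X ν) :
    ContinuousOn ν (frontier X) := by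
  intro q hq
  obtain ⟨U, ρ, hU, hqU, hρ, -, h1⟩ := h q hq
  have hg : ContinuousAt (gradient ρ) q := by
    have h2 : ContinuousAt (fderiv ℝ ρ) q :=
      ((hρ.continuousOn_fderiv_of_isOpen hU le_rfl).continuousAt (hU.mem_nhds hqU))
    exact (InnerProductSpace.toDual ℝ E).symm.continuous.continuousAt.comp h2
  have h3 : ContinuousAt (fun x => ‖gradient ρ x‖⁻¹ • gradient ρ x) q :=
    (hg.norm.inv₀ (norm_ne_zero_iff.2 (h1 q hqU).1)).smul hg
  refine (h3.continuousWithinAt (s := frontier X)).congr_of_eventuallyEq ?_ ((h1 q hqU).2 hq)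
  filter_upwards [self_mem_nhdsWithin, mem_nhdsWithin_of_mem_nhds (hU.mem_nhds hqU)] with x hx hxU
  exact (h1 x hxU).2 hx

lemma HasUnitNormal.continuousOn_inner {X : Set E} {ν : E → E} (h : HasUnitNormal X ν) (e : E) :
    ContinuousOn (fun x => (inner ℝ e (ν x) : ℝ)) (frontier X) :=
  ContinuousOn.inner continuousOn_const h.continuousOn

/-- Chords of the boundary near `q` are almost orthogonal to the normal at `q`. -/
lemma HasUnitNormal.exists_nhds_abs_inner_le {X : Set E} {ν : E → E} (hX : IsOpen X)
    (h : HasUnitNormal X ν) {q : E} (hq : q ∈ frontier X) {δ : ℝ} (hδ : 0 < δ) :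
    ∃ W ∈ 𝓝 q, ∀ x ∈ W ∩ frontier X, ∀ y ∈ W ∩ frontier X,
      |inner ℝ (ν q) (x - y)| ≤ δ * ‖x - y‖ := by
  obtain ⟨U, ρ, hU, hqU, hρ, hXU, h1⟩ := h q hq
  set N := ‖gradient ρ q‖
  have hN : 0 < N := norm_pos_iff.2 (h1 q hqU).1
  have hs : HasStrictFDerivAt ρ (fderiv ℝ ρ q) q :=
    (hρ.contDiffAt (hU.mem_nhds hqU)).hasStrictFDerivAt one_ne_zero
  obtain ⟨s, hs, happ⟩ := hs.approximates_deriv_on_nhds (c := ⟨δ * N, by positivity⟩)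
    (Or.inr (show (0 : ℝ) < δ * N by positivity))
  refine ⟨s ∩ U, Filter.inter_mem hs (hU.mem_nhds hqU), ?_⟩
  rintro x ⟨⟨hxs, hxU⟩, hx⟩ y ⟨⟨hys, hyU⟩, hy⟩
  have h2 := happ x hxs y hys
  rw [defining_eq_zero_of_mem_frontier hX hU hρ.continuousOn hXU hx hxU,
    defining_eq_zero_of_mem_frontier hX hU hρ.continuousOn hXU hy hyU, sub_zero, zero_sub,
    norm_neg, ← inner_gradient, Real.norm_eq_abs] at h2
  rw [(h1 q hqU).2 hq, inner_smul_left]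
  simp only [map_inv₀, conj_trivial]
  rw [abs_mul, abs_inv, abs_of_pos hN, inv_mul_le_iff₀ hN]
  calc _ ≤ δ * N * ‖x - y‖ := h2
    _ = _ := by ring

/-- The box with axis `e` around `p`: points `p + y + s e` with `y ⟂ e`, `|y| < r`, `|s| < h`. -/
def axisBox (p e : E) (r h : ℝ) : Set E :=
  {x | ‖projAlong e (x - p)‖ < r ∧ |inner ℝ e (x - p)| < h}

/-- The boundary of `X` is, in the box around `p` with axis `e`, the graph over `e^⊥` of the
function `g`, and `X` lies below the graph. The chords of the graph have bounded slope. -/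
structure IsLocalGraph (X : Set E) (ν : E → E) (p e : E) (r h : ℝ)
    (g : (ℝ ∙ e)ᗮ → ℝ) : Prop where
  norm_eq : ‖e‖ = 1
  r_pos : 0 < r
  h_pos : 0 < h
  abs_height_lt : ∀ y, ‖y‖ < r → |g y| < h
  mem_iff : ∀ y : (ℝ ∙ e)ᗮ, ∀ s : ℝ, ‖y‖ < r → |s| < h → (p + y + s • e ∈ X ↔ s < g y)
  frontier_iff : ∀ y : (ℝ ∙ e)ᗮ, ∀ s : ℝ, ‖y‖ < r → |s| < h →
    (p + y + s • e ∈ frontier X ↔ s = g y)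
  lipschitz : ∃ C : ℝ, 0 ≤ C ∧ ∀ x ∈ frontier X ∩ axisBox p e r h,
    ∀ x' ∈ frontier X ∩ axisBox p e r h, ‖x - x'‖ ≤ C * ‖projAlong e (x - x')‖
  inner_pos : ∀ x ∈ frontier X ∩ axisBox p e r h, 0 < inner ℝ e (ν x)

omit [CompleteSpace E] in
lemma continuous_projAlong (e : E) : Continuous (projAlong e) := by
  change Continuous fun x => x - inner ℝ e x • e
  fun_prop

omit [CompleteSpace E] in
lemma isOpen_axisBox (p e : E) (r h : ℝ) : IsOpen (axisBox p e r h) := by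
  have h1 : Continuous fun x => ‖projAlong e (x - p)‖ :=
    ((continuous_projAlong e).comp (continuous_id.sub continuous_const)).norm
  have h2 : Continuous fun x => |inner ℝ e (x - p)| := by fun_prop
  exact (isOpen_lt h1 continuous_const).inter (isOpen_lt h2 continuous_const)

omit [CompleteSpace E] in
lemma mem_axisBox {p e : E} {r h : ℝ} (he : ‖e‖ = 1) (y : (ℝ ∙ e)ᗮ) (s : ℝ) :
    p + y + s • e ∈ axisBox p e r h ↔ ‖y‖ < r ∧ |s| < h := by
  have hy : inner ℝ e (y : E) = 0 := mem_orthogonal_span.1 y.2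
  have h1 : p + y + s • e - p = y + s • e := by abel
  rw [axisBox, mem_ofPred_eq, h1, projAlong_add_smul he, projAlong_of_inner_eq_zero hy,
    inner_add_right, hy, inner_smul_right, real_inner_self_eq_norm_sq, he]
  simp

omit [CompleteSpace E] in
/-- Coordinates `(y, s)` along `e` of a point. -/
lemma exists_eq_add_smul {e : E} (he : ‖e‖ = 1) (p x : E) :
    ∃ (y : (ℝ ∙ e)ᗮ) (s : ℝ), x = p + y + s • e :=
  ⟨⟨projAlong e (x - p), mem_orthogonal_span.2 (inner_projAlong he _)⟩, inner ℝ e (x - p), by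
    simp only [projAlong_apply]; abel⟩

/-- A direction that points out of `X` at `p` is the axis of a local graph. -/
theorem HasUnitNormal.exists_isLocalGraph {X : Set E} {ν : E → E} (hX : IsOpen X)
    (hν : HasUnitNormal X ν) {p e : E} (hp : p ∈ frontier X) (he : ‖e‖ = 1)
    (hpos : 0 < inner ℝ e (ν p)) : ∃ r h g, IsLocalGraph X ν p e r h g := by
  obtain ⟨U, ρ, hU, hpU, hρ, hXU, h1⟩ := hν p hp
  set a := fderiv ℝ ρ p with ha
  set b := a e with hb'
  have hb : 0 < b := by
    rw [(h1 p hpU).2 hp, inner_smul_right, real_inner_comm, inner_gradient] at hpos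
    exact pos_of_mul_pos_right hpos (by positivity)
  have hs : HasStrictFDerivAt ρ a p :=
    (hρ.contDiffAt (hU.mem_nhds hpU)).hasStrictFDerivAt one_ne_zero
  obtain ⟨s, hs, happ⟩ := hs.approximates_deriv_on_nhds (c := ⟨b / 2, by positivity⟩)
    (Or.inr (show (0 : ℝ) < b / 2 by positivity))
  have hpos' : ∀ᶠ x in 𝓝[frontier X] p, 0 < inner ℝ e (ν x) := by
    have h2 : ContinuousWithinAt (fun x => (inner ℝ e (ν x) : ℝ)) (frontier X) p :=
      ContinuousWithinAt.inner continuousWithinAt_const (hν.continuousOn p hp)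
    exact h2.eventually (lt_mem_nhds hpos)
  rw [eventually_nhdsWithin_iff] at hpos'
  obtain ⟨R, hR, hball⟩ := Metric.mem_nhds_iff.1
    (Filter.inter_mem (Filter.inter_mem hs (hU.mem_nhds hpU)) hpos')
  have happ' : ∀ x ∈ Metric.ball p R, ∀ x' ∈ Metric.ball p R,
      |ρ x - ρ x' - a (x - x')| ≤ b / 2 * ‖x - x'‖ := fun x hx x' hx' =>
    happ x (hball hx).1.1 x' (hball hx').1.1
  have hρ0 : ρ p = 0 := defining_eq_zero_of_mem_frontier hX hU hρ.continuousOn hXU hp hpU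
  -- for `|y| < r` the lateral change of `ρ` is smaller than its growth `b h / 2` along the axis
  set h := R / 2 with hh
  obtain ⟨r, hr, hr1, hr2⟩ : ∃ r : ℝ, 0 < r ∧ r < R / 2 ∧ (‖a‖ + b / 2) * r < b / 2 * h := by
    have h3 : 0 < ‖a‖ + b / 2 := by positivity
    refine ⟨min (R / 4) (b / 2 * h / (‖a‖ + b / 2) / 2), by positivity, ?_, ?_⟩
    · exact (min_le_left _ _).trans_lt (by linarith)
    · calc _ ≤ (‖a‖ + b / 2) * (b / 2 * h / (‖a‖ + b / 2) / 2) := by gcongr; exact min_le_right _ _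
        _ = b / 2 * h / 2 := by field_simp
        _ < b / 2 * h := half_lt_self (by positivity)
  have hmemball (y : (ℝ ∙ e)ᗮ) (s : ℝ) (hy : ‖y‖ < r) (hs : |s| ≤ h) :
      p + y + s • e ∈ Metric.ball p R := by
    rw [Metric.mem_ball, dist_eq_norm]
    have : p + y + s • e - p = y + s • e := by abel
    rw [this]
    calc _ ≤ ‖(y : E)‖ + ‖s • e‖ := norm_add_le _ _
      _ = ‖y‖ + |s| := by rw [norm_smul, he, mul_one]; rfl
      _ < R := by linarith
  -- `ρ` increases along the axis with slope at least `b / 2`, hence vanishes at most once per line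
  have hmono (y : (ℝ ∙ e)ᗮ) (s s' : ℝ) (hy : ‖y‖ < r) (hs : |s| ≤ h) (hs' : |s'| ≤ h)
      (hlt : s < s') : ρ (p + y + s • e) < ρ (p + y + s' • e) := by
    have h2 := happ' _ (hmemball y s' hy hs') _ (hmemball y s hy hs)
    have h3 : p + y + s' • e - (p + y + s • e) = (s' - s) • e := by rw [sub_smul]; abel
    rw [h3, map_smul, norm_smul, he, mul_one, smul_eq_mul, ← hb', Real.norm_eq_abs,
      abs_of_pos (by linarith : 0 < s' - s)] at h2
    have h4 := (abs_le.1 h2).1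
    nlinarith
  have hex (y : (ℝ ∙ e)ᗮ) : ∃ s : ℝ, ‖y‖ < r → |s| < h ∧ ρ (p + y + s • e) = 0 := by
    by_cases hy : ‖y‖ < r
    swap
    · exact ⟨0, fun h => absurd h hy⟩
    have hh0 : 0 < h := by positivity
    have habs : |h| = h := abs_of_pos hh0
    have hend (s : ℝ) (hs : |s| ≤ h) : |ρ (p + y + s • e) - ρ (p + s • e)| < b / 2 * h := by
      have h5 := hmemball 0 s (by simpa using hr) hs
      rw [Submodule.coe_zero, add_zero] at h5
      have h2 := happ' _ (hmemball y s hy hs) _ h5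
      have h3 : p + y + s • e - (p + s • e) = y := by abel
      rw [h3] at h2
      have h4 : |a y| ≤ ‖a‖ * ‖(y : E)‖ := a.le_opNorm _
      calc _ ≤ |a y| + b / 2 * ‖(y : E)‖ := by
            have := abs_sub_abs_le_abs_sub (ρ (p + y + s • e) - ρ (p + s • e)) (a y)
            linarith
        _ ≤ (‖a‖ + b / 2) * ‖(y : E)‖ := by linarith
        _ ≤ (‖a‖ + b / 2) * r := by gcongr; exact hy.le
        _ < _ := hr2
    have hpaxis (s : ℝ) (hs : |s| ≤ h) : |ρ (p + s • e) - s * b| ≤ b / 2 * |s| := by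
      have h5 := hmemball 0 s (by simpa using hr) hs
      rw [Submodule.coe_zero, add_zero] at h5
      have h2 := happ' _ h5 _ (Metric.mem_ball_self hR)
      rw [add_sub_cancel_left, hρ0, sub_zero, map_smul, norm_smul, he, mul_one, smul_eq_mul] at h2
      exact h2
    have hup : 0 < ρ (p + y + h • e) := by
      have h2 := (abs_lt.1 (hend h habs.le)).1
      have h3 := (abs_le.1 (hpaxis h habs.le)).1
      rw [habs] at h3
      linarith
    have hlow : ρ (p + y + (-h) • e) < 0 := by
      have h2 := (abs_lt.1 (hend (-h) (by rw [abs_neg, habs]))).2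
      have h3 := (abs_le.1 (hpaxis (-h) (by rw [abs_neg, habs]))).2
      rw [abs_neg, habs] at h3
      linarith
    have hcont : ContinuousOn (fun s : ℝ => ρ (p + y + s • e)) (Icc (-h) h) := by
      refine hρ.continuousOn.comp (by fun_prop) fun s hs => ?_
      exact (hball (hmemball y s hy (abs_le.2 hs))).1.2
    obtain ⟨s, hs, hs0⟩ := intermediate_value_Icc (by linarith : -h ≤ h) hcont
      (show (0 : ℝ) ∈ Icc _ _ from ⟨hlow.le, hup.le⟩)
    refine ⟨s, fun _ => ⟨abs_lt.2 ⟨lt_of_le_of_ne hs.1 ?_, lt_of_le_of_ne hs.2 ?_⟩, hs0⟩⟩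
    · rintro rfl; exact hlow.ne hs0
    · rintro rfl; exact hup.ne' hs0
  choose g hg using hex
  have hmem (y : (ℝ ∙ e)ᗮ) (s : ℝ) (hy : ‖y‖ < r) (hs : |s| < h) :
      p + y + s • e ∈ X ↔ s < g y := by
    have hxU := (hball (hmemball y s hy hs.le)).1.2
    have h2 : p + y + s • e ∈ X ↔ ρ (p + y + s • e) < 0 := by
      have := Set.ext_iff.1 hXU (p + y + s • e)
      simpa [hxU] using this
    rw [h2]
    obtain ⟨hg1, hg2⟩ := hg y hy
    rcases lt_trichotomy s (g y) with hlt | heq | hgt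
    · exact ⟨fun _ => hlt, fun _ => hg2 ▸ hmono y s (g y) hy hs.le hg1.le hlt⟩
    · simp [heq, hg2]
    · exact ⟨fun h5 => absurd (hg2 ▸ hmono y (g y) s hy hg1.le hs.le hgt) (not_lt.2 h5.le),
        fun h5 => absurd h5 (not_lt.2 hgt.le)⟩
  have hbox : axisBox p e r h ⊆ Metric.ball p R := by
    intro x hx
    obtain ⟨y, s, rfl⟩ := exists_eq_add_smul he p x
    obtain ⟨h2, h3⟩ := (mem_axisBox he y s).1 hx
    exact hmemball y s h2 h3.le
  refine ⟨r, h, g, he, hr, by positivity, fun y hy => (hg y hy).1, hmem, ?_, ?_, ?_⟩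
  · intro y s hy hs
    obtain ⟨hg1, hg2⟩ := hg y hy
    constructor
    · intro hfr
      have hxU := (hball (hmemball y s hy hs.le)).1.2
      have h0 := defining_eq_zero_of_mem_frontier hX hU hρ.continuousOn hXU hfr hxU
      rcases lt_trichotomy s (g y) with hlt | heq | hgt
      · have := hmono y s (g y) hy hs.le hg1.le hlt
        rw [h0, hg2] at this; exact absurd this (lt_irrefl _)
      · exact heq
      · have := hmono y (g y) s hy hg1.le hs.le hgt
        rw [h0, hg2] at this; exact absurd this (lt_irrefl _)
    · rintro rfl
      rw [hX.frontier_eq]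
      refine ⟨?_, fun h5 => lt_irrefl _ ((hmem y _ hy hs).1 h5)⟩
      have hcw : ContinuousWithinAt (fun s : ℝ => p + y + s • e) (Ioo (-h) (g y)) (g y) :=
        Continuous.continuousWithinAt (by fun_prop)
      refine hcw.mem_closure ?_ ?_
      · rw [closure_Ioo (abs_lt.1 hg1).1.ne]
        exact right_mem_Icc.2 (abs_lt.1 hg1).1.le
      · intro s hs'
        exact (hmem y s hy (abs_lt.2 ⟨hs'.1, hs'.2.trans (abs_lt.1 hg1).2⟩)).2 hs'.2
  · refine ⟨1 + (‖a‖ + b / 2) / (b / 2), by positivity, ?_⟩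
    rintro x ⟨hx, hxb⟩ x' ⟨hx', hxb'⟩
    have h2 := happ' x (hbox hxb) x' (hbox hxb')
    rw [defining_eq_zero_of_mem_frontier hX hU hρ.continuousOn hXU hx (hball (hbox hxb)).1.2,
      defining_eq_zero_of_mem_frontier hX hU hρ.continuousOn hXU hx' (hball (hbox hxb')).1.2] at h2
    set d := x - x'
    set z := projAlong e d with hz
    set τ := inner ℝ e d
    have hd : d = z + τ • e := by simp [hz, projAlong_apply, τ]
    have hdn : ‖d‖ ≤ ‖z‖ + |τ| := by
      conv_lhs => rw [hd]
      refine (norm_add_le _ _).trans_eq ?_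
      rw [norm_smul, he, mul_one, Real.norm_eq_abs]
    have had : a d = a z + τ * b := by
      conv_lhs => rw [hd]
      rw [map_add, map_smul, smul_eq_mul]
    have haz : |a z| ≤ ‖a‖ * ‖z‖ := a.le_opNorm _
    have h6 : |τ| * b ≤ ‖a‖ * ‖z‖ + b / 2 * (‖z‖ + |τ|) := by
      have h7 : |τ * b| ≤ |a d| + |a z| := by
        have : τ * b = a d - a z := by rw [had]; ring
        rw [this]; exact abs_sub _ _
      rw [abs_mul, abs_of_pos hb] at h7
      rw [sub_zero, zero_sub, abs_neg] at h2
      have : b / 2 * ‖d‖ ≤ b / 2 * (‖z‖ + |τ|) := by gcongr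
      linarith
    have h8 : |τ| ≤ (‖a‖ + b / 2) / (b / 2) * ‖z‖ := by
      rw [div_mul_eq_mul_div, le_div_iff₀ (by positivity)]
      linarith
    linarith
  · rintro x ⟨hx, hxb⟩
    exact (hball (hbox hxb)).2 hx

end LocalGraph

/-! ### The area formula for graphs and the flux along the axis -/

section Flux

open Module Topology
open scoped NNReal ENNReal

variable {E : Type*} [NormedAddCommGroup E] [InnerProductSpace ℝ E] [CompleteSpace E]

/-- The parametrization `y ↦ p + y + g(y) e` of the graph of `g` over `e^⊥`. -/
def graphMap (p e : E) (g : (ℝ ∙ e)ᗮ → ℝ) (y : (ℝ ∙ e)ᗮ) : E := p + y + g y • e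

namespace IsLocalGraph

variable {X : Set E} {ν : E → E} {p e : E} {r h : ℝ} {g : (ℝ ∙ e)ᗮ → ℝ}

omit [CompleteSpace E] in
lemma projAlong_graphMap (H : IsLocalGraph X ν p e r h g) (y : (ℝ ∙ e)ᗮ) :
    projAlong e (graphMap p e g y) = projAlong e p + y := by
  rw [graphMap, projAlong_add_smul H.norm_eq, map_add,
    projAlong_of_inner_eq_zero (mem_orthogonal_span.1 y.2)]

omit [CompleteSpace E] in
lemma graphMap_mem (H : IsLocalGraph X ν p e r h g) {y : (ℝ ∙ e)ᗮ} (hy : ‖y‖ < r) :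
    graphMap p e g y ∈ frontier X ∩ axisBox p e r h :=
  ⟨(H.frontier_iff y _ hy (H.abs_height_lt y hy)).2 rfl,
    (mem_axisBox H.norm_eq y _).2 ⟨hy, H.abs_height_lt y hy⟩⟩

omit [CompleteSpace E] in
lemma exists_graphMap_eq (H : IsLocalGraph X ν p e r h g) {x : E}
    (hx : x ∈ frontier X ∩ axisBox p e r h) : ∃ y, ‖y‖ < r ∧ graphMap p e g y = x := by
  obtain ⟨y, s, rfl⟩ := exists_eq_add_smul H.norm_eq p x
  obtain ⟨h1, h2⟩ := (mem_axisBox H.norm_eq y s).1 hx.2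
  exact ⟨y, h1, by rw [graphMap, (H.frontier_iff y s h1 h2).1 hx.1]⟩

omit [CompleteSpace E] in
lemma continuousOn_graphMap (H : IsLocalGraph X ν p e r h g) :
    ContinuousOn (graphMap p e g) (Metric.ball 0 r) := by
  obtain ⟨C, hC, hL⟩ := H.lipschitz
  have : LipschitzOnWith ⟨C, hC⟩ (graphMap p e g) (Metric.ball 0 r) := by
    apply LipschitzOnWith.of_dist_le_mul
    intro y hy y' hy'
    rw [mem_ball_zero_iff] at hy hy'
    have := hL _ (H.graphMap_mem hy) _ (H.graphMap_mem hy')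
    rw [map_sub, H.projAlong_graphMap, H.projAlong_graphMap, add_sub_add_left_eq_sub] at this
    rw [dist_eq_norm, dist_eq_norm]
    exact this
  exact this.continuousOn

variable [FiniteDimensional ℝ E] [MeasurableSpace E] [BorelSpace E]

omit [CompleteSpace E] [FiniteDimensional ℝ E] in
lemma measurableSet_piece : MeasurableSet (frontier X ∩ axisBox p e r h) :=
  isClosed_frontier.measurableSet.inter (isOpen_axisBox p e r h).measurableSet

omit [CompleteSpace E] in
lemma aemeasurable_graphMap (H : IsLocalGraph X ν p e r h g) :
    AEMeasurable (graphMap p e g) (volume.restrict (Metric.ball 0 r)) :=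
  H.continuousOn_graphMap.aemeasurable measurableSet_ball

omit [CompleteSpace E] in
lemma map_graphMap_apply (H : IsLocalGraph X ν p e r h g) {S : Set E} (hS : MeasurableSet S)
    (hSM : S ⊆ frontier X ∩ axisBox p e r h) :
    (volume.restrict (Metric.ball 0 r)).map (graphMap p e g) S =
      μHE[finrank ℝ E - 1] (projAlong e '' S) := by
  have himg : projAlong e '' S = (fun x => projAlong e p + x) ''
      (Subtype.val '' (graphMap p e g ⁻¹' S ∩ Metric.ball 0 r)) := by
    ext z
    simp only [mem_image, exists_exists_and_eq_and, mem_inter_iff, mem_preimage,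
      mem_ball_zero_iff]
    constructor
    · rintro ⟨x, hx, rfl⟩
      obtain ⟨y, hy, rfl⟩ := H.exists_graphMap_eq (hSM hx)
      exact ⟨y, ⟨hx, hy⟩, (H.projAlong_graphMap y).symm⟩
    · rintro ⟨y, ⟨hx, hy⟩, rfl⟩
      exact ⟨_, hx, H.projAlong_graphMap y⟩
  have h2 : Isometry (Subtype.val : (ℝ ∙ e)ᗮ → E) := isometry_subtype_coe
  have h1 : Isometry (fun x : E => projAlong e p + x) := isometry_add_left _
  rw [himg, h1.euclideanHausdorffMeasure_image, h2.euclideanHausdorffMeasure_image,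
    ← finrank_orthogonal_unit H.norm_eq, InnerProductSpace.euclideanHausdorffMeasure_eq_volume,
    Measure.map_apply_of_aemeasurable H.aemeasurable_graphMap hS,
    Measure.restrict_apply' measurableSet_ball]

omit [CompleteSpace E] in
lemma measure_piece_lt_top (H : IsLocalGraph X ν p e r h g) :
    μHE[finrank ℝ E - 1] (frontier X ∩ axisBox p e r h) < ⊤ := by
  obtain ⟨C, hC, hL⟩ := H.lipschitz
  have h1 := hausdorffMeasure_image_le_of_norm_le (f := id) (g := projAlong e) hC
    (fun x hx y hy => by simpa [← map_sub] using hL x hx y hy) (finrank ℝ E - 1)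
  rw [image_id] at h1
  refine h1.trans_lt (ENNReal.mul_lt_top ENNReal.ofReal_lt_top ?_)
  rw [← H.map_graphMap_apply measurableSet_piece Subset.rfl]
  refine (measure_mono (subset_univ _)).trans_lt ?_
  rw [Measure.map_apply_of_aemeasurable H.aemeasurable_graphMap MeasurableSet.univ, preimage_univ,
    Measure.restrict_apply_univ]
  exact measure_ball_lt_top

/-- Area formula for graphs: the projection of the boundary piece along `e` has Jacobian
`⟪e, ν⟫`. -/
theorem withDensity_eq_map (hX : IsOpen X) (hν : HasUnitNormal X ν)
    (H : IsLocalGraph X ν p e r h g) :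
    (μHE[finrank ℝ E - 1].restrict (frontier X ∩ axisBox p e r h)).withDensity
        (fun x => ENNReal.ofReal (inner ℝ e (ν x))) =
      (volume.restrict (Metric.ball 0 r)).map (graphMap p e g) := by
  set m := finrank ℝ E - 1
  set M := frontier X ∩ axisBox p e r h
  set c : E → ℝ := fun x => inner ℝ e (ν x)
  set α := (μHE[m].restrict M).withDensity (fun x => ENNReal.ofReal (c x))
  set β := (volume.restrict (Metric.ball 0 r)).map (graphMap p e g)
  have hMm : MeasurableSet M := measurableSet_piece
  have hα (S : Set E) (hS : MeasurableSet S) (hSM : S ⊆ M) :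
      α S = ∫⁻ x in S, ENNReal.ofReal (c x) ∂μHE[m] := by
    rw [withDensity_apply _ hS, Measure.restrict_restrict hS, inter_eq_left.2 hSM]
  -- comparison near a point, up to a factor `η²`
  have hloc (η : ℝ) (hη : 1 < η) (q : E) (hq : q ∈ M) : ∃ W ∈ 𝓝 q, ∀ S, MeasurableSet S →
      S ⊆ W → S ⊆ M → α S ≤ ENNReal.ofReal (η ^ 2) * β S ∧
        β S ≤ ENNReal.ofReal (η ^ 2) * α S := by
    have hcq : 0 < c q := H.inner_pos q hq
    obtain ⟨δ, hδ, hb⟩ := exists_hausdorffMeasure_projAlong_image_bounds H.norm_eq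
      (hν.norm_eq_one hq.1) hcq hη
    obtain ⟨W, hW, hWc⟩ := hν.exists_nhds_abs_inner_le hX hq.1 hδ
    have hcc : ContinuousWithinAt c (frontier X) q :=
      ContinuousWithinAt.inner continuousWithinAt_const (hν.continuousOn q hq.1)
    have e1 : ∀ᶠ x in 𝓝[frontier X] q, c x < η * c q ∧ c q < η * c x := by
      refine (hcc.eventually (gt_mem_nhds ?_)).and
        ((continuousWithinAt_const.mul hcc).eventually (lt_mem_nhds ?_))
      · nlinarith
      · change c q < η * c q
        nlinarith
    rw [eventually_nhdsWithin_iff] at e1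
    refine ⟨W ∩ _, Filter.inter_mem hW e1, fun S hS hSW hSM => ?_⟩
    obtain ⟨b1, b2⟩ := hb S fun x hx y hy =>
      hWc x ⟨(hSW hx).1, (hSM hx).1⟩ y ⟨(hSW hy).1, (hSM hy).1⟩
    rw [← H.map_graphMap_apply hS hSM] at b1 b2
    have hη0 : 0 ≤ η := by linarith
    have hc1 (x) (hx : x ∈ S) : ENNReal.ofReal (c x) ≤ ENNReal.ofReal η * ENNReal.ofReal (c q) := by
      rw [← ENNReal.ofReal_mul hη0]
      exact ENNReal.ofReal_le_ofReal ((hSW hx).2 (hSM hx).1).1.le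
    have hc2 (x) (hx : x ∈ S) : ENNReal.ofReal (c q) ≤ ENNReal.ofReal η * ENNReal.ofReal (c x) := by
      rw [← ENNReal.ofReal_mul hη0]
      exact ENNReal.ofReal_le_ofReal ((hSW hx).2 (hSM hx).1).2.le
    rw [pow_two, ENNReal.ofReal_mul hη0, mul_assoc, mul_assoc]
    constructor
    · calc α S = ∫⁻ x in S, ENNReal.ofReal (c x) ∂μHE[m] := hα S hS hSM
        _ ≤ ∫⁻ x in S, ENNReal.ofReal η * ENNReal.ofReal (c q) ∂μHE[m] :=
          setLIntegral_mono' hS hc1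
        _ = ENNReal.ofReal η * (ENNReal.ofReal (c q) * μHE[m] S) := by
          rw [setLIntegral_const, mul_assoc]
        _ ≤ _ := by gcongr _ * ?_
    · refine b1.trans ?_
      gcongr _ * ?_
      rw [hα S hS hSM, ← lintegral_const_mul' _ _ ENNReal.ofReal_ne_top, ← setLIntegral_const]
      exact setLIntegral_mono' hS hc2
  -- let `η → 1`
  have hlim (x : ℝ≥0∞) :
      Filter.Tendsto (fun η : ℝ => ENNReal.ofReal (η ^ 2) * x) (𝓝[>] 1) (𝓝 x) := by
    have h1 : Filter.Tendsto (fun η : ℝ => ENNReal.ofReal (η ^ 2)) (𝓝[>] 1) (𝓝 1) := by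
      have : ContinuousAt (fun η : ℝ => ENNReal.ofReal (η ^ 2)) 1 :=
        (ENNReal.continuous_ofReal.comp (continuous_pow 2)).continuousAt
      have := this.tendsto
      rw [one_pow, ENNReal.ofReal_one] at this
      exact this.mono_left nhdsWithin_le_nhds
    have := ENNReal.Tendsto.mul_const (b := x) h1 (Or.inl one_ne_zero)
    rwa [one_mul] at this
  have hle1 (S : Set E) (hS : MeasurableSet S) (hSM : S ⊆ M) : α S ≤ β S := by
    refine ge_of_tendsto (hlim (β S)) ?_
    filter_upwards [self_mem_nhdsWithin] with η hη
    have := measure_le_of_forall_exists_nhds (α := α) (β := ENNReal.ofReal (η ^ 2) • β) (M := M)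
      (fun q hq => by
        obtain ⟨W, hW, hWS⟩ := hloc η hη q hq
        exact ⟨W, hW, fun S h1 h2 h3 => (hWS S h1 h2 h3).1⟩) hS hSM
    simpa using this
  have hle2 (S : Set E) (hS : MeasurableSet S) (hSM : S ⊆ M) : β S ≤ α S := by
    refine ge_of_tendsto (hlim (α S)) ?_
    filter_upwards [self_mem_nhdsWithin] with η hη
    have := measure_le_of_forall_exists_nhds (α := β) (β := ENNReal.ofReal (η ^ 2) • α) (M := M)
      (fun q hq => by
        obtain ⟨W, hW, hWS⟩ := hloc η hη q hq
        exact ⟨W, hW, fun S h1 h2 h3 => (hWS S h1 h2 h3).2⟩) hS hSM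
    simpa using this
  ext S hS
  have hα0 : α (S \ M) = 0 := by
    rw [withDensity_apply _ (hS.diff hMm), Measure.restrict_restrict (hS.diff hMm)]
    simp
  have hβ0 : β (S \ M) = 0 := by
    rw [Measure.map_apply_of_aemeasurable H.aemeasurable_graphMap (hS.diff hMm),
      Measure.restrict_apply' measurableSet_ball]
    convert! measure_empty (μ := (volume : Measure (ℝ ∙ e)ᗮ))
    ext y
    simp only [mem_inter_iff, mem_preimage, mem_sdiff, mem_ball_zero_iff, mem_empty_iff_false,
      iff_false, not_and]
    exact fun h1 h2 => h1.2 (H.graphMap_mem h2)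
  rw [← measure_inter_add_sdiff (μ := α) S hMm, ← measure_inter_add_sdiff (μ := β) S hMm,
    hα0, hβ0, add_zero, add_zero]
  exact le_antisymm (hle1 _ (hS.inter hMm) inter_subset_right)
    (hle2 _ (hS.inter hMm) inter_subset_right)

end IsLocalGraph

variable [FiniteDimensional ℝ E] [MeasurableSpace E] [BorelSpace E]

/-- Orthogonal coordinates around `p` with axis `e`: the pair `(y, s)` stands for `p + y + s e`. -/
def axisCoord (p : E) {e : E} (he : ‖e‖ = 1) : ((ℝ ∙ e)ᗮ × ℝ) ≃ᵐ E :=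
  MeasurableEquiv.prodComm.trans
    (((LinearIsometryEquiv.toSpanUnitSingleton e he).toMeasurableEquiv.prodCongr
      (MeasurableEquiv.refl _)).trans ((ℝ ∙ e).measurableEquivProd p).symm)

omit [CompleteSpace E] in
lemma axisCoord_apply (p : E) {e : E} (he : ‖e‖ = 1) (z : (ℝ ∙ e)ᗮ × ℝ) :
    axisCoord p he z = p + z.1 + z.2 • e := by
  have : axisCoord p he z = ((ℝ ∙ e).measurableEquivProd p).symm
      (LinearIsometryEquiv.toSpanUnitSingleton e he z.2, z.1) := rfl
  rw [this, Submodule.measurableEquivProd_symm_apply]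
  simp [vadd_eq_add]
  abel

omit [CompleteSpace E] in
lemma measurePreserving_axisCoord (p : E) {e : E} (he : ‖e‖ = 1) :
    MeasurePreserving (axisCoord p he) (volume.prod volume) volume := by
  have h1 := (ℝ ∙ e).measurePreserving_measurableEquivProd p
  rw [InnerProductSpace.euclideanHausdorffMeasure_eq_volume] at h1
  have h2 := (LinearIsometryEquiv.toSpanUnitSingleton e he).measurePreserving
  exact h1.symm.comp ((h2.prod (MeasurePreserving.id _)).comp Measure.measurePreserving_swap)

/-- Flux formula for the axis direction of a local graph. -/
theorem IsLocalGraph.integral_lineDeriv {X : Set E} {ν : E → E} {p e : E} {r h : ℝ}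
    {g : (ℝ ∙ e)ᗮ → ℝ} (hX : IsOpen X) (hν : HasUnitNormal X ν) (H : IsLocalGraph X ν p e r h g)
    {f f' : E → ℂ} (hf : ContinuousOn f (closure X)) (hf' : IntegrableOn f' X)
    (hd : ∀ x ∈ X, HasLineDerivAt ℝ f (f' x) x e)
    (h0 : ∀ x ∈ closure X, x ∉ axisBox p e r h → f x = 0)
    (h0' : ∀ x ∈ X, x ∉ axisBox p e r h → f' x = 0) :
    ∫ x in X, f' x =
      ∫ x in frontier X, (inner ℝ e (ν x) : ℝ) • f x ∂μHE[finrank ℝ E - 1] := by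
  have he := H.norm_eq
  have hcl : closure X = X ∪ frontier X := closure_eq_self_union_frontier X
  set m := finrank ℝ E - 1
  set M := frontier X ∩ axisBox p e r h with hM
  have hMm : MeasurableSet M := measurableSet_piece
  -- Fubini along the axis
  have hint : Integrable (fun z => X.indicator f' (axisCoord p he z)) (volume.prod volume) :=
    (measurePreserving_axisCoord p he).integrable_comp_emb (axisCoord p he).measurableEmbedding
      |>.2 ((integrable_indicator_iff hX.measurableSet).2 hf')
  have hL : ∫ x in X, f' x =
      ∫ y : (ℝ ∙ e)ᗮ, ∫ s : ℝ, X.indicator f' (p + y + s • e) := by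
    rw [← integral_indicator hX.measurableSet,
      ← (measurePreserving_axisCoord p he).integral_comp', integral_prod _ hint]
    simp only [axisCoord_apply]
  have hinner : ∀ᵐ y : (ℝ ∙ e)ᗮ, ∫ s : ℝ, X.indicator f' (p + y + s • e) =
      (Metric.ball 0 r).indicator (fun y => f (graphMap p e g y)) y := by
    filter_upwards [hint.prod_right_ae] with y hy
    simp only [axisCoord_apply] at hy
    by_cases hyr : ‖y‖ < r
    · rw [indicator_of_mem (mem_ball_zero_iff.2 hyr)]
      have hg := H.abs_height_lt y hyr
      have hlt : -h < g y := (abs_lt.1 hg).1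
      have hIoo (s : ℝ) (hs : s ∈ Ioo (-h) (g y)) : p + y + s • e ∈ X :=
        (H.mem_iff y s hyr (abs_lt.2 ⟨hs.1, hs.2.trans (abs_lt.1 hg).2⟩)).2 hs.2
      have hEq : (fun s : ℝ => X.indicator f' (p + y + s • e)) =
          (Ioo (-h) (g y)).indicator (fun s => X.indicator f' (p + y + s • e)) := by
        funext s
        by_cases hs : s ∈ Ioo (-h) (g y)
        · rw [indicator_of_mem hs]
        · rw [indicator_of_notMem hs]
          by_cases hxX : p + y + s • e ∈ X
          · rw [indicator_of_mem hxX]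
            by_cases hsh : |s| < h
            · exact absurd ⟨(abs_lt.1 hsh).1, (H.mem_iff y s hyr hsh).1 hxX⟩ hs
            · exact h0' _ hxX fun hb => hsh ((mem_axisBox he y s).1 hb).2
          · rw [indicator_of_notMem hxX]
      have hIcc (s : ℝ) (hs : s ∈ Icc (-h) (g y)) : p + y + s • e ∈ closure X := by
        have hcw : ContinuousWithinAt (fun s : ℝ => p + y + s • e) (Ioo (-h) (g y)) s :=
          Continuous.continuousWithinAt (by fun_prop)
        refine hcw.mem_closure ?_ hIoo
        rwa [closure_Ioo hlt.ne]
      rw [hEq, integral_indicator measurableSet_Ioo, ← integral_Ioc_eq_integral_Ioo,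
        ← intervalIntegral.integral_of_le hlt.le,
        intervalIntegral.integral_eq_sub_of_hasDerivAt_of_le (f := fun s : ℝ => f (p + y + s • e))
          hlt.le]
      · have h1 : f (p + y + (-h) • e) = 0 := by
          refine h0 _ (hIcc _ (left_mem_Icc.2 hlt.le)) fun hb => ?_
          have := ((mem_axisBox he y (-h)).1 hb).2
          rw [abs_neg, abs_of_pos H.h_pos] at this
          exact lt_irrefl _ this
        rw [h1, sub_zero, graphMap]
      · exact hf.comp (by fun_prop) hIcc
      · intro s hs
        rw [indicator_of_mem (hIoo s hs)]
        have h1 := hd _ (hIoo s hs)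
        rw [HasLineDerivAt] at h1
        have h2 : HasDerivAt (fun t : ℝ => t - s) 1 s := (hasDerivAt_id s).sub_const s
        have h3 := HasDerivAt.scomp (h := fun t : ℝ => t - s) s (by simpa using h1) h2
        rw [one_smul] at h3
        refine h3.congr_of_eventuallyEq (Filter.Eventually.of_forall fun t => ?_)
        simp only [Function.comp_apply, sub_smul]
        congr 1
        abel
      · exact hy.intervalIntegrable
    · rw [indicator_of_notMem (by simpa using hyr)]
      have : ∀ s : ℝ, X.indicator f' (p + y + s • e) = 0 := by
        intro s
        by_cases hxX : p + y + s • e ∈ X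
        · rw [indicator_of_mem hxX]
          exact h0' _ hxX fun hb => hyr ((mem_axisBox he y s).1 hb).1
        · rw [indicator_of_notMem hxX]
      simp [this]
  -- the boundary side
  have hνc : ContinuousOn (fun x => (inner ℝ e (ν x) : ℝ)) M :=
    (hν.continuousOn_inner e).mono inter_subset_left
  have hfM : ContinuousOn f M := hf.mono (inter_subset_left.trans frontier_subset_closure)
  have hdens : AEMeasurable (fun x => ENNReal.ofReal (inner ℝ e (ν x))) (μHE[m].restrict M) :=
    (hνc.aemeasurable hMm).ennreal_ofReal
  have hmap := IsLocalGraph.withDensity_eq_map hX hν H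
  have hfm : AEStronglyMeasurable f
      ((volume.restrict (Metric.ball 0 r)).map (graphMap p e g)) := by
    rw [← hmap]
    exact (hfM.aestronglyMeasurable hMm).mono_ac (withDensity_absolutelyContinuous _ _)
  rw [hL, integral_congr_ae hinner, integral_indicator measurableSet_ball,
    ← integral_map H.aemeasurable_graphMap hfm, ← hmap,
    integral_withDensity_eq_integral_toReal_smul₀ hdens (by simp)]
  have h1 : ∫ x in M, (ENNReal.ofReal (inner ℝ e (ν x))).toReal • f x ∂μHE[m] =
      ∫ x in M, (inner ℝ e (ν x) : ℝ) • f x ∂μHE[m] := by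
    refine setIntegral_congr_fun hMm fun x hx => ?_
    rw [ENNReal.toReal_ofReal (H.inner_pos x hx).le]
  rw [h1]
  refine (setIntegral_eq_of_subset_of_forall_sdiff_eq_zero isClosed_frontier.measurableSet
    inter_subset_left fun x hx => ?_).symm
  rw [h0 x (frontier_subset_closure hx.1) fun hb => hx.2 ⟨hx.1, hb⟩, smul_zero]

end Flux

/-! ### The divergence theorem -/

section Divergence

open Module Topology
open scoped NNReal ENNReal

variable {E : Type*} [NormedAddCommGroup E] [InnerProductSpace ℝ E] [CompleteSpace E]
  {X : Set E} {ν : E → E}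

/-- The open half-space of inward vectors is tangent to `X` at a boundary point. -/
lemma HasUnitNormal.mem_tangentConeAt (hν : HasUnitNormal X ν) (hX : IsOpen X) {p w : E}
    (hp : p ∈ frontier X) (hw : inner ℝ (ν p) w < 0) : w ∈ tangentConeAt ℝ X p := by
  obtain ⟨U, ρ, hU, hpU, hρ, hXU, h1⟩ := hν p hp
  have h2 : fderiv ℝ ρ p w < 0 := by
    rw [(h1 p hpU).2 hp, inner_smul_left, inner_gradient] at hw
    exact neg_of_mul_neg_right hw (by simp)
  have hρ0 : ρ p = 0 := defining_eq_zero_of_mem_frontier hX hU hρ.continuousOn hXU hp hpU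
  have h3 : HasDerivAt (fun t : ℝ => ρ (p + t • w)) (fderiv ℝ ρ p w) 0 := by
    have hd : HasFDerivAt ρ (fderiv ℝ ρ p) p :=
      ((hρ.contDiffAt (hU.mem_nhds hpU)).differentiableAt one_ne_zero).hasFDerivAt
    exact (hd.hasLineDerivAt w)
  have h4 : ∀ᶠ t : ℝ in 𝓝[>] 0, p + t • w ∈ X := by
    have h5 := (h3.tendsto_slope.mono_left
      (nhdsWithin_mono (0 : ℝ) (fun t (ht : 0 < t) => ht.ne'))).eventually (gt_mem_nhds h2)
    have h6 : ∀ᶠ t : ℝ in 𝓝[>] 0, p + t • w ∈ U := by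
      have : ContinuousAt (fun t : ℝ => p + t • w) 0 := by fun_prop
      refine (this.eventually (hU.mem_nhds (by simpa using hpU))).filter_mono nhdsWithin_le_nhds
    filter_upwards [h5, h6, self_mem_nhdsWithin] with t h5 h6 ht
    rw [slope_def_field, zero_smul, add_zero, hρ0, sub_zero, sub_zero, div_neg_iff] at h5
    have : p + t • w ∈ X ∩ U := by
      rw [hXU]
      refine ⟨h6, ?_⟩
      rcases h5 with h | h
      · exact absurd h.2 (not_lt.2 (le_of_lt ht))
      · exact h.1
    exact this.1
  refine mem_tangentConeAt_of_add_smul_mem (l := 𝓝[>] (0 : ℝ)) (c := id) ?_ h4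
  exact Filter.tendsto_id.mono_left (nhdsWithin_mono _ fun t (ht : 0 < t) => ht.ne')

/-- Derivatives up to the boundary are unique, since inward vectors span the whole space. -/
lemma HasUnitNormal.uniqueDiffOn_closure (hν : HasUnitNormal X ν) (hX : IsOpen X) :
    UniqueDiffOn ℝ (closure X) := by
  intro p hp
  refine UniqueDiffWithinAt.closure ?_
  by_cases hpX : p ∈ X
  · exact hX.uniqueDiffWithinAt hpX
  have hpf : p ∈ frontier X := by rw [hX.frontier_eq]; exact ⟨hp, hpX⟩
  refine ⟨?_, hp⟩
  suffices h : Submodule.span ℝ (tangentConeAt ℝ X p) = ⊤ by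
    rw [h]; exact dense_univ
  refine eq_top_iff.2 fun v _ => ?_
  have hn := hν.norm_eq_one hpf
  set t : ℝ := |inner ℝ (ν p) v| + 1
  have h1 : -(t • ν p) ∈ tangentConeAt ℝ X p := by
    refine hν.mem_tangentConeAt hX hpf ?_
    rw [inner_neg_right, inner_smul_right, real_inner_self_eq_norm_sq, hn]
    have : 0 < t := by positivity
    linarith
  have h2 : v - t • ν p ∈ tangentConeAt ℝ X p := by
    refine hν.mem_tangentConeAt hX hpf ?_
    rw [inner_sub_right, inner_smul_right, real_inner_self_eq_norm_sq, hn]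
    have := le_abs_self (inner ℝ (ν p) v : ℝ)
    simp only [t]
    linarith
  have h3 : v = (v - t • ν p) - -(t • ν p) := by abel
  rw [h3]
  exact Submodule.sub_mem _ (Submodule.subset_span h2) (Submodule.subset_span h1)

/-- Vectors orthogonal to the normal are tangent to the boundary. -/
lemma HasUnitNormal.mem_tangentConeAt_frontier (hν : HasUnitNormal X ν) (hX : IsOpen X) {p w : E}
    (hp : p ∈ frontier X) (hw : inner ℝ (ν p) w = 0) : w ∈ tangentConeAt ℝ (frontier X) p := by
  have he := hν.norm_eq_one hp
  have hee : 0 < inner ℝ (ν p) (ν p) := by rw [real_inner_self_eq_norm_sq, he]; norm_num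
  -- in the graph coordinates with axis `ν p`, the height `g` is `o(t)` along `y = t w`
  set e := ν p with hed
  obtain ⟨r, h, g, H⟩ := hν.exists_isLocalGraph (e := e) hX hp he hee
  let y (t : ℝ) : (ℝ ∙ e)ᗮ := t • ⟨w, mem_orthogonal_span.2 hw⟩
  have hy (t : ℝ) : (y t : E) = t • w := rfl
  have hy0 : ∀ᶠ t in 𝓝 (0 : ℝ), ‖y t‖ < r := by
    have : Continuous fun t => ‖y t‖ := by fun_prop
    exact (this.tendsto' 0 0 (by simp [y])).eventually (gt_mem_nhds H.r_pos)
  have hg0 : g 0 = 0 := by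
    have := (H.frontier_iff 0 0 (by simpa using H.r_pos) (by simpa using H.h_pos)).1 (by simpa)
    exact this.symm
  have hG0 : graphMap p e g 0 = p := by simp [graphMap, hg0]
  obtain ⟨C, hC, hL⟩ := H.lipschitz
  have hGc : Filter.Tendsto (fun t => graphMap p e g (y t)) (𝓝 0) (𝓝 p) := by
    have h1 := H.continuousOn_graphMap.continuousAt (Metric.ball_mem_nhds 0 H.r_pos)
    have h2 : Filter.Tendsto y (𝓝 0) (𝓝 0) := by
      have : Continuous y := by fun_prop
      exact this.tendsto' 0 0 (by simp [y])
    have := h1.tendsto.comp h2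
    rwa [hG0] at this
  have hgo : (fun t => g (y t)) =o[𝓝 0] (fun t : ℝ => t) := by
    rw [Asymptotics.isLittleO_iff]
    intro c hc
    have hδ : 0 < c / (C * ‖w‖ + 1) := by positivity
    obtain ⟨W, hW, hWc⟩ := hν.exists_nhds_abs_inner_le hX hp hδ
    filter_upwards [hy0, hGc hW] with t ht htW
    have hm := H.graphMap_mem ht
    have h1 := hWc (graphMap p e g (y t)) ⟨htW, hm.1⟩ p ⟨mem_of_mem_nhds hW, hp⟩
    have h2 := hL _ hm p (by
      have := H.graphMap_mem (y := 0) (by simpa using H.r_pos)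
      rwa [hG0] at this)
    rw [map_sub, H.projAlong_graphMap, add_sub_cancel_left, hy, norm_smul] at h2
    have h3 : graphMap p e g (y t) - p = t • w + g (y t) • e := by
      rw [graphMap, hy]; abel
    have h4 : inner ℝ e (graphMap p e g (y t) - p) = g (y t) := by
      rw [h3, inner_add_right, inner_smul_right, inner_smul_right, hw, real_inner_self_eq_norm_sq,
        he]
      simp
    rw [h4] at h1
    rw [Real.norm_eq_abs]
    calc |g (y t)| ≤ c / (C * ‖w‖ + 1) * (C * (‖t‖ * ‖w‖)) := h1.trans (by gcongr)
      _ = c * (C * ‖w‖ / (C * ‖w‖ + 1)) * ‖t‖ := by ring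
      _ ≤ c * 1 * ‖t‖ := by
        gcongr
        rw [div_le_one (by positivity)]
        linarith
      _ = _ := by ring
  refine mem_tangentConeAt_of_seq (𝓝[>] (0 : ℝ)) (fun t => t⁻¹)
    (fun t => graphMap p e g (y t) - p) ?_ ?_ ?_
  · have := hGc.sub_const p
    rw [sub_self] at this
    exact this.mono_left nhdsWithin_le_nhds
  · filter_upwards [hy0.filter_mono nhdsWithin_le_nhds] with t ht
    rw [add_sub_cancel]
    exact (H.graphMap_mem ht).1
  · have h1 : Filter.Tendsto (fun t : ℝ => w + (g (y t) / t) • e) (𝓝[>] 0) (𝓝 w) := by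
      have h2 := (hgo.tendsto_div_nhds_zero.mono_left nhdsWithin_le_nhds :
        Filter.Tendsto _ (𝓝[>] (0 : ℝ)) _)
      have := (h2.smul_const e).const_add w
      simpa using this
    refine h1.congr' ?_
    filter_upwards [self_mem_nhdsWithin] with t ht
    have ht0 : t ≠ 0 := ne_of_gt ht
    have h3 : graphMap p e g (y t) - p = t • w + g (y t) • e := by
      rw [graphMap, hy]; abel
    rw [h3, smul_add, smul_smul, smul_smul, inv_mul_cancel₀ ht0, one_smul, div_eq_inv_mul]

variable [FiniteDimensional ℝ E] [MeasurableSpace E] [BorelSpace E]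

lemma HasUnitNormal.measure_frontier_lt_top (hν : HasUnitNormal X ν) (hX : IsOpen X)
    (hb : Bornology.IsBounded X) : μHE[finrank ℝ E - 1] (frontier X) < ⊤ := by
  have hK : IsCompact (frontier X) :=
    hb.isCompact_closure.of_isClosed_subset isClosed_frontier frontier_subset_closure
  refine hK.measure_lt_top_of_nhdsWithin fun p hp => ?_
  have he := hν.norm_eq_one hp
  obtain ⟨r, h, g, H⟩ := hν.exists_isLocalGraph hX hp he
    (by rw [real_inner_self_eq_norm_sq, he]; norm_num)
  refine ⟨_, inter_mem_nhdsWithin _ ((isOpen_axisBox p (ν p) r h).mem_nhds ?_),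
    H.measure_piece_lt_top⟩
  have := (mem_axisBox (p := p) (r := r) (h := h) he 0 0).2
    ⟨by simpa using H.r_pos, by simpa using H.h_pos⟩
  simpa using this

/-- The divergence formula `∫_X ∂_e f = ∮ ⟪e, ν⟫ f` holds for the functions that are `C¹` up to the
boundary and supported in `V`. -/
def FluxFormulaOn (X : Set E) (ν : E → E) (e : E) (V : Set E) : Prop :=
  ∀ f : E → ℂ, ContDiffOn ℝ 1 f (closure X) → tsupport f ⊆ V →
    ∫ x in X, fderiv ℝ f x e =
      ∫ x in frontier X, (inner ℝ e (ν x) : ℝ) • f x ∂μHE[finrank ℝ E - 1]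

omit [CompleteSpace E] [FiniteDimensional ℝ E] [MeasurableSpace E] [BorelSpace E] in
lemma differentiableAt_of_contDiffOn_closure {m : WithTop ℕ∞} (hX : IsOpen X) {f : E → ℂ}
    (hf : ContDiffOn ℝ m f (closure X)) {x : E} (hx : x ∈ X) (hm : m ≠ 0 := by simp) :
    DifferentiableAt ℝ f x :=
  (hf.contDiffAt (Filter.mem_of_superset (hX.mem_nhds hx) subset_closure)).differentiableAt hm

lemma HasUnitNormal.integrableOn_fderiv (hν : HasUnitNormal X ν) (hX : IsOpen X)
    (hb : Bornology.IsBounded X) {f : E → ℂ} (hf : ContDiffOn ℝ 1 f (closure X)) (e : E) :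
    IntegrableOn (fun x => fderiv ℝ f x e) X := by
  have h1 : ContinuousOn (fun x => fderivWithin ℝ f (closure X) x e) (closure X) :=
    (hf.continuousOn_fderivWithin (hν.uniqueDiffOn_closure hX) le_rfl).clm_apply
      continuousOn_const
  have h2 := (h1.integrableOn_compact (μ := volume) hb.isCompact_closure).mono_set subset_closure
  refine h2.congr_fun (fun x hx => ?_) hX.measurableSet
  simp only
  rw [fderivWithin_of_mem_nhds (Filter.mem_of_superset (hX.mem_nhds hx) subset_closure)]

lemma HasUnitNormal.integrableOn_frontier (hν : HasUnitNormal X ν) (hX : IsOpen X)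
    (hb : Bornology.IsBounded X) {f : E → ℂ} (hf : ContinuousOn f (frontier X)) :
    IntegrableOn f (frontier X) μHE[finrank ℝ E - 1] := by
  have hK : IsCompact (frontier X) :=
    hb.isCompact_closure.of_isClosed_subset isClosed_frontier frontier_subset_closure
  obtain ⟨C, hC⟩ := hK.exists_bound_of_continuousOn hf
  exact IntegrableOn.of_bound (hν.measure_frontier_lt_top hX hb)
    (hf.aestronglyMeasurable isClosed_frontier.measurableSet) C
    ((ae_restrict_iff' isClosed_frontier.measurableSet).2 (Filter.Eventually.of_forall hC))

lemma HasUnitNormal.fluxFormulaOn_of_inner_pos (hν : HasUnitNormal X ν) (hX : IsOpen X)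
    (hb : Bornology.IsBounded X) {p e : E} (hp : p ∈ frontier X) (he : ‖e‖ = 1)
    (hpos : 0 < inner ℝ e (ν p)) :
    ∃ V, IsOpen V ∧ p ∈ V ∧ FluxFormulaOn X ν e V := by
  obtain ⟨r, h, g, H⟩ := hν.exists_isLocalGraph hX hp he hpos
  refine ⟨_, isOpen_axisBox p e r h, ?_, fun f hf hs => ?_⟩
  · have := (mem_axisBox (p := p) (r := r) (h := h) he 0 0).2
      ⟨by simpa using H.r_pos, by simpa using H.h_pos⟩
    simpa using this
  · have h0 (x : E) (hx : x ∉ axisBox p e r h) : x ∉ tsupport f := fun hx' => hx (hs hx')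
    refine H.integral_lineDeriv hX hν hf.continuousOn (hν.integrableOn_fderiv hX hb hf e)
      (fun x hx => (differentiableAt_of_contDiffOn_closure hX hf hx).hasFDerivAt.hasLineDerivAt e)
      (fun x _ hx => image_eq_zero_of_notMem_tsupport (h0 x hx)) (fun x _ hx => ?_)
    rw [fderiv_of_notMem_tsupport ℝ (h0 x hx)]
    rfl

omit [CompleteSpace E] in
lemma FluxFormulaOn.mono {e : E} {V W : Set E} (hV : FluxFormulaOn X ν e V) (h : W ⊆ V) :
    FluxFormulaOn X ν e W := fun f hf hs => hV f hf (hs.trans h)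

lemma HasUnitNormal.fluxFormulaOn_frontier (hν : HasUnitNormal X ν) (hX : IsOpen X)
    (hb : Bornology.IsBounded X) {p : E} (hp : p ∈ frontier X) (e : E) :
    ∃ V, IsOpen V ∧ p ∈ V ∧ FluxFormulaOn X ν e V := by
  -- `e = (e + t ν(p)) - t ν(p)`, where both directions point out of `X` at `p`
  have hn := hν.norm_eq_one hp
  set t : ℝ := |inner ℝ e (ν p)| + 1
  set w := e + t • ν p
  have hw : 0 < inner ℝ w (ν p) := by
    rw [inner_add_left, inner_smul_left, real_inner_self_eq_norm_sq, hn]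
    have := neg_abs_le (inner ℝ e (ν p) : ℝ)
    simp only [t, conj_trivial]
    linarith
  have hw0 : 0 < ‖w‖ := by
    rw [norm_pos_iff]; intro h; rw [h, inner_zero_left] at hw; exact lt_irrefl _ hw
  set w' := ‖w‖⁻¹ • w
  have hw1 : ‖w'‖ = 1 := by rw [norm_smul, norm_inv, norm_norm, inv_mul_cancel₀ hw0.ne']
  have hw2 : 0 < inner ℝ w' (ν p) := by
    rw [inner_smul_left]; exact mul_pos (by simpa using hw0) hw
  obtain ⟨V, hV, hpV, hF⟩ := hν.fluxFormulaOn_of_inner_pos hX hb hp hw1 hw2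
  obtain ⟨V', hV', hpV', hF'⟩ := hν.fluxFormulaOn_of_inner_pos hX hb hp hn
    (by rw [real_inner_self_eq_norm_sq, hn]; norm_num)
  refine ⟨V ∩ V', hV.inter hV', ⟨hpV, hpV'⟩, fun f hf hs => ?_⟩
  have he : e = ‖w‖ • w' - t • ν p := by
    simp only [w', w]
    rw [smul_smul, mul_inv_cancel₀ hw0.ne', one_smul, add_sub_cancel_right]
  clear_value w'
  have h1 := hF f hf (hs.trans inter_subset_left)
  have h2 := hF' f hf (hs.trans inter_subset_right)
  have hi (a : E) : IntegrableOn (fun x => (inner ℝ a (ν x) : ℝ) • f x) (frontier X)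
      μHE[finrank ℝ E - 1] := by
    refine hν.integrableOn_frontier hX hb ?_
    exact (hν.continuousOn_inner _).smul
      (hf.continuousOn.mono frontier_subset_closure)
  calc ∫ x in X, fderiv ℝ f x e
      = ‖w‖ • (∫ x in X, fderiv ℝ f x w') - t • ∫ x in X, fderiv ℝ f x (ν p) := by
        have hd (c : ℝ) (a : E) : IntegrableOn (fun x => c • fderiv ℝ f x a) X :=
          (hν.integrableOn_fderiv hX hb hf a).smul c
        rw [← integral_smul, ← integral_smul, ← integral_sub (hd _ _) (hd _ _)]
        congr 1; funext x
        conv_lhs => rw [he]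
        rw [map_sub, map_smul, map_smul]
    _ = _ := by
        have hd (c : ℝ) (a : E) : IntegrableOn (fun x => c • (inner ℝ a (ν x) : ℝ) • f x)
            (frontier X) μHE[finrank ℝ E - 1] := (hi a).smul c
        rw [h1, h2, ← integral_smul, ← integral_smul, ← integral_sub (hd _ _) (hd _ _)]
        congr 1; funext x
        conv_rhs => rw [he]
        rw [inner_sub_left, real_inner_smul_left, real_inner_smul_left, sub_smul, mul_smul,
          mul_smul]

lemma fluxFormulaOn_interior (hν : HasUnitNormal X ν) (hX : IsOpen X)
    (hb : Bornology.IsBounded X) (e : E) : FluxFormulaOn X ν e X := by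
  intro f hf hs
  have hR : ∫ x in frontier X, (inner ℝ e (ν x) : ℝ) • f x ∂μHE[finrank ℝ E - 1] = 0 := by
    refine setIntegral_eq_zero_of_forall_eq_zero fun x hx => ?_
    rw [hX.frontier_eq] at hx
    rw [image_eq_zero_of_notMem_tsupport fun h => hx.2 (hs h), smul_zero]
  have hd (x : E) : DifferentiableAt ℝ f x := by
    by_cases hx : x ∈ X
    · exact differentiableAt_of_contDiffOn_closure hX hf hx
    · have : f =ᶠ[𝓝 x] fun _ => 0 :=
        notMem_tsupport_iff_eventuallyEq.1 fun h => hx (hs h)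
      exact this.differentiableAt_iff.2 (differentiableAt_const _)
  have h0 (x : E) (hx : x ∉ X) : f x = 0 :=
    image_eq_zero_of_notMem_tsupport fun h => hx (hs h)
  have h0' (x : E) (hx : x ∉ X) : fderiv ℝ f x e = 0 := by
    rw [fderiv_of_notMem_tsupport ℝ fun h => hx (hs h)]; rfl
  have hi : Integrable (fun x => fderiv ℝ f x e) := by
    have := (integrable_indicator_iff hX.measurableSet).2 (hν.integrableOn_fderiv hX hb hf e)
    rwa [indicator_eq_self.2 fun x hx => by_contra fun h => hx (h0' x h)] at this
  have hif : Integrable f := by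
    have h2 := (hf.continuousOn.integrableOn_compact (μ := volume) hb.isCompact_closure).mono_set
      subset_closure
    have := (integrable_indicator_iff hX.measurableSet).2 h2
    rwa [indicator_eq_self.2 fun x hx => by_contra fun h => hx (h0 x h)] at this
  have h1 := integral_bilinear_hasLineDerivAt_right_eq_neg_left_of_integrable (μ := volume)
    (f := fun _ : E => (1 : ℝ)) (f' := fun _ => 0) (g := f) (g' := fun x => fderiv ℝ f x e)
    (v := e) (B := ContinuousLinearMap.lsmul ℝ ℝ) (by simp) (by simpa using hi) (by simpa using hif)
    (fun x _ => (hasFDerivAt_const (1 : ℝ) x).hasLineDerivAt e)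
    (fun x _ => (hd x).hasFDerivAt.hasLineDerivAt e)
  rw [hR, setIntegral_eq_integral_of_forall_compl_eq_zero h0']
  simpa using h1

/-- **Divergence theorem** for a bounded domain with `C¹` boundary, in the form
`∫_X ∂_e f dx = ∮_{∂X} ⟪e, ν⟫ f dμ` with the Hausdorff measure on the boundary. -/
theorem HasUnitNormal.integral_fderiv (hν : HasUnitNormal X ν) (hX : IsOpen X)
    (hb : Bornology.IsBounded X) {f : E → ℂ} (hf : ContDiffOn ℝ 1 f (closure X)) (e : E) :
    ∫ x in X, fderiv ℝ f x e =
      ∫ x in frontier X, (inner ℝ e (ν x) : ℝ) • f x ∂μHE[finrank ℝ E - 1] := by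
  have hloc (p : E) (hp : p ∈ closure X) : ∃ V, IsOpen V ∧ p ∈ V ∧ FluxFormulaOn X ν e V := by
    by_cases hpX : p ∈ X
    · exact ⟨X, hX, hpX, fluxFormulaOn_interior hν hX hb e⟩
    · exact hν.fluxFormulaOn_frontier hX hb (by rw [hX.frontier_eq]; exact ⟨hp, hpX⟩) e
  choose! V hVo hpV hV using hloc
  obtain ⟨t, ht, hcov⟩ := hb.isCompact_closure.elim_nhds_subcover V
    fun x hx => (hVo x hx).mem_nhds (hpV x hx)
  obtain ⟨φ, hφ⟩ := SmoothPartitionOfUnity.exists_isSubordinate (modelWithCornersSelf ℝ E)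
    (isClosed_closure (s := X)) (fun i : t => V i) (fun i => hVo i (ht i i.2)) (by
      intro x hx
      obtain ⟨i, hi, hxi⟩ := mem_iUnion₂.1 (hcov hx)
      exact mem_iUnion.2 ⟨⟨i, hi⟩, hxi⟩)
  have hφs (i : t) : ContDiff ℝ 1 (φ i) := ((φ i).contMDiff.contDiff).of_le (by simp)
  have hφf (i : t) : ContDiffOn ℝ 1 (fun x => φ i x • f x) (closure X) :=
    (hφs i).contDiffOn.smul hf
  have hts (i : t) : tsupport (fun x => φ i x • f x) ⊆ V i :=
    (tsupport_smul_subset_left (φ i) f).trans (hφ i)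
  have hsum (x : E) (hx : x ∈ closure X) : f x = ∑ i, φ i x • f x := by
    have := φ.sum_eq_one hx
    rw [finsum_eq_sum_of_fintype] at this
    rw [← Finset.sum_smul, this, one_smul]
  have h1 : ∫ x in X, fderiv ℝ f x e =
      ∑ i, ∫ x in X, fderiv ℝ (fun x => φ i x • f x) x e := by
    rw [← integral_finsetSum _ fun i _ => hν.integrableOn_fderiv hX hb (hφf i) e]
    refine setIntegral_congr_fun hX.measurableSet fun x hx => ?_
    have h2 : f =ᶠ[𝓝 x] fun x => ∑ i, φ i x • f x :=
      Filter.mem_of_superset (hX.mem_nhds hx) fun y hy => hsum y (subset_closure hy)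
    have h3 : HasFDerivAt (fun x => ∑ i, φ i x • f x)
        (∑ i, fderiv ℝ (fun x => φ i x • f x) x) x :=
      HasFDerivAt.fun_sum fun i _ =>
        (differentiableAt_of_contDiffOn_closure hX (hφf i) hx).hasFDerivAt
    rw [h2.fderiv_eq, h3.fderiv, sum_apply]
  have hi (i : t) : IntegrableOn (fun x => (inner ℝ e (ν x) : ℝ) • φ i x • f x) (frontier X)
      μHE[finrank ℝ E - 1] := by
    refine hν.integrableOn_frontier hX hb ?_
    exact (hν.continuousOn_inner _).smul
      ((hφf i).continuousOn.mono frontier_subset_closure)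
  rw [h1, Finset.sum_congr rfl fun (i : t) _ => hV i (ht i i.2) _ (hφf i) (hts i),
    ← integral_finsetSum _ fun i _ => hi i]
  refine setIntegral_congr_fun isClosed_frontier.measurableSet fun x hx => ?_
  rw [← Finset.smul_sum, ← hsum x (frontier_subset_closure hx)]

end Divergence

/-! ### Algebra of the polarized elementary symmetric functions -/

section PolarizedSigma

open Matrix

variable {ι κ : Type} [Fintype ι] [DecidableEq ι] [Fintype κ] [DecidableEq κ]

omit [DecidableEq ι] in
lemma sum_cons {m : ℕ} (F : (Fin (m + 1) → ι) → ℂ) :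
    ∑ I, F I = ∑ i, ∑ I : Fin m → ι, F (Fin.cons i I) := by
  rw [← (Fin.consEquiv fun _ => ι).sum_comp, Fintype.sum_prod_type]
  rfl

omit [DecidableEq ι] [DecidableEq κ] in
/-- Multilinearity of the determinant in rows and columns simultaneously. -/
lemma sum_sum_det_mul_prod {k : ℕ} (K : ι → κ → ℂ) (x : Fin k → ι → ℂ) (y : Fin k → κ → ℂ) :
    ∑ I : Fin k → ι, ∑ J : Fin k → κ,
        (of fun a b => K (I a) (J b)).det * ((∏ a, x a (I a)) * ∏ b, y b (J b)) =
      (of fun a b => ∑ i, ∑ j, x a i * K i j * y b j).det := by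
  have h1 (σ : Equiv.Perm (Fin k)) :
      ∑ I : Fin k → ι, ∑ J : Fin k → κ,
        (∏ b, K (I (σ b)) (J b)) * ((∏ a, x a (I a)) * ∏ b, y b (J b)) =
      ∏ b, ∑ i, ∑ j, x (σ b) i * K i j * y b j := by
    have h2 (I : Fin k → ι) (J : Fin k → κ) :
        (∏ b, K (I (σ b)) (J b)) * ((∏ a, x a (I a)) * ∏ b, y b (J b)) =
          ∏ b, x (σ b) (I (σ b)) * K (I (σ b)) (J b) * y b (J b) := by
      rw [Finset.prod_mul_distrib, Finset.prod_mul_distrib,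
        Equiv.prod_comp σ fun a => x a (I a)]
      ring
    simp only [h2]
    rw [← (Equiv.arrowCongr σ (Equiv.refl ι)).sum_comp]
    simp only [Equiv.arrowCongr_apply, Equiv.coe_refl, Function.comp_apply, id,
      Equiv.symm_apply_apply]
    rw [Finset.prod_univ_sum, Fintype.piFinset_univ]
    refine Finset.sum_congr rfl fun I _ => ?_
    rw [Finset.prod_univ_sum, Fintype.piFinset_univ]
  simp only [det_apply', of_apply, Finset.sum_mul]
  rw [Finset.sum_congr rfl fun I _ => Finset.sum_comm, Finset.sum_comm]
  refine Finset.sum_congr rfl fun σ _ => ?_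
  rw [← h1 σ, Finset.mul_sum]
  refine Finset.sum_congr rfl fun I _ => ?_
  rw [Finset.mul_sum]
  refine Finset.sum_congr rfl fun J _ => ?_
  ring

lemma sum_sum_genDelta_mul_prod {k : ℕ} (x y : Fin k → ι → ℂ) :
    ∑ I : Fin k → ι, ∑ J : Fin k → ι,
        genDelta I J * ((∏ a, x a (I a)) * ∏ b, y b (J b)) =
      (of fun a b => ∑ i, x a i * y b i).det := by
  have := sum_sum_det_mul_prod (fun i j : ι => if i = j then (1 : ℂ) else 0) x y
  simp only [mul_ite, mul_one, mul_zero, ite_mul, zero_mul, Finset.sum_ite_eq,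
    Finset.mem_univ, if_true] at this
  exact this

lemma sum_comm_pairs {α β γ δ : Type*} [Fintype α] [Fintype β] [Fintype γ] [Fintype δ]
    (F : α → β → γ → δ → ℂ) :
    ∑ a, ∑ b, ∑ c, ∑ d, F a b c d = ∑ c, ∑ d, ∑ a, ∑ b, F a b c d := by
  simp only [← Fintype.sum_prod_type']
  rw [← (Equiv.prodAssoc α β (γ × δ)).sum_comp, ← (Equiv.prodAssoc γ δ (α × β)).sum_comp]
  rw [← (Equiv.prodComm (γ × δ) (α × β)).sum_comp]
  rfl

omit [DecidableEq κ] in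
/-- Change of frame in the polarized `σ_k`. The frame need not be a basis: only the Gram-type
matrix `W * V` enters. -/
lemma sigmaPol_mul_mul {k : ℕ} (V : Matrix ι κ ℂ) (B : Fin k → Matrix κ κ ℂ) (W : Matrix κ ι ℂ) :
    sigmaPol (fun l => V * B l * W) = (1 / (k.factorial : ℂ)) *
      ∑ P : Fin k → κ, ∑ Q : Fin k → κ,
        (of fun a b => (W * V) (Q b) (P a)).det * ∏ l, B l (P l) (Q l) := by
  rw [sigmaPol]
  congr 1
  have h1 (I J : Fin k → ι) : ∏ l, (V * B l * W) (I l) (J l) =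
      ∑ P : Fin k → κ, ∑ Q : Fin k → κ,
        (∏ l, V (I l) (P l) * W (Q l) (J l)) * ∏ l, B l (P l) (Q l) := by
    have h2 (l : Fin k) : (V * B l * W) (I l) (J l) =
        ∑ p, ∑ q, V (I l) p * W q (J l) * B l p q := by
      simp only [mul_apply, Finset.sum_mul]
      rw [Finset.sum_comm]
      refine Finset.sum_congr rfl fun p _ => Finset.sum_congr rfl fun q _ => by ring
    simp only [h2]
    rw [Finset.prod_univ_sum, Fintype.piFinset_univ]
    refine Finset.sum_congr rfl fun P _ => ?_
    rw [Finset.prod_univ_sum, Fintype.piFinset_univ]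
    refine Finset.sum_congr rfl fun Q _ => ?_
    rw [Finset.prod_mul_distrib]
  have h3 (P Q : Fin k → κ) : ∑ I : Fin k → ι, ∑ J : Fin k → ι,
      genDelta I J * ∏ l, V (I l) (P l) * W (Q l) (J l) =
      (of fun a b => (W * V) (Q b) (P a)).det := by
    have := sum_sum_genDelta_mul_prod (fun a i => V i (P a)) (fun b i => W (Q b) i)
    simp only [Finset.prod_mul_distrib]
    rw [this]
    congr 1
    ext a b
    simp only [of_apply, mul_apply]
    exact Finset.sum_congr rfl fun i _ => mul_comm _ _
  simp only [h1, Finset.mul_sum]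
  rw [sum_comm_pairs]
  refine Finset.sum_congr rfl fun P _ => Finset.sum_congr rfl fun Q _ => ?_
  rw [← h3, Finset.sum_mul]
  refine Finset.sum_congr rfl fun I _ => ?_
  rw [Finset.sum_mul]
  refine Finset.sum_congr rfl fun J _ => ?_
  ring

/-- Pairing the Newton tensor with a matrix is polarization of `σ_{m+1}`. -/
lemma sum_mul_newton {m : ℕ} (A B : Matrix ι ι ℂ) :
    ∑ i, ∑ j, B i j * newton m A j i =
      ((m : ℂ) + 1) * sigmaPol (Fin.cons B fun _ => A : Fin (m + 1) → Matrix ι ι ℂ) := by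
  rw [sigmaPol, sum_cons, Nat.factorial_succ]
  simp only [newton, of_apply]
  have hm : (m.factorial : ℂ) ≠ 0 := Nat.cast_ne_zero.2 m.factorial_ne_zero
  have hm1 : (m : ℂ) + 1 ≠ 0 := by exact_mod_cast m.succ_ne_zero
  have h1 : ((m : ℂ) + 1) * (1 / (((m + 1) * m.factorial : ℕ) : ℂ)) = 1 / (m.factorial : ℂ) := by
    push_cast; field_simp
  rw [← mul_assoc, h1, Finset.mul_sum]
  refine Finset.sum_congr rfl fun i _ => ?_
  rw [Finset.sum_congr rfl fun I _ => sum_cons _, Finset.sum_comm, Finset.mul_sum]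
  refine Finset.sum_congr rfl fun j _ => ?_
  simp only [Finset.mul_sum]
  refine Finset.sum_congr rfl fun I _ => Finset.sum_congr rfl fun J _ => ?_
  simp only [Fin.prod_univ_succ, Fin.cons_zero, Fin.cons_succ]
  ring

/-- Euler's identity for the homogeneous polynomial `σ_{m+1}`. -/
lemma sum_mul_newton_self {m : ℕ} (A : Matrix ι ι ℂ) :
    ∑ i, ∑ j, A i j * newton m A j i = ((m : ℂ) + 1) * sigma (m + 1) A := by
  rw [sum_mul_newton, sigma]
  congr 2
  funext l
  refine Fin.cases ?_ (fun _ => ?_) l <;> simp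

/-- Contracting the first pair of indices of `δ` with `x ⊗ y` replaces the Kronecker symbols of the
other indices by the projection `1 - y ⊗ x`: eliminate the first column of the Gram determinant. -/
lemma sum_mul_mul_genDelta_cons {m : ℕ} (x y : ι → ℂ) (hxy : ∑ i, x i * y i = 1)
    (P Q : Fin m → ι) :
    ∑ i, ∑ j, x i * y j * genDelta (Fin.cons i P : Fin (m + 1) → ι) (Fin.cons j Q) =
      (of fun a b => (if P a = Q b then 1 else 0) - y (P a) * x (Q b)).det := by
  have h1 := sum_sum_genDelta_mul_prod
    (Fin.cons x (fun a i => if P a = i then 1 else 0) : Fin (m + 1) → ι → ℂ)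
    (Fin.cons y (fun a i => if Q a = i then 1 else 0) : Fin (m + 1) → ι → ℂ)
  have hd (R I : Fin m → ι) : (∏ a, if R a = I a then (1 : ℂ) else 0) = if R = I then 1 else 0 := by
    rw [Finset.prod_ite_zero]
    simp [funext_iff]
  rw [sum_cons] at h1
  have h2 : ∀ i (I : Fin m → ι), ∑ J : Fin (m + 1) → ι, genDelta (Fin.cons i I) J *
      ((∏ a, (Fin.cons x (fun a i => if P a = i then 1 else 0) : Fin (m + 1) → ι → ℂ) a
        ((Fin.cons i I : Fin (m + 1) → ι) a)) *
      ∏ b, (Fin.cons y (fun a i => if Q a = i then 1 else 0) : Fin (m + 1) → ι → ℂ) b (J b)) =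
      if P = I then ∑ j, x i * y j * genDelta (Fin.cons i I : Fin (m + 1) → ι) (Fin.cons j Q)
      else 0 := by
    intro i I
    rw [sum_cons]
    simp only [Fin.prod_univ_succ, Fin.cons_zero, Fin.cons_succ, hd]
    split_ifs with h
    · refine Finset.sum_congr rfl fun j _ => ?_
      simp only [mul_ite, mul_one, mul_zero, Finset.sum_ite_eq, Finset.mem_univ, if_true]
      ring
    · simp
  simp only [h2, Finset.sum_ite_eq, Finset.mem_univ, if_true] at h1
  rw [h1]
  set M : Matrix (Fin (m + 1)) (Fin (m + 1)) ℂ := of fun a b => ∑ i,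
    (Fin.cons x (fun a i => if P a = i then 1 else 0) : Fin (m + 1) → ι → ℂ) a i *
    (Fin.cons y (fun a i => if Q a = i then 1 else 0) : Fin (m + 1) → ι → ℂ) b i with hM
  have m00 : M 0 0 = 1 := by simpa [hM] using hxy
  have m0b (b : Fin m) : M 0 b.succ = x (Q b) := by simp [hM]
  have ma0 (a : Fin m) : M a.succ 0 = y (P a) := by simp [hM]
  have mab (a b : Fin m) : M a.succ b.succ = if P a = Q b then 1 else 0 := by
    simp only [hM, of_apply, Fin.cons_succ, ite_mul, one_mul, zero_mul, Finset.sum_ite_eq,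
      Finset.mem_univ, if_true]
    exact if_congr eq_comm rfl rfl
  -- subtract multiples of the first row
  set N : Matrix (Fin (m + 1)) (Fin (m + 1)) ℂ := of fun a b =>
    M a b - (Fin.cons 0 (fun a => y (P a)) : Fin (m + 1) → ℂ) a * M 0 b with hN
  have h3 : M.det = N.det := by
    refine det_eq_of_forall_row_eq_smul_add_const
      (Fin.cons 0 (fun a => y (P a)) : Fin (m + 1) → ℂ) 0 (by simp) fun a b => ?_
    simp [hN]
  rw [h3, det_succ_column_zero, Fin.sum_univ_succ]
  have h4 (a : Fin m) : N a.succ 0 = 0 := by simp [hN, ma0, m00]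
  have h5 : N 0 0 = 1 := by simp [hN, m00]
  simp only [h4, h5, mul_zero, zero_mul, Finset.sum_const_zero, add_zero, Fin.val_zero, pow_zero,
    one_mul]
  congr 1
  ext a b
  simp [hN, mab, m0b]

/-- The Newton tensor in the direction of a unit covector pair `x, y` is `σ_m` of the restriction
to the complement: `V` is a frame whose Gram matrix is the projection `1 - y ⊗ x`. -/
lemma sigmaPol_compression {m : ℕ} (V : Matrix κ ι ℂ) (x y : ι → ℂ) (hxy : ∑ i, x i * y i = 1)
    (hV : ∀ p q, (Vᴴ * V) q p = (if p = q then 1 else 0) - y p * x q) (A : Matrix ι ι ℂ) :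
    sigmaPol (fun _ : Fin m => V * A * Vᴴ) = ∑ i, ∑ j, x i * y j * newton m A j i := by
  rw [sigmaPol_mul_mul]
  simp only [newton, of_apply, hV]
  have h1 : ∀ i j, x i * y j * (1 / (m.factorial : ℂ) * ∑ I : Fin m → ι, ∑ J : Fin m → ι,
      genDelta (Fin.cons i I : Fin (m + 1) → ι) (Fin.cons j J) * ∏ l, A (I l) (J l)) =
      1 / (m.factorial : ℂ) * ∑ I : Fin m → ι, ∑ J : Fin m → ι,
        x i * y j * genDelta (Fin.cons i I : Fin (m + 1) → ι) (Fin.cons j J) *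
          ∏ l, A (I l) (J l) := by
    intro i j
    rw [mul_left_comm]
    simp only [Finset.mul_sum, mul_assoc]
  simp only [h1, ← Finset.mul_sum]
  congr 1
  rw [sum_comm_pairs]
  refine Finset.sum_congr rfl fun P _ => Finset.sum_congr rfl fun Q _ => ?_
  rw [← sum_mul_mul_genDelta_cons x y hxy, Finset.sum_mul]
  refine Finset.sum_congr rfl fun i _ => ?_
  rw [Finset.sum_mul]

omit [Fintype ι] in
lemma genDelta_comp_perm {k : ℕ} (I J : Fin k → ι) (σ : Equiv.Perm (Fin k)) :
    genDelta (I ∘ σ) (J ∘ σ) = genDelta I J :=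
  det_submatrix_equiv_self σ (of fun a b => if I a = J b then (1 : ℂ) else 0)

omit [Fintype ι] in
lemma genDelta_swap {k : ℕ} (I J : Fin k → ι) : genDelta J I = genDelta I J := by
  rw [genDelta, genDelta, ← det_transpose]
  congr 1
  ext a b
  simp [eq_comm]

omit [Fintype ι] in
lemma star_genDelta {k : ℕ} (I J : Fin k → ι) : star (genDelta I J) = genDelta I J := by
  rw [genDelta, ← det_conjTranspose, ← det_transpose]
  congr 1
  ext a b
  simp only [transpose_apply, conjTranspose_apply, of_apply]
  split_ifs <;> simp

/-- `σ_k` is symmetric in its arguments. -/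
lemma sigmaPol_comp_perm {k : ℕ} (A : Fin k → Matrix ι ι ℂ) (σ : Equiv.Perm (Fin k)) :
    sigmaPol (A ∘ σ) = sigmaPol A := by
  rw [sigmaPol, sigmaPol]
  congr 1
  rw [← (Equiv.arrowCongr σ.symm (Equiv.refl ι)).sum_comp]
  refine Finset.sum_congr rfl fun I _ => ?_
  rw [← (Equiv.arrowCongr σ.symm (Equiv.refl ι)).sum_comp]
  refine Finset.sum_congr rfl fun J _ => ?_
  have h1 (I : Fin k → ι) : Equiv.arrowCongr σ.symm (Equiv.refl ι) I = I ∘ σ := by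
    ext; simp [Equiv.arrowCongr_apply]
  rw [h1, h1, genDelta_comp_perm]
  congr 1
  exact Equiv.prod_comp σ fun l => A l (I l) (J l)

lemma isHermitian_newton {m : ℕ} {A : Matrix ι ι ℂ} (hA : A.IsHermitian) :
    (newton m A).IsHermitian := by
  ext j i
  simp only [conjTranspose_apply, newton, of_apply]
  rw [star_mul']
  have h0 : star (1 / (m.factorial : ℂ)) = 1 / (m.factorial : ℂ) := by simp
  rw [h0]
  congr 1
  simp only [star_sum]
  rw [Finset.sum_comm]
  refine Finset.sum_congr rfl fun I _ => Finset.sum_congr rfl fun J _ => ?_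
  rw [star_mul', star_genDelta, genDelta_swap, star_prod]
  congr 1
  refine Finset.prod_congr rfl fun l _ => ?_
  exact hA.apply _ _

lemma sigmaPol_update_zero {k : ℕ} (A : Fin k → Matrix ι ι ℂ) (l : Fin k) :
    sigmaPol (Function.update A l 0) = 0 := by
  rw [sigmaPol]
  have (I J : Fin k → ι) : ∏ l', Function.update A l 0 l' (I l') (J l') = 0 :=
    Finset.prod_eq_zero (Finset.mem_univ l) (by simp)
  simp [this]

lemma sigmaPol_update_smul {k : ℕ} (A : Fin k → Matrix ι ι ℂ) (l : Fin k) (c : ℂ)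
    (B : Matrix ι ι ℂ) :
    sigmaPol (Function.update A l (c • B)) = c * sigmaPol (Function.update A l B) := by
  rw [sigmaPol, sigmaPol, mul_left_comm]
  congr 1
  rw [Finset.mul_sum]
  refine Finset.sum_congr rfl fun I _ => ?_
  rw [Finset.mul_sum]
  refine Finset.sum_congr rfl fun J _ => ?_
  rw [mul_left_comm]
  congr 1
  rw [← Finset.mul_prod_erase _ _ (Finset.mem_univ l),
    ← Finset.mul_prod_erase _ _ (Finset.mem_univ l)]
  simp only [Function.update_self, Matrix.smul_apply, smul_eq_mul]
  rw [mul_assoc]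
  congr 2
  refine Finset.prod_congr rfl fun l' hl' => ?_
  rw [Function.update_of_ne (Finset.ne_of_mem_erase hl'),
    Function.update_of_ne (Finset.ne_of_mem_erase hl')]

/-- Leibniz rule for the polarized `σ_k`. -/
lemma hasDerivAt_sigmaPol {k : ℕ} {A : Fin k → ℝ → Matrix ι ι ℂ} {A' : Fin k → Matrix ι ι ℂ}
    {t : ℝ} (h : ∀ l i j, HasDerivAt (fun s => A l s i j) (A' l i j) t) :
    HasDerivAt (fun s => sigmaPol fun l => A l s)
      (∑ l, sigmaPol (Function.update (fun l => A l t) l (A' l))) t := by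
  have hs : ∑ l, sigmaPol (Function.update (fun l => A l t) l (A' l)) =
      (1 / (k.factorial : ℂ)) * ∑ I : Fin k → ι, ∑ J : Fin k → ι, genDelta I J *
        ∑ l, ∏ l', Function.update (fun l => A l t) l (A' l) l' (I l') (J l') := by
    simp only [sigmaPol]
    rw [← Finset.mul_sum, Finset.sum_comm]
    congr 1
    refine Finset.sum_congr rfl fun I _ => ?_
    rw [Finset.sum_comm]
    simp only [Finset.mul_sum]
  rw [hs]
  refine HasDerivAt.const_mul _ (HasDerivAt.fun_sum fun I _ => HasDerivAt.fun_sum fun J _ =>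
    HasDerivAt.const_mul _ ?_)
  have h1 := HasDerivAt.fun_finsetProd (u := Finset.univ) (f := fun l s => A l s (I l) (J l))
    (f' := fun l => A' l (I l) (J l)) (x := t) (fun l _ => h l (I l) (J l))
  have h2 : ∑ l, ∏ l', Function.update (fun l => A l t) l (A' l) l' (I l') (J l') =
      ∑ l, (∏ l' ∈ Finset.univ.erase l, A l' t (I l') (J l')) • A' l (I l) (J l) := by
    refine Finset.sum_congr rfl fun l _ => ?_
    rw [← Finset.prod_erase_mul _ _ (Finset.mem_univ l)]
    simp only [Function.update_self, smul_eq_mul]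
    congr 1
    refine Finset.prod_congr rfl fun l' hl' => ?_
    rw [Function.update_of_ne (Finset.ne_of_mem_erase hl')]
  rw [h2]
  exact h1

/-- First variation of `σ_{m+1}`: its gradient is the Newton tensor `T_m`. -/
lemma hasDerivAt_sigma {m : ℕ} {A : ℝ → Matrix ι ι ℂ} {A' : Matrix ι ι ℂ} {t : ℝ}
    (h : ∀ i j, HasDerivAt (fun s => A s i j) (A' i j) t) :
    HasDerivAt (fun s => sigma (m + 1) (A s)) (∑ i, ∑ j, A' i j * newton m (A t) j i) t := by
  have h1 := hasDerivAt_sigmaPol (A := fun _ : Fin (m + 1) => A) (A' := fun _ => A') fun _ => h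
  convert! h1 using 1
  rw [sum_mul_newton]
  have h2 (l : Fin (m + 1)) : sigmaPol (Function.update (fun _ : Fin (m + 1) => A t) l A') =
      sigmaPol (Fin.cons A' fun _ => A t : Fin (m + 1) → Matrix ι ι ℂ) := by
    rw [← sigmaPol_comp_perm _ (Equiv.swap 0 l)]
    congr 1
    funext l'
    simp only [Function.comp_apply]
    refine Fin.cases ?_ (fun a => ?_) l'
    · simp
    · rw [Fin.cons_succ]
      rcases eq_or_ne a.succ l with rfl | hne
      · rw [Equiv.swap_apply_right, Function.update_of_ne (Fin.succ_ne_zero a).symm]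
      · rw [Equiv.swap_apply_of_ne_of_ne (Fin.succ_ne_zero a) hne, Function.update_of_ne hne]
  simp [h2]

/-- Derivative of `σ_m(L, …, L, H(t), …, H(t))`, with `q` entries `L`, along `H' = c L`. -/
lemma hasDerivAt_sigmaPol_ite {m q : ℕ} (hq : q ≤ m) (L : Matrix ι ι ℂ) {H : ℝ → Matrix ι ι ℂ}
    {c : ℂ} {t : ℝ} (h : ∀ i j, HasDerivAt (fun s => H s i j) (c * L i j) t) :
    HasDerivAt (fun s => sigmaPol fun l : Fin m => if (l : ℕ) < q then L else H s)
      (((m - q : ℕ) : ℂ) * c * sigmaPol fun l : Fin m => if (l : ℕ) < q + 1 then L else H t) t := by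
  have h1 := hasDerivAt_sigmaPol (t := t)
    (A := fun (l : Fin m) s => if (l : ℕ) < q then L else H s)
    (A' := fun l => if (l : ℕ) < q then 0 else c • L) (fun l i j => by
      by_cases hl : (l : ℕ) < q
      · simpa [hl] using hasDerivAt_const t (L i j)
      · simpa [hl] using h i j)
  convert! h1 using 1
  have h2 (l : Fin m) : sigmaPol (Function.update
      (fun l : Fin m => if (l : ℕ) < q then L else H t) l (if (l : ℕ) < q then 0 else c • L)) =
      if (l : ℕ) < q then 0 else
        c * sigmaPol fun l : Fin m => if (l : ℕ) < q + 1 then L else H t := by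
    split_ifs with hl
    · exact sigmaPol_update_zero _ _
    rw [sigmaPol_update_smul]
    congr 1
    have hqm : q < m := by have := l.2; omega
    rw [← sigmaPol_comp_perm _ (Equiv.swap ⟨q, hqm⟩ l)]
    congr 1
    funext l'
    simp only [Function.comp_apply]
    rcases eq_or_ne l' ⟨q, hqm⟩ with rfl | h3
    · simp
    rcases eq_or_ne l' l with rfl | h4
    · rw [Equiv.swap_apply_right, Function.update_of_ne h3.symm]
      have : (l' : ℕ) ≠ q := fun h => h3 (Fin.ext h)
      rw [if_neg (by simp), if_neg (by omega)]
    · rw [Equiv.swap_apply_of_ne_of_ne h3 h4, Function.update_of_ne h4]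
      have : (l' : ℕ) ≠ q := fun h => h3 (Fin.ext h)
      congr 1
      exact propext (by omega)
  simp only [h2]
  rw [Finset.sum_ite, Finset.sum_const_zero, zero_add, Finset.sum_const, nsmul_eq_mul, mul_assoc]
  congr 2
  have h3 : (Finset.univ.filter fun l : Fin m => ¬ (l : ℕ) < q).card = m - q := by
    have h4 := Finset.card_filter_add_card_filter_not (s := Finset.univ)
      (fun l : Fin m => (l : ℕ) < q)
    rw [Fin.card_filter_val_lt, Finset.card_univ, Fintype.card_fin, min_eq_right hq] at h4
    omega
  rw [h3]

end PolarizedSigma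

/-! ### Newton's inequality for real-rooted polynomials -/

section NewtonInequality

open Polynomial

/-- By Rolle's theorem, the derivative of a real-rooted polynomial is real-rooted. -/
lemma splits_derivative {p : ℝ[X]} (hp : p.Splits) : p.derivative.Splits := by
  rcases Nat.eq_zero_or_pos p.natDegree with h0 | h0
  · rw [derivative_of_natDegree_zero h0]
    exact Splits.zero
  rw [splits_iff_card_roots]
  refine le_antisymm (card_roots' _) ?_
  have h1 := card_roots_le_derivative p
  rw [← hp.natDegree_eq_card_roots] at h1
  rw [natDegree_derivative]
  omega

lemma splits_iterate_derivative {p : ℝ[X]} (hp : p.Splits) (m : ℕ) :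
    (derivative^[m] p).Splits := by
  induction m with
  | zero => exact hp
  | succ m ih =>
    rw [Function.iterate_succ_apply']
    exact splits_derivative ih

/-- Laguerre's inequality `p p'' ≤ (p')²` for real-rooted polynomials. -/
lemma eval_mul_eval_derivative_le_sq {p : ℝ[X]} (hp : p.Splits) (x : ℝ) :
    p.eval x * (derivative (derivative p)).eval x ≤ (derivative p).eval x ^ 2 := by
  obtain ⟨s, hs⟩ := splits_iff_exists_multiset.1 hp
  rw [hs]
  generalize p.leadingCoeff = c
  clear hs
  suffices h : (s.map (X - C ·)).prod.eval x *
      (derivative (derivative (s.map (X - C ·)).prod)).eval x ≤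
      (derivative (s.map (X - C ·)).prod).eval x ^ 2 by
    simp only [derivative_C_mul, eval_mul, eval_C]
    nlinarith [mul_le_mul_of_nonneg_left h (sq_nonneg c)]
  induction s using Multiset.induction_on with
  | empty => simp
  | cons r s ih =>
    rw [Multiset.map_cons, Multiset.prod_cons]
    set q := (s.map (X - C ·)).prod
    simp only [derivative_mul, derivative_sub, derivative_X, derivative_C, sub_zero, one_mul,
      derivative_add, eval_add, eval_mul, eval_sub, eval_X, eval_C]
    nlinarith [mul_le_mul_of_nonneg_left ih (sq_nonneg (x - r)), sq_nonneg (q.eval x)]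

/-- Newton's inequality (without the sharp constant) for a real-rooted polynomial. -/
lemma coeff_mul_coeff_le_sq {p : ℝ[X]} (hp : p.Splits) (m : ℕ) :
    p.coeff m * p.coeff (m + 2) ≤ p.coeff (m + 1) ^ 2 := by
  rcases le_or_gt (p.coeff m * p.coeff (m + 2)) 0 with h0 | h0
  · exact h0.trans (sq_nonneg _)
  have h1 := eval_mul_eval_derivative_le_sq (splits_iterate_derivative hp m) 0
  have h2 : (m.factorial : ℝ) ≠ 0 := Nat.cast_ne_zero.2 m.factorial_ne_zero
  rw [← Function.iterate_succ_apply' derivative, ← Function.iterate_succ_apply' derivative] at h1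
  simp only [← coeff_zero_eq_eval_zero, coeff_iterate_derivative, zero_add,
    Nat.descFactorial_self, nsmul_eq_mul, Nat.factorial_succ, Nat.cast_mul] at h1
  push_cast at h1
  have h3 : 0 < (m.factorial : ℝ) ^ 2 := by positivity
  have h4 : (m.factorial : ℝ) ^ 2 * (((m : ℝ) + 1) * ((m : ℝ) + 2) *
      (p.coeff m * p.coeff (m + 2))) ≤
      (m.factorial : ℝ) ^ 2 * (((m : ℝ) + 1) ^ 2 * p.coeff (m + 1) ^ 2) := by
    have e : (m : ℝ) + 1 + 1 = m + 2 := by ring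
    rw [e] at h1
    linarith
  have h5 := le_of_mul_le_mul_left h4 h3
  have hm : (0 : ℝ) ≤ m := Nat.cast_nonneg m
  have h6 : ((m : ℝ) + 1) ^ 2 * (p.coeff m * p.coeff (m + 2)) ≤
      ((m : ℝ) + 1) ^ 2 * p.coeff (m + 1) ^ 2 := by
    refine le_trans ?_ h5
    exact mul_le_mul_of_nonneg_right (by nlinarith) h0.le
  exact le_of_mul_le_mul_left h6 (by positivity)

end NewtonInequality

/-! ### Elementary symmetric functions in the positive cone -/

section ElementarySymmetric

variable {ι : Type} [DecidableEq ι]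

/-- The elementary symmetric function of degree `j` of the numbers `f i`, `i ∈ s`. -/
def elemSymm (f : ι → ℝ) (s : Finset ι) (j : ℕ) : ℝ :=
  ∑ t ∈ s.powersetCard j, ∏ i ∈ t, f i

omit [DecidableEq ι] in
open Polynomial in
lemma coeff_prod_one_add (f : ι → ℝ) (s : Finset ι) (j : ℕ) :
    (∏ i ∈ s, (1 + C (f i) * X)).coeff j = elemSymm f s j := by
  classical
  rw [Finset.prod_one_add, finsetSum_coeff, elemSymm, Finset.powersetCard_eq_filter,
    Finset.sum_filter]
  refine Finset.sum_congr rfl fun t _ => ?_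
  rw [Finset.prod_mul_distrib, Finset.prod_const, ← map_prod, coeff_C_mul_X_pow]
  exact if_congr eq_comm rfl rfl

omit [DecidableEq ι] in
open Polynomial in
/-- Newton's inequality for elementary symmetric functions: they are the coefficients of the
real-rooted polynomial `∏ (1 + f i X)`. -/
lemma elemSymm_mul_le_sq (f : ι → ℝ) (s : Finset ι) (j : ℕ) :
    elemSymm f s j * elemSymm f s (j + 2) ≤ elemSymm f s (j + 1) ^ 2 := by
  simp only [← coeff_prod_one_add]
  refine coeff_mul_coeff_le_sq (Splits.prod fun i _ => ?_) j
  refine Splits.of_natDegree_le_one ?_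
  rw [add_comm, ← C_1]
  exact natDegree_linear_le

omit [DecidableEq ι] in
lemma elemSymm_zero (f : ι → ℝ) (s : Finset ι) : elemSymm f s 0 = 1 := by
  simp [elemSymm]

open Polynomial in
lemma elemSymm_succ (f : ι → ℝ) {s : Finset ι} {i : ι} (hi : i ∈ s) (j : ℕ) :
    elemSymm f s (j + 1) = f i * elemSymm f (s.erase i) j + elemSymm f (s.erase i) (j + 1) := by
  simp only [← coeff_prod_one_add]
  rw [← Finset.mul_prod_erase s _ hi, add_mul, one_mul, coeff_add, mul_assoc, coeff_C_mul,
    coeff_X_mul, add_comm]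

/-- In the cone `Γ_k⁺`, the derivatives of `σ_1, …, σ_k` in each coordinate direction are
positive. -/
lemma elemSymm_erase_pos {f : ι → ℝ} {s : Finset ι} {i : ι} (hi : i ∈ s) {k : ℕ}
    (h : ∀ j, 1 ≤ j → j ≤ k → 0 < elemSymm f s j) {j : ℕ} (hj : j < k) :
    0 < elemSymm f (s.erase i) j := by
  induction j with
  | zero => simp [elemSymm_zero]
  | succ j ih =>
    have ha := ih (by omega)
    have h1 := h (j + 1) (by omega) (by omega)
    have h2 := h (j + 2) (by omega) (by omega)
    rw [elemSymm_succ f hi] at h1 h2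
    have h3 := elemSymm_mul_le_sq f (s.erase i) j
    set a := elemSymm f (s.erase i) j
    set b := elemSymm f (s.erase i) (j + 1)
    set c := elemSymm f (s.erase i) (j + 2)
    by_contra! hb
    -- otherwise `f i > 0` and `a c > (f i) a (-b) ≥ b ^ 2`, against Newton's inequality
    have h4 : a * (f i * b + c) > 0 := mul_pos ha h2
    have h5 : 0 ≤ (f i * a + b) * (-b) := mul_nonneg h1.le (by linarith)
    nlinarith

end ElementarySymmetric

/-! ### Nonnegativity of the Newton tensor -/

section DiagonalNewton

open Matrix

variable {ι : Type} [Fintype ι] [DecidableEq ι]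

omit [Fintype ι] in
lemma genDelta_self_of_injective {m : ℕ} {I : Fin m → ι} (hI : Function.Injective I) :
    genDelta I I = 1 := by
  rw [genDelta, show (of fun a b : Fin m => if I a = I b then (1 : ℂ) else 0) = 1 from ?_, det_one]
  ext a b
  simp [Matrix.one_apply, hI.eq_iff]

omit [Fintype ι] in
lemma genDelta_eq_zero_of_eq {m : ℕ} {I J : Fin m → ι} {a b : Fin m} (hab : a ≠ b)
    (h : J a = J b) : genDelta I J = 0 := by
  rw [genDelta]
  exact det_zero_of_column_eq hab fun c => by simp [h]

omit [Fintype ι] in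
lemma genDelta_eq_zero_of_forall_ne {m : ℕ} {I J : Fin m → ι} {b : Fin m}
    (h : ∀ a, I a ≠ J b) : genDelta I J = 0 := by
  rw [genDelta]
  exact det_eq_zero_of_column_eq_zero b fun a => by simp [h]

/-- Each `m`-element set has `m!` enumerations. -/
lemma sum_injective_prod {m : ℕ} (f : ι → ℝ) (s : Finset ι) :
    ∑ I : Fin m → ι, (if Function.Injective I ∧ ∀ a, I a ∈ s then ∏ a, f (I a) else 0) =
      m.factorial * elemSymm f s m := by
  classical
  rw [← Finset.sum_filter, elemSymm, Finset.mul_sum]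
  rw [← Finset.sum_fiberwise_of_maps_to (t := s.powersetCard m)
    (g := fun I : Fin m → ι => Finset.univ.image I)]
  · refine Finset.sum_congr rfl fun t ht => ?_
    obtain ⟨hts, htm⟩ := Finset.mem_powersetCard.1 ht
    have h1 : ∀ I ∈ (Finset.univ.filter fun I : Fin m → ι =>
        Function.Injective I ∧ ∀ a, I a ∈ s).filter (fun I => Finset.univ.image I = t),
        ∏ a, f (I a) = ∏ i ∈ t, f i := by
      intro I hI
      simp only [Finset.mem_filter, Finset.mem_univ, true_and] at hI
      rw [← hI.2, Finset.prod_image fun a _ b _ h => hI.1.1 h]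
    rw [Finset.sum_congr rfl h1, Finset.sum_const, nsmul_eq_mul]
    congr 2
    -- enumerations of `t` are the bijections `Fin m ≃ t`
    rw [show m.factorial = (Finset.univ : Finset (Equiv.Perm (Fin m))).card by
      rw [Finset.card_univ, Fintype.card_perm, Fintype.card_fin]]
    have e : Fin m ≃ t := (finCongr htm.symm).trans t.equivFin.symm
    symm
    refine Finset.card_bij (fun σ _ => fun a => (e (σ a) : ι)) ?_ ?_ ?_
    · intro σ _
      simp only [Finset.mem_filter, Finset.mem_univ, true_and]
      refine ⟨⟨fun a b h => σ.injective (e.injective (Subtype.ext h)),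
        fun a => hts (e (σ a)).2⟩, ?_⟩
      ext i
      simp only [Finset.mem_image, Finset.mem_univ, true_and]
      constructor
      · rintro ⟨a, rfl⟩
        exact (e (σ a)).2
      · intro hi
        exact ⟨σ.symm (e.symm ⟨i, hi⟩), by simp⟩
    · intro σ _ τ _ h
      ext a
      have := congrFun h a
      exact congrArg Fin.val (e.injective (Subtype.ext this))
    · intro I hI
      simp only [Finset.mem_filter, Finset.mem_univ, true_and] at hI
      have hmem (a : Fin m) : I a ∈ t := hI.2 ▸ Finset.mem_image_of_mem I (Finset.mem_univ a)
      have hinj : Function.Injective fun a => e.symm ⟨I a, hmem a⟩ := by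
        intro a b h
        exact hI.1.1 (congrArg Subtype.val (e.symm.injective h))
      refine ⟨Equiv.ofBijective _ (Finite.injective_iff_bijective.1 hinj), Finset.mem_univ _, ?_⟩
      funext a
      simp
  · intro I hI
    simp only [Finset.mem_filter, Finset.mem_univ, true_and] at hI
    rw [Finset.mem_powersetCard]
    refine ⟨fun i hi => ?_, ?_⟩
    · obtain ⟨a, -, rfl⟩ := Finset.mem_image.1 hi
      exact hI.2 a
    · rw [Finset.card_image_of_injective _ hI.1, Finset.card_univ, Fintype.card_fin]

/-- The Newton tensor of a diagonal matrix is diagonal, and its entries are the elementary symmetric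
functions with one variable left out. -/
lemma newton_diagonal (m : ℕ) (f : ι → ℝ) :
    newton m (diagonal fun i => (f i : ℂ)) =
      diagonal fun i => (elemSymm f (Finset.univ.erase i) m : ℂ) := by
  have hm : (m.factorial : ℂ) ≠ 0 := Nat.cast_ne_zero.2 m.factorial_ne_zero
  ext j i
  have hd (I J : Fin m → ι) : ∏ l, (diagonal fun i => (f i : ℂ)) (I l) (J l) =
      if I = J then ∏ l, (f (I l) : ℂ) else 0 := by
    simp only [diagonal_apply, Finset.prod_ite_zero, Finset.mem_univ, true_implies, funext_iff]
  simp only [newton, of_apply, hd, mul_ite, mul_zero, Finset.sum_ite_eq, Finset.mem_univ, if_true]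
  rcases eq_or_ne i j with rfl | hij
  · rw [diagonal_apply_eq, one_div, inv_mul_eq_iff_eq_mul₀ hm, ← Complex.ofReal_natCast,
      ← Complex.ofReal_mul, ← sum_injective_prod, Complex.ofReal_sum]
    refine Finset.sum_congr rfl fun I _ => ?_
    split_ifs with h
    · rw [genDelta_self_of_injective, one_mul, Complex.ofReal_prod]
      rw [Fin.cons_injective_iff]
      exact ⟨by rintro ⟨a, ha⟩; simpa [ha] using h.2 a, h.1⟩
    · have h2 : ¬ Function.Injective (Fin.cons i I : Fin (m + 1) → ι) := by
        rw [Fin.cons_injective_iff]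
        rintro ⟨h3, h4⟩
        exact h ⟨h4, fun a => by simpa using fun ha => h3 ⟨a, ha⟩⟩
      simp only [Function.Injective, not_forall] at h2
      obtain ⟨a, b, hab, hne⟩ := h2
      rw [genDelta_eq_zero_of_eq hne hab, zero_mul, Complex.ofReal_zero]
  · rw [diagonal_apply_ne _ hij.symm, Finset.sum_eq_zero, mul_zero]
    intro I _
    by_cases h : ∃ a, I a = j
    · obtain ⟨a, ha⟩ := h
      rw [genDelta_eq_zero_of_eq (a := 0) (b := a.succ) (Fin.succ_ne_zero a).symm (by simp [ha]),
        zero_mul]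
    · rw [genDelta_eq_zero_of_forall_ne (b := 0), zero_mul]
      intro a
      refine Fin.cases ?_ (fun a => ?_) a
      · simpa using hij
      · simpa using fun ha => h ⟨a, ha⟩

/-- `σ_k` is invariant under simultaneous conjugation. -/
lemma sigmaPol_conj {k : ℕ} (U W : Matrix ι ι ℂ) (h : W * U = 1) (B : Fin k → Matrix ι ι ℂ) :
    sigmaPol (fun l => U * B l * W) = sigmaPol B := by
  rw [sigmaPol_mul_mul, sigmaPol, h]
  congr 1
  refine Finset.sum_congr rfl fun P _ => Finset.sum_congr rfl fun Q _ => ?_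
  congr 1
  rw [genDelta]
  congr 1
  ext a b
  simp [Matrix.one_apply, eq_comm]

/-- The Newton tensor `T_{k-1}` is nonnegative on the cone `Γ_k⁺`. -/
lemma newton_nonneg {k : ℕ} (hk : 1 ≤ k) {A : Matrix ι ι ℂ} (hA : A ∈ gammaCone ι k)
    (x : ι → ℂ) : 0 ≤ (∑ i, ∑ j, x i * star (x j) * newton (k - 1) A j i).re := by
  obtain ⟨hH, hpos⟩ := hA
  set U : Matrix ι ι ℂ := hH.eigenvectorUnitary.1
  set D : Matrix ι ι ℂ := diagonal fun i => (hH.eigenvalues i : ℂ)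
  have hUU : star U * U = 1 := Unitary.coe_star_mul_self _
  have hUU' : U * star U = 1 := Unitary.coe_mul_star_self _
  have hAD : A = U * D * star U := hH.spectral_theorem
  -- the quadratic form is the pairing of the Newton tensor with `x ⊗ x̄`, a polarized `σ_k`
  set B : Matrix ι ι ℂ := of fun i j => x i * star (x j) with hB
  have h1 : ∑ i, ∑ j, x i * star (x j) * newton (k - 1) A j i =
      ∑ i, ∑ j, (star U * B * U) i j * newton (k - 1) D j i := by
    have h2 := sum_mul_newton (m := k - 1) A B
    simp only [hB, of_apply] at h2 ⊢
    rw [h2, sum_mul_newton, ← hB,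
      ← sigmaPol_conj U (star U) hUU (Fin.cons (star U * B * U) fun _ => D)]
    congr 2
    funext l
    refine Fin.cases ?_ (fun l => ?_) l
    · simp only [Fin.cons_zero]
      rw [show U * (star U * B * U) * star U = (U * star U) * B * (U * star U) by
        simp only [Matrix.mul_assoc], hUU', Matrix.one_mul, Matrix.mul_one]
    · simp only [Fin.cons_succ]
      exact hAD
  rw [h1, newton_diagonal]
  have h3 (i : ι) : (star U * B * U) i i =
      ((‖∑ l, star (U l i) * x l‖ ^ 2 : ℝ) : ℂ) := by
    rw [Complex.ofReal_pow, ← Complex.mul_conj', map_sum, Finset.sum_mul_sum]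
    simp only [Matrix.mul_apply, Finset.sum_mul, hB, of_apply, star_apply]
    rw [Finset.sum_comm]
    refine Finset.sum_congr rfl fun l _ => Finset.sum_congr rfl fun m _ => ?_
    simp only [map_mul, RCLike.star_def, Complex.conj_conj]
    ring
  simp only [diagonal_apply, mul_ite, mul_zero, Finset.sum_ite_eq',
    Finset.mem_univ, if_true, h3, ← Complex.ofReal_mul, ← Complex.ofReal_sum, Complex.ofReal_re]
  exact Finset.sum_nonneg fun i _ => mul_nonneg (sq_nonneg _)
    (elemSymm_erase_pos (Finset.mem_univ i) hpos (by omega)).le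

end DiagonalNewton

/-! ### Antisymmetry of the Kronecker delta -/

section NewtonDivergence

open Matrix

variable {ι : Type} [Fintype ι] [DecidableEq ι]

omit [Fintype ι] in
lemma genDelta_comp_swap {k : ℕ} (I J : Fin k → ι) {a b : Fin k} (hab : a ≠ b) :
    genDelta I (J ∘ Equiv.swap a b) = -genDelta I J := by
  have := det_permute' (Equiv.swap a b) (of fun a b => if I a = J b then (1 : ℂ) else 0)
  rw [Equiv.Perm.sign_swap hab] at this
  rw [genDelta, genDelta]
  exact this.trans (by simp)

/-- The antisymmetry of `δ` makes the divergence of the Newton tensor vanish: `B j p q` stands for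
the derivative `∂_j A_{pq}`, which is symmetric in `j` and `q`. -/
lemma sum_genDelta_cons_eq_zero {m : ℕ} (A : Matrix ι ι ℂ) (B : ι → ι → ι → ℂ)
    (hB : ∀ j p q, B j p q = B q p j) (i : ι) (I : Fin m → ι) (l : Fin m) :
    ∑ j, ∑ J : Fin m → ι, genDelta (Fin.cons i I : Fin (m + 1) → ι) (Fin.cons j J) *
      ((∏ l' ∈ Finset.univ.erase l, A (I l') (J l')) * B j (I l) (J l)) = 0 := by
  set F : (Fin (m + 1) → ι) → ℂ := fun K => genDelta (Fin.cons i I : Fin (m + 1) → ι) K *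
    ((∏ l' ∈ Finset.univ.erase l, A (I l') (K l'.succ)) * B (K 0) (I l) (K l.succ)) with hF
  have h1 : ∑ K, F K = ∑ j, ∑ J : Fin m → ι,
      genDelta (Fin.cons i I : Fin (m + 1) → ι) (Fin.cons j J) *
      ((∏ l' ∈ Finset.univ.erase l, A (I l') (J l')) * B j (I l) (J l)) := by
    rw [sum_cons]
    simp [hF]
  rw [← h1]
  have h2 (K : Fin (m + 1) → ι) : F (K ∘ Equiv.swap 0 l.succ) = -F K := by
    simp only [hF]
    rw [genDelta_comp_swap _ _ (Fin.succ_ne_zero l).symm, neg_mul]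
    congr 2
    simp only [Function.comp_apply, Equiv.swap_apply_left, Equiv.swap_apply_right]
    rw [hB]
    congr 1
    refine Finset.prod_congr rfl fun l' hl' => ?_
    rw [Equiv.swap_apply_of_ne_of_ne (Fin.succ_ne_zero l')
      fun h => Finset.ne_of_mem_erase hl' (Fin.succ_injective _ h)]
  have h3 : ∑ K, F K = ∑ K : Fin (m + 1) → ι, F (K ∘ Equiv.swap 0 l.succ) := by
    rw [← (Equiv.arrowCongr (Equiv.swap 0 l.succ) (Equiv.refl ι)).sum_comp]
    refine Finset.sum_congr rfl fun K _ => ?_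
    congr 1
  simp only [h2, Finset.sum_neg_distrib] at h3
  exact self_eq_neg.1 h3

end NewtonDivergence

/-! ### Complex Hessians and their Newton tensors -/

section WirtingerDerivative

variable {n : ℕ}

/-- The value of a real-linear form on `Z̄_j = (e_j + √-1 J e_j) / √2`. -/
def dbarForm (j : Fin n) : (Cn n →L[ℝ] ℂ) →ₗ[ℂ] ℂ where
  toFun φ := (1 / (Real.sqrt 2 : ℂ)) *
    (φ (stdVec j) + Complex.I * φ (Complex.I • stdVec j))
  map_add' φ ψ := by simp; ring
  map_smul' c φ := by simp; ring

lemma dbarForm_apply (j : Fin n) (φ : Cn n →L[ℝ] ℂ) : dbarForm j φ =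
    (1 / (Real.sqrt 2 : ℂ)) * (φ (stdVec j) + Complex.I * φ (Complex.I • stdVec j)) := rfl

/-- `Z̄_j f` for a complex function `f`. -/
def dbar (j : Fin n) (f : Cn n → ℂ) (x : Cn n) : ℂ := dbarForm j (fderiv ℝ f x)

lemma one_div_sqrt_two_mul_self :
    (1 / (Real.sqrt 2 : ℂ)) * (1 / (Real.sqrt 2 : ℂ)) = 1 / 2 := by
  rw [div_mul_div_comm, one_mul, ← Complex.ofReal_mul, Real.mul_self_sqrt (by norm_num)]
  norm_num

/-- `Z̄_j` and `Z̄_q` commute. -/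
lemma dbar_dbar_comm {f : Cn n → ℂ} {x : Cn n} (hf : ContDiffAt ℝ 2 f x) (j q : Fin n) :
    dbar j (dbar q f) x = dbar q (dbar j f) x := by
  have h1 : ContDiffAt ℝ 1 (fderiv ℝ f) x := hf.fderiv_right (by norm_num)
  have h2 : DifferentiableAt ℝ (fderiv ℝ f) x := h1.differentiableAt one_ne_zero
  have h3 : IsSymmSndFDerivAt ℝ f x := hf.isSymmSndFDerivAt (by simp)
  have h4 (q : Fin n) (w : Cn n) : fderiv ℝ (dbar q f) x w = (1 / (Real.sqrt 2 : ℂ)) *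
      (fderiv ℝ (fderiv ℝ f) x w (stdVec q) +
        Complex.I * fderiv ℝ (fderiv ℝ f) x w (Complex.I • stdVec q)) := by
    have h5 (y : Cn n) : HasFDerivAt (fun z => fderiv ℝ f z y)
        ((ContinuousLinearMap.apply ℝ ℂ y).comp (fderiv ℝ (fderiv ℝ f) x)) x :=
      (ContinuousLinearMap.apply ℝ ℂ y).hasFDerivAt.comp x h2.hasFDerivAt
    have h6 : HasFDerivAt (dbar q f) _ x := ((h5 (stdVec q)).add
      ((h5 (Complex.I • stdVec q)).const_mul Complex.I)).const_mul (1 / (Real.sqrt 2 : ℂ))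
    rw [h6.fderiv]
    rfl
  rw [dbar, dbar, dbarForm_apply, dbarForm_apply, h4, h4, h4, h4,
    h3.eq (stdVec j) (stdVec q), h3.eq (stdVec j) (Complex.I • stdVec q),
    h3.eq (Complex.I • stdVec j) (stdVec q),
    h3.eq (Complex.I • stdVec j) (Complex.I • stdVec q)]
  ring

lemma dbar_congr {f g : Cn n → ℂ} {x : Cn n} (h : f =ᶠ[nhds x] g) (j : Fin n) :
    dbar j f x = dbar j g x := by
  rw [dbar, dbar, h.fderiv_eq]

variable {X : Set (Cn n)}

lemma closure_mem_nhds (hX : IsOpen X) {x : Cn n} (hx : x ∈ X) : closure X ∈ nhds x :=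
  Filter.mem_of_superset (hX.mem_nhds hx) subset_closure

lemma contDiffOn_fderivWithin_apply_const (hU : UniqueDiffOn ℝ (closure X)) {u : Cn n → ℝ}
    (hu : SmoothOnClosure X u) (Y : Cn n) :
    ContDiffOn ℝ ∞ (fun x => fderivWithin ℝ u (closure X) x Y) (closure X) :=
  (ContDiffOn.fderivWithin hu hU (by simp)).clm_apply contDiffOn_const

lemma contDiffOn_dZ (hU : UniqueDiffOn ℝ (closure X)) {u : Cn n → ℝ}
    (hu : SmoothOnClosure X u) (i : Fin n) : ContDiffOn ℝ ∞ (dZ X u i) (closure X) :=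
  contDiffOn_const.mul ((Complex.ofRealCLM.contDiff.comp_contDiffOn
    (contDiffOn_fderivWithin_apply_const hU hu _)).sub
    (contDiffOn_const.mul (Complex.ofRealCLM.contDiff.comp_contDiffOn
      (contDiffOn_fderivWithin_apply_const hU hu _))))

lemma contDiffOn_dZbar (hU : UniqueDiffOn ℝ (closure X)) {u : Cn n → ℝ}
    (hu : SmoothOnClosure X u) (i : Fin n) : ContDiffOn ℝ ∞ (dZbar X u i) (closure X) :=
  contDiffOn_const.mul ((Complex.ofRealCLM.contDiff.comp_contDiffOn
    (contDiffOn_fderivWithin_apply_const hU hu _)).add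
    (contDiffOn_const.mul (Complex.ofRealCLM.contDiff.comp_contDiffOn
      (contDiffOn_fderivWithin_apply_const hU hu _))))

lemma contDiffOn_hess (hU : UniqueDiffOn ℝ (closure X)) {u : Cn n → ℝ}
    (hu : SmoothOnClosure X u) (Y Y' : Cn n) :
    ContDiffOn ℝ ∞ (fun x => hess X u x Y Y') (closure X) := by
  have h1 : ContDiffOn ℝ ∞ (fderivWithin ℝ u (closure X)) (closure X) :=
    ContDiffOn.fderivWithin hu hU (by simp)
  have h2 : ContDiffOn ℝ ∞ (fderivWithin ℝ (fderivWithin ℝ u (closure X)) (closure X))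
      (closure X) := ContDiffOn.fderivWithin h1 hU (by simp)
  exact (h2.clm_apply contDiffOn_const).clm_apply contDiffOn_const

lemma contDiffOn_complexHessian (hU : UniqueDiffOn ℝ (closure X)) {u : Cn n → ℝ}
    (hu : SmoothOnClosure X u) (i j : Fin n) :
    ContDiffOn ℝ ∞ (fun x => complexHessian X u x i j) (closure X) :=
  contDiffOn_const.mul ((Complex.ofRealCLM.contDiff.comp_contDiffOn
    ((contDiffOn_hess hU hu _ _).add (contDiffOn_hess hU hu _ _))).add
    (contDiffOn_const.mul (Complex.ofRealCLM.contDiff.comp_contDiffOn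
      ((contDiffOn_hess hU hu _ _).sub (contDiffOn_hess hU hu _ _)))))

lemma hess_symm (hX : IsOpen X) (hU : UniqueDiffOn ℝ (closure X)) {u : Cn n → ℝ}
    (hu : SmoothOnClosure X u) {x : Cn n} (hx : x ∈ closure X) (Y Y' : Cn n) :
    hess X u x Y Y' = hess X u x Y' Y := by
  have h1 : x ∈ closure (interior (closure X)) :=
    closure_mono (hX.subset_interior_iff.2 subset_closure) hx
  exact ((hu x hx).isSymmSndFDerivWithinAt (n := ∞)
    (by rw [minSmoothness_of_isRCLikeNormedField]; norm_cast) hU h1 hx).eq Y Y'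

lemma isHermitian_complexHessian (hX : IsOpen X) (hU : UniqueDiffOn ℝ (closure X)) {u : Cn n → ℝ}
    (hu : SmoothOnClosure X u) {x : Cn n} (hx : x ∈ closure X) :
    (complexHessian X u x).IsHermitian := by
  ext i j
  simp only [Matrix.conjTranspose_apply, complexHessian, mixedMatrix, Matrix.of_apply, mixedPart]
  rw [hess_symm hX hU hu hx (stdVec j) (stdVec i),
    hess_symm hX hU hu hx (Complex.I • stdVec j) (Complex.I • stdVec i),
    hess_symm hX hU hu hx (stdVec j) (Complex.I • stdVec i),
    hess_symm hX hU hu hx (Complex.I • stdVec j) (stdVec i)]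
  simp only [RCLike.star_def, map_mul, map_add, Complex.conj_I, Complex.conj_ofReal, map_div₀,
    map_one, map_ofNat]
  push_cast
  ring

/-- `u_{i j̄} = Z̄_j Z_i u`. -/
lemma complexHessian_eq_dbar (hX : IsOpen X) (hU : UniqueDiffOn ℝ (closure X)) {u : Cn n → ℝ}
    (hu : SmoothOnClosure X u) {x : Cn n} (hx : x ∈ X) (i j : Fin n) :
    complexHessian X u x i j = dbar j (dZ X u i) x := by
  have hxc := subset_closure hx
  have h1 : ContDiffOn ℝ ∞ (fderivWithin ℝ u (closure X)) (closure X) :=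
    ContDiffOn.fderivWithin hu hU (by simp)
  have h2 : HasFDerivAt (fderivWithin ℝ u (closure X))
      (fderivWithin ℝ (fderivWithin ℝ u (closure X)) (closure X) x) x :=
    ((h1.differentiableOn (by simp)) x hxc).hasFDerivWithinAt.hasFDerivAt (closure_mem_nhds hX hx)
  have h3 (w : Cn n) : HasFDerivAt (fun y => ((fderivWithin ℝ u (closure X) y w : ℝ) : ℂ))
      (Complex.ofRealCLM.comp ((ContinuousLinearMap.apply ℝ ℝ w).comp
        (fderivWithin ℝ (fderivWithin ℝ u (closure X)) (closure X) x))) x :=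
    Complex.ofRealCLM.hasFDerivAt.comp x ((ContinuousLinearMap.apply ℝ ℝ w).hasFDerivAt.comp x h2)
  have h4 : HasFDerivAt (dZ X u i) _ x := ((h3 (stdVec i)).sub
      ((h3 (Complex.I • stdVec i)).const_mul Complex.I)).const_mul (1 / (Real.sqrt 2 : ℂ))
  have h5 (w : Cn n) : fderiv ℝ (dZ X u i) x w = (1 / (Real.sqrt 2 : ℂ)) *
      ((hess X u x w (stdVec i) : ℝ) - Complex.I * (hess X u x w (Complex.I • stdVec i) : ℝ)) := by
    rw [h4.fderiv]
    rfl
  rw [dbar, dbarForm_apply, h5, h5, hess_symm hX hU hu hxc (stdVec j),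
    hess_symm hX hU hu hxc (stdVec j), hess_symm hX hU hu hxc (Complex.I • stdVec j),
    hess_symm hX hU hu hxc (Complex.I • stdVec j)]
  simp only [complexHessian, mixedMatrix, Matrix.of_apply, mixedPart]
  rw [← one_div_sqrt_two_mul_self]
  push_cast
  linear_combination ((1 / (Real.sqrt 2 : ℂ)) * (1 / (Real.sqrt 2 : ℂ)) *
    (hess X u x (Complex.I • stdVec i) (Complex.I • stdVec j) : ℝ)) * Complex.I_mul_I

/-- `Z̄_j u_{p q̄}` is symmetric in `j` and `q`. -/
lemma dbar_complexHessian_comm (hX : IsOpen X) (hU : UniqueDiffOn ℝ (closure X)) {u : Cn n → ℝ}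
    (hu : SmoothOnClosure X u) {x : Cn n} (hx : x ∈ X) (j p q : Fin n) :
    dbar j (fun y => complexHessian X u y p q) x =
      dbar q (fun y => complexHessian X u y p j) x := by
  have h1 (q : Fin n) : (fun y => complexHessian X u y p q) =ᶠ[nhds x] dbar q (dZ X u p) := by
    filter_upwards [hX.mem_nhds hx] with y hy
    exact complexHessian_eq_dbar hX hU hu hy p q
  rw [dbar_congr (h1 q), dbar_congr (h1 j)]
  refine dbar_dbar_comm ?_ j q
  exact ((contDiffOn_dZ hU hu p).contDiffAt (closure_mem_nhds hX hx)).of_le (by norm_cast)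

lemma contDiffOn_newton {m : ℕ} {A : Cn n → Matrix (Fin n) (Fin n) ℂ} {s : Set (Cn n)}
    (hA : ∀ i j, ContDiffOn ℝ ∞ (fun x => A x i j) s) (i j : Fin n) :
    ContDiffOn ℝ ∞ (fun x => newton m (A x) j i) s :=
  contDiffOn_const.mul (ContDiffOn.sum fun _ _ => ContDiffOn.sum fun _ _ =>
    contDiffOn_const.mul (contDiffOn_prod fun _ _ => hA _ _))

/-- The Newton tensor of a complex Hessian is divergence free. -/
lemma sum_dbar_newton_eq_zero (hX : IsOpen X) (hU : UniqueDiffOn ℝ (closure X)) {u : Cn n → ℝ}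
    (hu : SmoothOnClosure X u) {x : Cn n} (hx : x ∈ X) (m : ℕ) (i : Fin n) :
    ∑ j, dbar j (fun y => newton m (complexHessian X u y) j i) x = 0 := by
  set A := complexHessian X u
  have hA (p q : Fin n) : HasFDerivAt (fun y => A y p q) (fderiv ℝ (fun y => A y p q) x) x :=
    (((contDiffOn_complexHessian hU hu p q).contDiffAt
      (closure_mem_nhds hX hx)).differentiableAt (by simp)).hasFDerivAt
  have h1 (j : Fin n) : HasFDerivAt (fun y => newton m (A y) j i)
      ((1 / (m.factorial : ℂ)) • ∑ I : Fin m → Fin n, ∑ J : Fin m → Fin n,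
        genDelta (Fin.cons i I : Fin (m + 1) → Fin n) (Fin.cons j J) •
          ∑ l, (∏ l' ∈ Finset.univ.erase l, A x (I l') (J l')) •
            fderiv ℝ (fun y => A y (I l) (J l)) x) x :=
    (HasFDerivAt.fun_sum fun I _ => HasFDerivAt.fun_sum fun J _ =>
      (HasFDerivAt.finsetProd fun l _ => hA (I l) (J l)).const_mul _).const_mul _
  have h2 (j : Fin n) : dbar j (fun y => newton m (A y) j i) x =
      (1 / (m.factorial : ℂ)) * ∑ I : Fin m → Fin n, ∑ l, ∑ J : Fin m → Fin n,
        genDelta (Fin.cons i I : Fin (m + 1) → Fin n) (Fin.cons j J) *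
          ((∏ l' ∈ Finset.univ.erase l, A x (I l') (J l')) *
            dbar j (fun y => A y (I l) (J l)) x) := by
    rw [dbar, (h1 j).fderiv]
    simp only [map_smul, map_sum, smul_eq_mul, Finset.mul_sum]
    congr 1
    funext I
    rw [Finset.sum_comm]
    rfl
  simp only [h2, ← Finset.mul_sum]
  rw [Finset.sum_comm, Finset.sum_eq_zero, mul_zero]
  intro I _
  rw [Finset.sum_comm]
  refine Finset.sum_eq_zero fun l _ => ?_
  exact sum_genDelta_cons_eq_zero (A x) (fun j p q => dbar j (fun y => A y p q) x)
    (fun j p q => dbar_complexHessian_comm hX hU hu hx j p q) i I l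

end WirtingerDerivative

/-! ### Green's formula for the Newton tensor -/

section IntegrationByParts

variable {n : ℕ} {X : Set (Cn n)} {ν : Cn n → Cn n}

lemma inner_real_eq_re (x y : Cn n) : inner ℝ x y = (inner ℂ x y).re := by
  rw [PiLp.inner_apply, PiLp.inner_apply, Complex.re_sum]
  exact Finset.sum_congr rfl fun i _ => real_inner_eq_re_inner ℂ _ _

lemma inner_stdVec (j : Fin n) (y : Cn n) : inner ℝ (stdVec j) y = (y j).re := by
  rw [inner_real_eq_re, stdVec, EuclideanSpace.inner_single_left]
  simp

lemma inner_I_smul_stdVec (j : Fin n) (y : Cn n) :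
    inner ℝ (Complex.I • stdVec j) y = (y j).im := by
  rw [inner_real_eq_re, inner_smul_left, stdVec, EuclideanSpace.inner_single_left]
  simp

lemma continuousOn_normal_apply (hν : HasUnitNormal X ν) (j : Fin n) :
    ContinuousOn (fun p => ν p j) (frontier X) :=
  (EuclideanSpace.proj (𝕜 := ℂ) j).continuous.comp_continuousOn hν.continuousOn

lemma integrableOn_dbar (hν : HasUnitNormal X ν) (hX : IsOpen X) (hb : Bornology.IsBounded X)
    {f : Cn n → ℂ} (hf : ContDiffOn ℝ 1 f (closure X)) (j : Fin n) :
    IntegrableOn (dbar j f) X :=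
  ((hν.integrableOn_fderiv hX hb hf _).add
    ((hν.integrableOn_fderiv hX hb hf _).const_mul Complex.I)).const_mul _

/-- The divergence theorem for `Z̄_j`, whose normal component is `ν_j / √2`. -/
lemma integral_dbar (hν : HasUnitNormal X ν) (hX : IsOpen X) (hb : Bornology.IsBounded X)
    {f : Cn n → ℂ} (hf : ContDiffOn ℝ 1 f (closure X)) (j : Fin n) :
    ∫ x in X, dbar j f x = ∫ x in frontier X, (1 / (Real.sqrt 2 : ℂ)) * (ν x j * f x)
      ∂μHE[Module.finrank ℝ (Cn n) - 1] := by
  have hi (e : Cn n) := hν.integrableOn_fderiv hX hb hf e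
  have hfc : ContinuousOn f (frontier X) := hf.continuousOn.mono frontier_subset_closure
  have hb' (e : Cn n) : IntegrableOn (fun x => (inner ℝ e (ν x) : ℝ) • f x) (frontier X)
      μHE[Module.finrank ℝ (Cn n) - 1] := by
    refine hν.integrableOn_frontier hX hb ?_
    exact (hν.continuousOn_inner e).smul hfc
  simp only [dbar, dbarForm_apply]
  rw [integral_const_mul, integral_add (hi _) ((hi _).const_mul _), integral_const_mul,
    hν.integral_fderiv hX hb hf, hν.integral_fderiv hX hb hf, integral_const_mul,
    ← integral_const_mul, ← integral_add (hb' _) ((hb' _).const_mul _)]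
  congr 2
  funext x
  rw [inner_stdVec, inner_I_smul_stdVec, Complex.real_smul, Complex.real_smul]
  conv_rhs => rw [← Complex.re_add_im (ν x j)]
  ring

lemma dbar_mul {f g : Cn n → ℂ} {x : Cn n} (hf : DifferentiableAt ℝ f x)
    (hg : DifferentiableAt ℝ g x) (j : Fin n) :
    dbar j (fun y => f y * g y) x = dbar j f x * g x + f x * dbar j g x := by
  have h1 : HasFDerivAt (fun y => f y * g y) _ x := hf.hasFDerivAt.mul hg.hasFDerivAt
  rw [dbar, h1.fderiv, map_add, map_smul, map_smul, dbar, dbar]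
  simp only [smul_eq_mul]
  ring

lemma contDiffOn_ofReal {u : Cn n → ℝ} (hu : SmoothOnClosure X u) :
    ContDiffOn ℝ ∞ (fun x => (u x : ℂ)) (closure X) :=
  Complex.ofRealCLM.contDiff.comp_contDiffOn hu

lemma dbar_ofReal (hX : IsOpen X) {u : Cn n → ℝ} (hu : SmoothOnClosure X u) {x : Cn n}
    (hx : x ∈ X) (j : Fin n) : dbar j (fun y => (u y : ℂ)) x = dZbar X u j x := by
  have h1 : HasFDerivAt u (fderivWithin ℝ u (closure X) x) x :=
    ((hu.differentiableOn (by simp)) x (subset_closure hx)).hasFDerivWithinAt.hasFDerivAt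
      (closure_mem_nhds hX hx)
  have h2 : HasFDerivAt (fun y => (u y : ℂ))
      (Complex.ofRealCLM.comp (fderivWithin ℝ u (closure X) x)) x :=
    Complex.ofRealCLM.hasFDerivAt.comp x h1
  rw [dbar, h2.fderiv]
  rfl

/-- Green's formula for the divergence-free Newton tensor of the complex Hessian of `w`. -/
lemma integral_newton_green (hν : HasUnitNormal X ν) (hX : IsOpen X) (hb : Bornology.IsBounded X)
    {a b w : Cn n → ℝ} (ha : SmoothOnClosure X a) (hb' : SmoothOnClosure X b)
    (hw : SmoothOnClosure X w) (m : ℕ) :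
    ∫ x in X, ∑ i, ∑ j, (dZ X b i x * dZbar X a j x * newton m (complexHessian X w x) j i +
        a x * (complexHessian X b x i j * newton m (complexHessian X w x) j i)) =
      ∫ p in frontier X, ∑ i, ∑ j, (1 / (Real.sqrt 2 : ℂ)) * (ν p j *
        (a p * (dZ X b i p * newton m (complexHessian X w p) j i)))
        ∂μHE[Module.finrank ℝ (Cn n) - 1] := by
  have hU := hν.uniqueDiffOn_closure hX
  set W : Fin n → Fin n → Cn n → ℂ := fun j i x => newton m (complexHessian X w x) j i
  have hW (j i : Fin n) : ContDiffOn ℝ ∞ (W j i) (closure X) :=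
    contDiffOn_newton (fun i j => contDiffOn_complexHessian hU hw i j) i j
  have ha' := contDiffOn_ofReal ha
  have hbW (i j : Fin n) : ContDiffOn ℝ ∞ (fun x => dZ X b i x * W j i x) (closure X) :=
    (contDiffOn_dZ hU hb' i).mul (hW j i)
  have hF (i j : Fin n) :
      ContDiffOn ℝ 1 (fun x => (a x : ℂ) * (dZ X b i x * W j i x)) (closure X) :=
    (ha'.mul (hbW i j)).of_le (by norm_cast)
  have h1 : ∀ x ∈ X, ∑ i, ∑ j, (dZ X b i x * dZbar X a j x * W j i x +
      a x * (complexHessian X b x i j * W j i x)) =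
      ∑ i, ∑ j, dbar j (fun x => (a x : ℂ) * (dZ X b i x * W j i x)) x := by
    intro x hx
    refine Finset.sum_congr rfl fun i _ => ?_
    have h2 (j : Fin n) : dbar j (fun x => (a x : ℂ) * (dZ X b i x * W j i x)) x =
        (dZ X b i x * dZbar X a j x * W j i x + a x * (complexHessian X b x i j * W j i x)) +
          a x * dZ X b i x * dbar j (W j i) x := by
      rw [dbar_mul (differentiableAt_of_contDiffOn_closure hX ha' hx)
        (differentiableAt_of_contDiffOn_closure hX (hbW i j) hx), dbar_ofReal hX ha hx,
        dbar_mul (differentiableAt_of_contDiffOn_closure hX (contDiffOn_dZ hU hb' i) hx)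
        (differentiableAt_of_contDiffOn_closure hX (hW j i) hx),
        ← complexHessian_eq_dbar hX hU hb' hx]
      ring
    simp only [h2]
    have h3 : ∑ j, a x * dZ X b i x * dbar j (W j i) x = 0 := by
      rw [← Finset.mul_sum, sum_dbar_newton_eq_zero hX hU hw hx, mul_zero]
    rw [Finset.sum_add_distrib (g := fun j => a x * dZ X b i x * dbar j (W j i) x), h3, add_zero]
  rw [setIntegral_congr_fun hX.measurableSet h1]
  have hcont (i j : Fin n) : IntegrableOn (fun p => (1 / (Real.sqrt 2 : ℂ)) * (ν p j *
      ((a p : ℂ) * (dZ X b i p * W j i p)))) (frontier X) μHE[Module.finrank ℝ (Cn n) - 1] := by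
    refine hν.integrableOn_frontier hX hb (continuousOn_const.mul ?_)
    exact (continuousOn_normal_apply hν j).mul
      ((hF i j).continuousOn.mono frontier_subset_closure)
  rw [integral_finsetSum _ fun i _ => integrable_finsetSum _ fun j _ =>
    integrableOn_dbar hν hX hb (hF i j) j,
    integral_finsetSum _ fun i _ => integrable_finsetSum _ fun j _ => hcont i j]
  refine Finset.sum_congr rfl fun i _ => ?_
  rw [integral_finsetSum _ fun j _ => integrableOn_dbar hν hX hb (hF i j) j,
    integral_finsetSum _ fun j _ => hcont i j]
  exact Finset.sum_congr rfl fun j _ => integral_dbar hν hX hb (hF i j) j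

end IntegrationByParts

/-! ### The outward normal and the second fundamental form -/

section OutwardNormal

open Filter Topology

variable {n : ℕ} {X : Set (Cn n)}

lemma IsLocalDefiningFunction.differentiableAt {U : Set (Cn n)} {ρ : Cn n → ℝ} {p : Cn n}
    (h : IsLocalDefiningFunction X p U ρ) {q : Cn n} (hq : q ∈ U) : DifferentiableAt ℝ ρ q :=
  (h.smooth.contDiffAt (h.isOpen.mem_nhds hq)).differentiableAt (by simp)

lemma IsLocalDefiningFunction.tendsto_slope {U : Set (Cn n)} {ρ : Cn n → ℝ} {p : Cn n}
    (h : IsLocalDefiningFunction X p U ρ) (hX : IsOpen X) (hp : p ∈ frontier X) (w : Cn n) :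
    Tendsto (fun t : ℝ => t⁻¹ * ρ (p + t • w)) (𝓝[>] 0) (𝓝 (inner ℝ (gradient ρ p) w)) := by
  have h1 : HasLineDerivAt ℝ ρ (fderiv ℝ ρ p w) p w :=
    (h.differentiableAt h.mem).hasFDerivAt.hasLineDerivAt w
  have h2 := HasDerivAt.tendsto_slope_zero_right h1
  rw [inner_gradient]
  refine h2.congr fun t => ?_
  simp [defining_eq_zero_of_mem_frontier hX h.isOpen h.smooth.continuousOn h.inter_eq hp h.mem]

/-- The unit normal does not depend on the defining function: the half-space `⟪∇ρ, w⟫ < 0` points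
into `X`, hence lies in `⟪∇ρ', w⟫ ≤ 0`. -/
lemma IsLocalDefiningFunction.normalized_gradient_eq {U U' : Set (Cn n)} {ρ ρ' : Cn n → ℝ}
    {p : Cn n} (h : IsLocalDefiningFunction X p U ρ) (h' : IsLocalDefiningFunction X p U' ρ')
    (hX : IsOpen X) (hp : p ∈ frontier X) :
    ‖gradient ρ p‖⁻¹ • gradient ρ p = ‖gradient ρ' p‖⁻¹ • gradient ρ' p := by
  have hn := norm_pos_iff.2 h.gradient_ne
  have hn' := norm_pos_iff.2 h'.gradient_ne
  have key (w : Cn n) (hw : inner ℝ (gradient ρ p) w < 0) : inner ℝ (gradient ρ' p) w ≤ 0 := by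
    have h1 := (h.tendsto_slope hX hp w).eventually_lt_const hw
    refine le_of_tendsto (h'.tendsto_slope hX hp w) ?_
    have hc : Tendsto (fun t : ℝ => p + t • w) (𝓝[>] 0) (𝓝 p) := by
      have : Continuous fun t : ℝ => p + t • w := by fun_prop
      simpa using (this.tendsto 0).mono_left nhdsWithin_le_nhds
    filter_upwards [h1, hc (h.isOpen.mem_nhds h.mem), hc (h'.isOpen.mem_nhds h'.mem),
      self_mem_nhdsWithin] with t ht htU htU' ht0
    have ht0' : (0 : ℝ) < t := ht0
    have h2 : ρ (p + t • w) < 0 := by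
      by_contra! h3
      exact absurd ht (not_lt.2 (mul_nonneg (inv_nonneg.2 ht0'.le) h3))
    have h3 : p + t • w ∈ X ∩ U := by
      rw [h.inter_eq]; exact ⟨htU, h2⟩
    have h4 : p + t • w ∈ X ∩ U' := ⟨h3.1, htU'⟩
    rw [h'.inter_eq] at h4
    exact mul_nonpos_of_nonneg_of_nonpos (inv_nonneg.2 ht0'.le) h4.2.le
  set a := ‖gradient ρ p‖⁻¹ • gradient ρ p with ha
  set b := ‖gradient ρ' p‖⁻¹ • gradient ρ' p with hb
  have ha1 : ‖a‖ = 1 := by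
    rw [ha, norm_smul, norm_inv, norm_norm, inv_mul_cancel₀ hn.ne']
  have hb1 : ‖b‖ = 1 := by
    rw [hb, norm_smul, norm_inv, norm_norm, inv_mul_cancel₀ hn'.ne']
  have hab : ¬ inner ℝ a b < (1 : ℝ) := by
    intro hlt
    have h1 : inner ℝ a (b - a) < (0 : ℝ) := by
      rw [inner_sub_right, real_inner_self_eq_norm_sq, ha1]; linarith
    have h2 : 0 < inner ℝ b (b - a) := by
      rw [inner_sub_right, real_inner_self_eq_norm_sq, hb1, real_inner_comm]; linarith
    rw [ha, real_inner_smul_left] at h1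
    rw [hb, real_inner_smul_left] at h2
    have h3 : inner ℝ (gradient ρ p) (b - a) < (0 : ℝ) := by
      by_contra! h4
      exact absurd h1 (not_lt.2 (mul_nonneg (inv_nonneg.2 hn.le) h4))
    exact absurd h2 (not_lt.2 (mul_nonpos_of_nonneg_of_nonpos (inv_nonneg.2 hn'.le) (key _ h3)))
  refine (inner_eq_one_iff_of_norm_eq_one (𝕜 := ℝ) ha1 hb1).1 (le_antisymm ?_ (not_lt.1 hab))
  simpa [ha1, hb1] using real_inner_le_norm a b

lemma IsLocalDefiningFunction.outwardNormal_eq {U : Set (Cn n)} {ρ : Cn n → ℝ} {p : Cn n}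
    (h : IsLocalDefiningFunction X p U ρ) (hX : IsOpen X) (hp : p ∈ frontier X) :
    outwardNormal X p = ‖gradient ρ p‖⁻¹ • gradient ρ p := by
  obtain ⟨U', ρ', h', he⟩ := Classical.epsilon_spec
    (p := fun ν => ∃ U ρ, IsLocalDefiningFunction X p U ρ ∧
      ν = ‖gradient ρ p‖⁻¹ • gradient ρ p) ⟨_, U, ρ, h, rfl⟩
  exact he.trans (h'.normalized_gradient_eq h hX hp)

lemma contDiffOn_gradient {U : Set (Cn n)} {ρ : Cn n → ℝ} (hU : IsOpen U)
    (h : ContDiffOn ℝ ∞ ρ U) : ContDiffOn ℝ ∞ (gradient ρ) U := by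
  set b := stdOrthonormalBasis ℝ (Cn n)
  have h1 (x : Cn n) : gradient ρ x = ∑ i, fderiv ℝ ρ x (b i) • b i := by
    rw [← b.sum_repr' (gradient ρ x)]
    refine Finset.sum_congr rfl fun i _ => ?_
    rw [real_inner_comm, inner_gradient]
  have h2 : gradient ρ = fun x => ∑ i, fderiv ℝ ρ x (b i) • b i := funext h1
  rw [h2]
  exact ContDiffOn.sum fun i _ =>
    ((h.fderiv_of_isOpen hU (by simp)).clm_apply contDiffOn_const).smul contDiffOn_const

/-- Near each boundary point the set has a defining function without critical points. -/
lemma IsSmoothBoundedDomain.exists_defining_gradient_ne (hX : IsSmoothBoundedDomain X) {p : Cn n}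
    (hp : p ∈ frontier X) : ∃ U ρ, p ∈ U ∧
      ∀ q ∈ U, IsLocalDefiningFunction X q U ρ := by
  obtain ⟨U, ρ, h⟩ := hX.exists_defining p hp
  have hc := (contDiffOn_gradient h.isOpen h.smooth).continuousOn
  refine ⟨U ∩ {q | gradient ρ q ≠ 0}, ρ, ⟨h.mem, h.gradient_ne⟩, fun q hq => ?_⟩
  refine ⟨?_, hq, h.smooth.mono inter_subset_left, ?_, hq.2⟩
  · exact hc.isOpen_inter_preimage h.isOpen isOpen_compl_singleton
  · rw [← inter_assoc, h.inter_eq]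
    ext x
    simp only [mem_inter_iff, mem_ofPred_eq]
    tauto

lemma IsSmoothBoundedDomain.hasUnitNormal (hX : IsSmoothBoundedDomain X) :
    HasUnitNormal X (outwardNormal X) := by
  intro p hp
  obtain ⟨U, ρ, hpU, h⟩ := hX.exists_defining_gradient_ne hp
  exact ⟨U, ρ, (h p hpU).isOpen, hpU, (h p hpU).smooth.of_le (by norm_cast),
    (h p hpU).inter_eq, fun q hq => ⟨(h q hq).gradient_ne,
      fun hqX => (h q hq).outwardNormal_eq hX.isOpen hqX⟩⟩

/-- The unit normal extends smoothly off the boundary. -/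
lemma IsSmoothBoundedDomain.exists_normal_extension (hX : IsSmoothBoundedDomain X) {p : Cn n}
    (hp : p ∈ frontier X) : ∃ (U : Set (Cn n)) (N : Cn n → Cn n), IsOpen U ∧ p ∈ U ∧
      ContDiffOn ℝ ∞ N U ∧ ∀ q ∈ frontier X ∩ U, outwardNormal X q = N q := by
  obtain ⟨U, ρ, hpU, h⟩ := hX.exists_defining_gradient_ne hp
  have hg := contDiffOn_gradient (h p hpU).isOpen (h p hpU).smooth
  refine ⟨U, fun q => ‖gradient ρ q‖⁻¹ • gradient ρ q, (h p hpU).isOpen, hpU, ?_,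
    fun q hq => (h q hq.2).outwardNormal_eq hX.isOpen hq.1⟩
  exact ((hg.norm ℝ fun q hq => (h q hq).gradient_ne).inv
    fun q hq => norm_ne_zero_iff.2 (h q hq).gradient_ne).smul hg

lemma hasFDerivWithinAt_outwardNormal {U : Set (Cn n)} {N : Cn n → Cn n} (hU : IsOpen U)
    (hN : ContDiffOn ℝ ∞ N U) (h : ∀ q ∈ frontier X ∩ U, outwardNormal X q = N q) {p : Cn n}
    (hp : p ∈ frontier X) (hpU : p ∈ U) :
    HasFDerivWithinAt (outwardNormal X) (fderiv ℝ N p) (frontier X) p := by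
  have h1 : HasFDerivWithinAt N (fderiv ℝ N p) (frontier X) p :=
    ((hN.contDiffAt (hU.mem_nhds hpU)).differentiableAt (by simp)).hasFDerivAt.hasFDerivWithinAt
  refine h1.congr_of_eventuallyEq ?_ (h p ⟨hp, hpU⟩)
  filter_upwards [self_mem_nhdsWithin, mem_nhdsWithin_of_mem_nhds (hU.mem_nhds hpU)] with q hq hqU
  exact h q ⟨hq, hqU⟩

/-- The derivative of `ν` along `M` may be computed with any extension of `ν`. -/
lemma secondFundamentalForm_eq (hX : IsSmoothBoundedDomain X) {U : Set (Cn n)} {N : Cn n → Cn n}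
    (hU : IsOpen U) (hN : ContDiffOn ℝ ∞ N U)
    (h : ∀ q ∈ frontier X ∩ U, outwardNormal X q = N q) {p : Cn n}
    (hp : p ∈ frontier X) (hpU : p ∈ U) {Y : Cn n} (hY : inner ℝ (outwardNormal X p) Y = 0)
    (Y' : Cn n) : secondFundamentalForm X p Y Y' = inner ℝ (fderiv ℝ N p Y) Y' := by
  have h1 := hasFDerivWithinAt_outwardNormal hU hN h hp hpU
  rw [secondFundamentalForm, h1.differentiableWithinAt.hasFDerivWithinAt.unique_on h1
    (hX.hasUnitNormal.mem_tangentConeAt_frontier hX.isOpen hp hY)]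

/-- The gradient of a function that vanishes on `M` is normal to `M`. -/
lemma fderivWithin_eq_normalDeriv_mul (hX : IsSmoothBoundedDomain X) {v : Cn n → ℝ}
    (hv : SmoothOnClosure X v) (hv0 : ∀ p ∈ frontier X, v p = 0) {p : Cn n}
    (hp : p ∈ frontier X) (Y : Cn n) :
    fderivWithin ℝ v (closure X) p Y = normalDeriv X v p * inner ℝ (outwardNormal X p) Y := by
  have hν := hX.hasUnitNormal
  have h1 : HasFDerivWithinAt v (fderivWithin ℝ v (closure X) p) (frontier X) p :=
    (((hv.differentiableOn (by simp)) p
      (frontier_subset_closure hp)).hasFDerivWithinAt).mono frontier_subset_closure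
  have h2 : HasFDerivWithinAt v (0 : Cn n →L[ℝ] ℝ) (frontier X) p :=
    (hasFDerivWithinAt_const (0 : ℝ) p (frontier X)).congr hv0 (hv0 p hp)
  set ν := outwardNormal X p
  have h3 : inner ℝ ν (Y - (inner ℝ ν Y : ℝ) • ν) = 0 := by
    rw [inner_sub_right, real_inner_smul_right, real_inner_self_eq_norm_sq, hν.norm_eq_one hp]
    ring
  have h4 := h1.unique_on h2 (hν.mem_tangentConeAt_frontier hX.isOpen hp h3)
  rw [map_sub, map_smul, zero_apply, sub_eq_zero, smul_eq_mul] at h4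
  rw [h4, mul_comm]
  rfl

/-- A function that vanishes on `M` has Hessian `v_ν L` on tangent vectors: differentiate the
identity `v_{Y'} = v_ν (ν, Y')` along `M`, for a fixed vector `Y'`. -/
lemma hess_eq_normalDeriv_mul (hX : IsSmoothBoundedDomain X) {v : Cn n → ℝ}
    (hv : SmoothOnClosure X v) (hv0 : ∀ p ∈ frontier X, v p = 0) {p : Cn n}
    (hp : p ∈ frontier X) {Y Y' : Cn n} (hY : inner ℝ (outwardNormal X p) Y = 0)
    (hY' : inner ℝ (outwardNormal X p) Y' = 0) :
    hess X v p Y Y' = normalDeriv X v p * secondFundamentalForm X p Y Y' := by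
  have hν := hX.hasUnitNormal
  have hU := hν.uniqueDiffOn_closure hX.isOpen
  obtain ⟨U, N, hUo, hpU, hN, hNν⟩ := hX.exists_normal_extension hp
  have h1 := (hasFDerivWithinAt_outwardNormal hUo hN hNν hp
    hpU).differentiableWithinAt.hasFDerivWithinAt
  set G := fderivWithin ℝ v (closure X) with hG
  have h2 : HasFDerivWithinAt G (fderivWithin ℝ G (closure X) p) (frontier X) p :=
    ((((ContDiffOn.fderivWithin hv hU (m := ∞) (by simp)).differentiableOn (by simp)) p
      (frontier_subset_closure hp)).hasFDerivWithinAt).mono frontier_subset_closure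
  have h3 : HasFDerivWithinAt (fun x => G x Y') _ (frontier X) p :=
    h2.clm_apply (hasFDerivWithinAt_const Y' p _)
  have h4 : HasFDerivWithinAt (fun x => G x (outwardNormal X x) *
      inner ℝ (outwardNormal X x) Y') _ (frontier X) p :=
    (h2.clm_apply h1).mul (h1.inner ℝ (hasFDerivWithinAt_const Y' p _))
  have h5 : HasFDerivWithinAt (fun x => G x Y') _ (frontier X) p :=
    h4.congr (fun x hx => fderivWithin_eq_normalDeriv_mul hX hv hv0 hx Y')
      (fderivWithin_eq_normalDeriv_mul hX hv hv0 hp Y')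
  have h6 := h3.unique_on h5 (hν.mem_tangentConeAt_frontier hX.isOpen hp hY)
  simpa [hY', hess, secondFundamentalForm, normalDeriv] using h6

end OutwardNormal

/-! ### Forms in unitary frames -/

section MixedPart

variable {n : ℕ}

/-- `mixedPart` of a real bilinear form, as a `ℂ`-linear form in its first argument. -/
def mixedPartLeft (B : Cn n →ₗ[ℝ] Cn n →ₗ[ℝ] ℝ) (Y' : Cn n) : Cn n →ₗ[ℂ] ℂ where
  toFun Y := mixedPart (fun Y Y' => B Y Y') Y Y'
  map_add' Y Z := by
    simp only [mixedPart, smul_add, map_add, LinearMap.add_apply]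
    push_cast
    ring
  map_smul' c Y := by
    have h1 (c : ℂ) (Y : Cn n) : c • Y = c.re • Y + c.im • (Complex.I • Y) := by
      rw [← Complex.coe_smul, ← Complex.coe_smul, smul_smul, ← add_smul, Complex.re_add_im]
    have h2 : Complex.I • c • Y = c.re • (Complex.I • Y) - c.im • Y := by
      rw [h1 c Y, smul_add, smul_comm Complex.I c.re, smul_comm Complex.I c.im, smul_smul,
        Complex.I_mul_I, neg_one_smul, smul_neg, sub_eq_add_neg]
    simp only [mixedPart, h2]
    rw [h1 c Y]
    simp only [map_add, map_sub, map_smul, LinearMap.add_apply, LinearMap.sub_apply,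
      LinearMap.smul_apply, smul_eq_mul, RingHom.id_apply]
    conv_rhs => rw [← Complex.re_add_im c]
    push_cast
    linear_combination (-(1 / 2 : ℂ) * c.im *
      ((B Y (Complex.I • Y') : ℝ) - (B (Complex.I • Y) Y' : ℝ))) * Complex.I_mul_I

lemma mixedPart_conj (B : Cn n → Cn n → ℝ) (Y Y' : Cn n) :
    star (mixedPart B Y Y') = mixedPart (fun Y Y' => B Y' Y) Y' Y := by
  simp only [mixedPart, RCLike.star_def, map_mul, map_add, Complex.conj_I, Complex.conj_ofReal,
    map_div₀, map_one, map_ofNat]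
  push_cast
  ring

lemma mixedPart_sum_smul {ι κ : Type} [Fintype ι] [Fintype κ] (B : Cn n →ₗ[ℝ] Cn n →ₗ[ℝ] ℝ)
    (c : ι → ℂ) (Y : ι → Cn n) (d : κ → ℂ) (Z : κ → Cn n) :
    mixedPart (fun Y Y' => B Y Y') (∑ i, c i • Y i) (∑ j, d j • Z j) =
      ∑ i, ∑ j, c i * mixedPart (fun Y Y' => B Y Y') (Y i) (Z j) * star (d j) := by
  have h1 : mixedPart (fun Y Y' => B Y Y') (∑ i, c i • Y i) (∑ j, d j • Z j) =
      mixedPartLeft B (∑ j, d j • Z j) (∑ i, c i • Y i) := rfl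
  have h2 (i : ι) : mixedPartLeft B (∑ j, d j • Z j) (Y i) =
      star (mixedPartLeft B.flip (Y i) (∑ j, d j • Z j)) :=
    (mixedPart_conj (fun Y Y' => B Y' Y) _ _).symm
  have h3 (i : ι) (j : κ) : mixedPartLeft B.flip (Y i) (Z j) =
      star (mixedPart (fun Y Y' => B Y Y') (Y i) (Z j)) :=
    (mixedPart_conj (fun Y Y' => B Y Y') _ _).symm
  rw [h1, map_sum]
  refine Finset.sum_congr rfl fun i _ => ?_
  rw [map_smul, h2, map_sum, star_sum, smul_eq_mul, Finset.mul_sum]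
  refine Finset.sum_congr rfl fun j _ => ?_
  rw [map_smul, h3, smul_eq_mul, star_mul', star_star]
  ring

lemma sum_smul_stdVec (y : Cn n) : ∑ i, y i • stdVec i = y := by
  ext j
  simp [stdVec, Finset.sum_apply, Pi.single_apply]

/-- Change of frame for the matrix of a real bilinear form. -/
lemma mixedMatrix_eq_mul {ι : Type} (B : Cn n →ₗ[ℝ] Cn n →ₗ[ℝ] ℝ) (e : ι → Cn n) :
    mixedMatrix (fun Y Y' => B Y Y') e = (Matrix.of fun a i => e a i) *
      mixedMatrix (fun Y Y' => B Y Y') stdVec * (Matrix.of fun a i => e a i).conjTranspose := by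
  ext a b
  rw [mixedMatrix, Matrix.of_apply, ← sum_smul_stdVec (e a), ← sum_smul_stdVec (e b),
    mixedPart_sum_smul]
  simp only [Matrix.mul_apply, Matrix.conjTranspose_apply, Matrix.of_apply, Finset.sum_mul,
    mixedMatrix]
  exact Finset.sum_comm

end MixedPart

/-! ### Restriction to the complex tangent space -/

section TangentFrame

variable {n : ℕ} {X : Set (Cn n)}

/-- The matrix of the coordinates of the unitary frame of `T^{1,0}M`. -/
def frameMatrix (X : Set (Cn n)) (p : Cn n) :
    Matrix (Fin (Module.finrank ℂ (complexTangent X p))) (Fin n) ℂ :=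
  Matrix.of fun a i => tangentFrame X p a i

lemma inner_outwardNormal_tangentFrame (p : Cn n)
    (a : Fin (Module.finrank ℂ (complexTangent X p))) :
    inner ℝ (outwardNormal X p) (tangentFrame X p a) = 0 ∧
      inner ℝ (outwardNormal X p) (Complex.I • tangentFrame X p a) = 0 := by
  have h1 : inner ℂ (outwardNormal X p) (tangentFrame X p a) = 0 :=
    Submodule.mem_orthogonal_singleton_iff_inner_right.1
      (stdOrthonormalBasis ℂ (complexTangent X p) a).2
  rw [inner_real_eq_re, inner_real_eq_re, inner_smul_right, h1]
  simp

lemma frameMatrix_mul_conjTranspose (p : Cn n) :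
    frameMatrix X p * (frameMatrix X p).conjTranspose = 1 := by
  have h := (stdOrthonormalBasis ℂ (complexTangent X p)).orthonormal
  ext a b
  have h1 := orthonormal_iff_ite.1 h b a
  rw [Submodule.coe_inner, PiLp.inner_apply] at h1
  rw [Matrix.one_apply, Matrix.mul_apply, ← if_congr (eq_comm (a := b) (b := a)) rfl rfl, ← h1]
  simp only [frameMatrix, Matrix.conjTranspose_apply, Matrix.of_apply, tangentFrame]
  refine Finset.sum_congr rfl fun i _ => ?_
  rw [RCLike.inner_apply]
  rfl

/-- The Gram matrix of the frame is the orthogonal projection to `𝓗`. -/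
lemma conjTranspose_mul_frameMatrix {p : Cn n} (hp : ‖outwardNormal X p‖ = 1) (i j : Fin n) :
    ((frameMatrix X p).conjTranspose * frameMatrix X p) j i =
      (if i = j then 1 else 0) - outwardNormal X p i * star (outwardNormal X p j) := by
  have h1 := (stdOrthonormalBasis ℂ (complexTangent X p)).starProjection_eq_sum_rankOne
  have h2 := congrArg (fun f : Cn n →L[ℂ] Cn n => f (stdVec j) i) h1
  simp only at h2
  rw [complexTangent, Submodule.starProjection_orthogonal_val,
    Submodule.starProjection_unit_singleton ℂ hp] at h2
  rw [Matrix.mul_apply]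
  have h3 (y : Cn n) : inner ℂ y (stdVec j) = star (y j) := by
    rw [stdVec, EuclideanSpace.inner_single_right]
    simp
  simp only [sum_apply, InnerProductSpace.rankOne_apply, h3] at h2
  simp only [frameMatrix, Matrix.conjTranspose_apply, Matrix.of_apply, tangentFrame]
  rw [WithLp.ofLp_sum] at h2
  simp only [Finset.sum_apply, PiLp.smul_apply, PiLp.sub_apply, smul_eq_mul] at h2
  refine h2.symm.trans ?_
  rw [stdVec, PiLp.single_apply]
  ring

lemma tangentHessian_eq (u : Cn n → ℝ) (p : Cn n) : tangentHessian X u p =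
    frameMatrix X p * complexHessian X u p * (frameMatrix X p).conjTranspose :=
  mixedMatrix_eq_mul (LinearMap.mk₂ ℝ (fun Y Y' => hess X u p Y Y')
    (by simp [hess]) (by simp [hess]) (by simp [hess]) (by simp [hess])) (tangentFrame X p)

lemma mixedMatrix_congr {ι : Type} {B B' : Cn n → Cn n → ℝ} {e : ι → Cn n}
    (h : ∀ a b, B (e a) (e b) = B' (e a) (e b) ∧
      B (Complex.I • e a) (Complex.I • e b) = B' (Complex.I • e a) (Complex.I • e b) ∧
      B (e a) (Complex.I • e b) = B' (e a) (Complex.I • e b) ∧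
      B (Complex.I • e a) (e b) = B' (Complex.I • e a) (e b)) :
    mixedMatrix B e = mixedMatrix B' e := by
  ext a b
  obtain ⟨h1, h2, h3, h4⟩ := h a b
  simp only [mixedMatrix, Matrix.of_apply, mixedPart, h1, h2, h3, h4]

/-- The complex Hessian of a function that vanishes on `M` restricts to `v_ν L` on `𝓗`. -/
lemma tangentHessian_eq_smul (hX : IsSmoothBoundedDomain X) {v : Cn n → ℝ}
    (hv : SmoothOnClosure X v) (hv0 : ∀ p ∈ frontier X, v p = 0) {p : Cn n}
    (hp : p ∈ frontier X) :
    tangentHessian X v p = (normalDeriv X v p : ℂ) • leviMatrix X p := by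
  have h1 : tangentHessian X v p = mixedMatrix
      (fun Y Y' => normalDeriv X v p * secondFundamentalForm X p Y Y') (tangentFrame X p) := by
    refine mixedMatrix_congr fun a b => ?_
    obtain ⟨ha, ha'⟩ := inner_outwardNormal_tangentFrame (X := X) p a
    obtain ⟨hb, hb'⟩ := inner_outwardNormal_tangentFrame (X := X) p b
    exact ⟨hess_eq_normalDeriv_mul hX hv hv0 hp ha hb,
      hess_eq_normalDeriv_mul hX hv hv0 hp ha' hb',
      hess_eq_normalDeriv_mul hX hv hv0 hp ha hb',
      hess_eq_normalDeriv_mul hX hv hv0 hp ha' hb⟩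
  rw [h1]
  ext a b
  simp only [leviMatrix, mixedMatrix, Matrix.of_apply, mixedPart, Matrix.smul_apply, smul_eq_mul]
  push_cast
  ring

/-- The Levi form as a matrix on all of `T^{1,0}ℂⁿ`, extended by zero on the normal direction. -/
def fullLevi (X : Set (Cn n)) (p : Cn n) : Matrix (Fin n) (Fin n) ℂ :=
  (frameMatrix X p).conjTranspose * leviMatrix X p * frameMatrix X p

lemma leviMatrix_eq (p : Cn n) : leviMatrix X p =
    frameMatrix X p * fullLevi X p * (frameMatrix X p).conjTranspose := by
  rw [fullLevi, show frameMatrix X p * ((frameMatrix X p).conjTranspose * leviMatrix X p *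
    frameMatrix X p) * (frameMatrix X p).conjTranspose =
    (frameMatrix X p * (frameMatrix X p).conjTranspose) * leviMatrix X p *
      (frameMatrix X p * (frameMatrix X p).conjTranspose) by simp only [Matrix.mul_assoc],
    frameMatrix_mul_conjTranspose, Matrix.one_mul, Matrix.mul_one]

lemma continuousOn_conjTranspose_mul_frameMatrix (hX : IsSmoothBoundedDomain X) (i j : Fin n) :
    ContinuousOn (fun p => ((frameMatrix X p).conjTranspose * frameMatrix X p) j i)
      (frontier X) := by
  have hν := hX.hasUnitNormal
  have h1 : ContinuousOn (fun p => (if i = j then (1 : ℂ) else 0) -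
      outwardNormal X p i * star (outwardNormal X p j)) (frontier X) :=
    continuousOn_const.sub ((continuousOn_normal_apply hν i).mul
      (continuousOn_normal_apply hν j).star)
  exact h1.congr fun p hp => conjTranspose_mul_frameMatrix (hν.norm_eq_one hp) i j

lemma continuousOn_fullLevi (hX : IsSmoothBoundedDomain X) (i j : Fin n) :
    ContinuousOn (fun p => fullLevi X p i j) (frontier X) := by
  intro p hp
  obtain ⟨U, N, hU, hpU, hN, hNν⟩ := hX.exists_normal_extension hp
  -- replace the derivative of `ν` along `M` by the derivative of an extension
  set B : Cn n → Cn n →ₗ[ℝ] Cn n →ₗ[ℝ] ℝ := fun q => LinearMap.mk₂ ℝ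
    (fun Y Y' => (inner ℝ (fderiv ℝ N q Y) Y' : ℝ))
    (by simp [inner_add_left]) (by simp [real_inner_smul_left])
    (by simp [inner_add_right]) (by simp [real_inner_smul_right]) with hB
  set M : Cn n → Matrix (Fin n) (Fin n) ℂ := fun q => mixedMatrix (fun Y Y' => B q Y Y') stdVec
  have hL : ∀ q ∈ frontier X ∩ U, fullLevi X q i j =
      (((frameMatrix X q).conjTranspose * frameMatrix X q) * M q *
        ((frameMatrix X q).conjTranspose * frameMatrix X q)) i j := by
    rintro q ⟨hq, hqU⟩
    have h1 : leviMatrix X q = frameMatrix X q * M q * (frameMatrix X q).conjTranspose := by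
      refine Eq.trans ?_ (mixedMatrix_eq_mul (B q) (tangentFrame X q))
      refine mixedMatrix_congr fun a b => ?_
      obtain ⟨ha, ha'⟩ := inner_outwardNormal_tangentFrame (X := X) q a
      exact ⟨secondFundamentalForm_eq hX hU hN hNν hq hqU ha _,
        secondFundamentalForm_eq hX hU hN hNν hq hqU ha' _,
        secondFundamentalForm_eq hX hU hN hNν hq hqU ha _,
        secondFundamentalForm_eq hX hU hN hNν hq hqU ha' _⟩
    rw [fullLevi, h1]
    simp only [Matrix.mul_assoc]
  have hNc : ContinuousOn (fderiv ℝ N) U := hN.continuousOn_fderiv_of_isOpen hU (by simp)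
  have hBc (Y Y' : Cn n) : ContinuousOn (fun q => B q Y Y') U := by
    have : ContinuousOn (fun q => (inner ℝ (fderiv ℝ N q Y) Y' : ℝ)) U :=
      (hNc.clm_apply continuousOn_const).inner continuousOn_const
    exact this
  have hMc (k l : Fin n) : ContinuousOn (fun q => M q k l) U :=
    continuousOn_const.mul ((Complex.continuous_ofReal.comp_continuousOn
      ((hBc _ _).add (hBc _ _))).add (continuousOn_const.mul
        (Complex.continuous_ofReal.comp_continuousOn ((hBc _ _).sub (hBc _ _)))))
  set P : Cn n → Matrix (Fin n) (Fin n) ℂ := fun q =>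
    (frameMatrix X q).conjTranspose * frameMatrix X q
  have hPc (k l : Fin n) : ContinuousOn (fun q => P q k l) (frontier X ∩ U) :=
    (continuousOn_conjTranspose_mul_frameMatrix hX l k).mono inter_subset_left
  have hc' : ContinuousOn (fun q => ∑ k, (∑ l, P q i l * M q l k) * P q k j) (frontier X ∩ U) :=
    continuousOn_finsetSum _ fun k _ => ContinuousOn.mul (continuousOn_finsetSum _ fun l _ =>
      (hPc i l).mul ((hMc l k).mono inter_subset_right)) (hPc k j)
  have hc : ContinuousOn (fun q => (P q * M q * P q) i j) (frontier X ∩ U) := by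
    refine hc'.congr fun q _ => ?_
    simp only [Matrix.mul_apply (M := P q * M q), Matrix.mul_apply (M := P q)]
  have h2 := (hc.congr hL) p ⟨hp, hpU⟩
  exact h2.mono_of_mem_nhdsWithin (inter_mem_nhdsWithin _ (hU.mem_nhds hpU))

/-- The polarized `σ_k` in the frame of `𝓗`, written through the orthogonal projection to `𝓗`.
Unlike the frame, the projection depends continuously on the boundary point. -/
lemma sigmaPol_frame {k : ℕ} {p : Cn n} (B : Fin k → Matrix (Fin n) (Fin n) ℂ) :
    sigmaPol (fun l => frameMatrix X p * B l * (frameMatrix X p).conjTranspose) =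
      (1 / (k.factorial : ℂ)) * ∑ P : Fin k → Fin n, ∑ Q : Fin k → Fin n,
        (Matrix.of fun a b => ((frameMatrix X p).conjTranspose * frameMatrix X p)
          (Q b) (P a)).det * ∏ l, B l (P l) (Q l) :=
  sigmaPol_mul_mul _ _ _

end TangentFrame

/-! ### Integrals depending on a parameter -/

section ParametricIntegral

open Filter Topology

variable {E G : Type*} [NormedAddCommGroup E] [MeasurableSpace E] [BorelSpace E]
  [SecondCountableTopology E] [NormedAddCommGroup G] [NormedSpace ℝ G]

omit [MeasurableSpace E] [BorelSpace E] [SecondCountableTopology E] [NormedSpace ℝ G] in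
lemma exists_bound_of_continuousOn_univ_prod {K : Set E} (hK : IsCompact K) {F : ℝ → E → G}
    (hF : ContinuousOn (fun z : ℝ × E => F z.1 z.2) (univ ×ˢ K)) (t : ℝ) :
    ∃ C, ∀ s ∈ Metric.ball t 1, ∀ x ∈ K, ‖F s x‖ ≤ C := by
  obtain ⟨C, hC⟩ := ((isCompact_closedBall t 1).prod hK).exists_bound_of_continuousOn
    (hF.mono (prod_mono (subset_univ _) subset_rfl))
  exact ⟨C, fun s hs x hx => hC (s, x) ⟨Metric.ball_subset_closedBall hs, hx⟩⟩

omit [MeasurableSpace E] [BorelSpace E] [SecondCountableTopology E] [NormedSpace ℝ G] in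
lemma continuousOn_slice {K : Set E} {F : ℝ → E → G}
    (hF : ContinuousOn (fun z : ℝ × E => F z.1 z.2) (univ ×ˢ K)) (t : ℝ) :
    ContinuousOn (F t) K :=
  hF.comp (f := fun x => (t, x)) (by fun_prop) fun _ hx => ⟨mem_univ _, hx⟩

variable {μ : Measure E} {K S : Set E}

lemma continuous_setIntegral (hK : IsCompact K) (hS : MeasurableSet S) (hSK : S ⊆ K)
    (hμ : μ S < ⊤) {F : ℝ → E → G}
    (hF : ContinuousOn (fun z : ℝ × E => F z.1 z.2) (univ ×ˢ K)) :
    Continuous fun t => ∫ x in S, F t x ∂μ := by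
  have : IsFiniteMeasure (μ.restrict S) := ⟨by simpa using hμ⟩
  rw [continuous_iff_continuousAt]
  intro t
  obtain ⟨C, hC⟩ := exists_bound_of_continuousOn_univ_prod hK hF t
  refine continuousAt_of_dominated (bound := fun _ => C)
    (Eventually.of_forall fun s => ((continuousOn_slice hF s).mono hSK).aestronglyMeasurable hS)
    ?_ (integrable_const C) ?_
  · filter_upwards [Metric.ball_mem_nhds t one_pos] with s hs
    exact (ae_restrict_iff' hS).2 (Eventually.of_forall fun x hx => hC s hs x (hSK hx))
  · refine (ae_restrict_iff' hS).2 (Eventually.of_forall fun x hx => ?_)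
    have h1 : Continuous fun s => F s x :=
      continuousOn_univ.1 (hF.comp (f := fun s => (s, x)) (by fun_prop)
        fun s _ => ⟨mem_univ _, hSK hx⟩)
    exact h1.continuousAt

lemma hasDerivAt_setIntegral (hK : IsCompact K) (hS : MeasurableSet S) (hSK : S ⊆ K)
    (hμ : μ S < ⊤) {F F' : ℝ → E → G}
    (hF : ContinuousOn (fun z : ℝ × E => F z.1 z.2) (univ ×ˢ K))
    (hF' : ContinuousOn (fun z : ℝ × E => F' z.1 z.2) (univ ×ˢ K))
    (hd : ∀ t, ∀ x ∈ S, HasDerivAt (fun s => F s x) (F' t x) t) (t : ℝ) :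
    HasDerivAt (fun s => ∫ x in S, F s x ∂μ) (∫ x in S, F' t x ∂μ) t := by
  have : IsFiniteMeasure (μ.restrict S) := ⟨by simpa using hμ⟩
  obtain ⟨C, hC⟩ := exists_bound_of_continuousOn_univ_prod hK hF' t
  obtain ⟨D, hD⟩ := exists_bound_of_continuousOn_univ_prod hK hF t
  have hm {F : ℝ → E → G} (hF : ContinuousOn (fun z : ℝ × E => F z.1 z.2) (univ ×ˢ K)) (s : ℝ) :
      AEStronglyMeasurable (F s) (μ.restrict S) :=
    ((continuousOn_slice hF s).mono hSK).aestronglyMeasurable hS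
  refine (hasDerivAt_integral_of_dominated_loc_of_deriv_le (bound := fun _ => C)
    (Metric.ball_mem_nhds t one_pos) (Eventually.of_forall fun s => hm hF s) ?_ (hm hF' t) ?_
    (integrable_const C) ?_).2
  · exact Integrable.of_bound (hm hF t) D ((ae_restrict_iff' hS).2
      (Eventually.of_forall fun x hx => hD t (Metric.mem_ball_self one_pos) x (hSK hx)))
  · exact (ae_restrict_iff' hS).2 (Eventually.of_forall fun x hx s hs => hC s hs x (hSK hx))
  · exact (ae_restrict_iff' hS).2 (Eventually.of_forall fun x hx s _ => hd s x hx)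

omit [NormedSpace ℝ G] in
lemma integrableOn_of_continuousOn (hK : IsCompact K) (hS : MeasurableSet S) (hSK : S ⊆ K)
    (hμ : μ S < ⊤) {f : E → G} (hf : ContinuousOn f K) : IntegrableOn f S μ := by
  obtain ⟨C, hC⟩ := hK.exists_bound_of_continuousOn hf
  exact IntegrableOn.of_bound hμ ((hf.mono hSK).aestronglyMeasurable hS) C
    ((ae_restrict_iff' hS).2 (Eventually.of_forall fun x hx => hC x (hSK hx)))

end ParametricIntegral

/-! ### Continuity of the symmetric functions -/

section ContinuityOfSigma

variable {ι : Type} [Fintype ι] [DecidableEq ι] {Z : Type*} [TopologicalSpace Z] {s : Set Z}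

lemma continuousOn_sigma {k : ℕ} {A : Z → Matrix ι ι ℂ}
    (h : ∀ i j, ContinuousOn (fun z => A z i j) s) :
    ContinuousOn (fun z => sigma k (A z)) s :=
  continuousOn_const.mul (continuousOn_finsetSum _ fun _ _ => continuousOn_finsetSum _
    fun _ _ => continuousOn_const.mul (continuousOn_finsetProd _ fun _ _ => h _ _))

lemma continuousOn_newton {k : ℕ} {A : Z → Matrix ι ι ℂ}
    (h : ∀ i j, ContinuousOn (fun z => A z i j) s) (i j : ι) :
    ContinuousOn (fun z => newton k (A z) j i) s :=
  continuousOn_const.mul (continuousOn_finsetSum _ fun _ _ => continuousOn_finsetSum _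
    fun _ _ => continuousOn_const.mul (continuousOn_finsetProd _ fun _ _ => h _ _))

end ContinuityOfSigma

/-! ### Derivatives along a segment of functions -/

section Segments

variable {n : ℕ} {X : Set (Cn n)} {u v : Cn n → ℝ}

lemma smoothOnClosure_add_smul (hu : SmoothOnClosure X u) (hv : SmoothOnClosure X v) (t : ℝ) :
    SmoothOnClosure X (u + t • v) :=
  ContDiffOn.add hu (contDiffOn_const.smul hv)

lemma fderivWithin_add_smul (hU : UniqueDiffOn ℝ (closure X)) (hu : SmoothOnClosure X u)
    (hv : SmoothOnClosure X v) (t : ℝ) {x : Cn n} (hx : x ∈ closure X) :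
    fderivWithin ℝ (u + t • v) (closure X) x =
      fderivWithin ℝ u (closure X) x + t • fderivWithin ℝ v (closure X) x := by
  have h1 := ((hu.differentiableOn (by simp)) x hx).hasFDerivWithinAt
  have h2 := ((hv.differentiableOn (by simp)) x hx).hasFDerivWithinAt
  exact (h1.add (h2.const_smul t)).fderivWithin (hU x hx)

lemma hess_add_smul (hU : UniqueDiffOn ℝ (closure X)) (hu : SmoothOnClosure X u)
    (hv : SmoothOnClosure X v) (t : ℝ) {x : Cn n} (hx : x ∈ closure X) (Y Y' : Cn n) :
    hess X (u + t • v) x Y Y' = hess X u x Y Y' + t * hess X v x Y Y' := by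
  have h (w : Cn n → ℝ) (hw : SmoothOnClosure X w) :
      HasFDerivWithinAt (fderivWithin ℝ w (closure X))
        (fderivWithin ℝ (fderivWithin ℝ w (closure X)) (closure X) x) (closure X) x :=
    (((ContDiffOn.fderivWithin hw hU (m := ∞) (by simp)).differentiableOn (by simp)) x
      hx).hasFDerivWithinAt
  have h1 := ((h u hu).add ((h v hv).const_smul t)).congr
    (f₁ := fderivWithin ℝ (u + t • v) (closure X))
    (fun y hy => fderivWithin_add_smul hU hu hv t hy) (fderivWithin_add_smul hU hu hv t hx)
  rw [hess, h1.fderivWithin (hU x hx)]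
  rfl

lemma complexHessian_add_smul (hU : UniqueDiffOn ℝ (closure X)) (hu : SmoothOnClosure X u)
    (hv : SmoothOnClosure X v) (t : ℝ) {x : Cn n} (hx : x ∈ closure X) :
    complexHessian X (u + t • v) x = complexHessian X u x + (t : ℂ) • complexHessian X v x := by
  ext i j
  simp only [complexHessian, mixedMatrix, Matrix.of_apply, mixedPart,
    hess_add_smul hU hu hv t hx, Matrix.add_apply, Matrix.smul_apply, smul_eq_mul]
  push_cast
  ring

lemma normalDeriv_add_smul (hU : UniqueDiffOn ℝ (closure X)) (hu : SmoothOnClosure X u)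
    (hv : SmoothOnClosure X v) (t : ℝ) {p : Cn n} (hp : p ∈ closure X) :
    normalDeriv X (u + t • v) p = normalDeriv X u p + t * normalDeriv X v p := by
  rw [normalDeriv, fderivWithin_add_smul hU hu hv t hp]
  rfl

lemma hasDerivAt_complexHessian (hU : UniqueDiffOn ℝ (closure X)) (hu : SmoothOnClosure X u)
    (hv : SmoothOnClosure X v) (t : ℝ) {x : Cn n} (hx : x ∈ closure X) (i j : Fin n) :
    HasDerivAt (fun s : ℝ => complexHessian X (u + s • v) x i j) (complexHessian X v x i j) t := by
  simp only [complexHessian_add_smul hU hu hv _ hx, Matrix.add_apply, Matrix.smul_apply,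
    smul_eq_mul]
  simpa using ((Complex.ofRealCLM.hasDerivAt (x := t)).mul_const
    (complexHessian X v x i j)).const_add (complexHessian X u x i j)

lemma continuousOn_complexHessian_add_smul (hU : UniqueDiffOn ℝ (closure X))
    (hu : SmoothOnClosure X u) (hv : SmoothOnClosure X v) (i j : Fin n) :
    ContinuousOn (fun z : ℝ × Cn n => complexHessian X (u + z.1 • v) z.2 i j)
      (univ ×ˢ closure X) := by
  have h (w : Cn n → ℝ) (hw : SmoothOnClosure X w) :
      ContinuousOn (fun z : ℝ × Cn n => complexHessian X w z.2 i j) (univ ×ˢ closure X) :=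
    (contDiffOn_complexHessian hU hw i j).continuousOn.comp continuousOn_snd fun z hz => hz.2
  have h1 : ContinuousOn (fun z : ℝ × Cn n => complexHessian X u z.2 i j +
      (z.1 : ℂ) * complexHessian X v z.2 i j) (univ ×ˢ closure X) :=
    (h u hu).add ((Complex.continuous_ofReal.comp_continuousOn continuousOn_fst).mul (h v hv))
  refine h1.congr fun z hz => ?_
  simp only [complexHessian_add_smul hU hu hv _ hz.2, Matrix.add_apply, Matrix.smul_apply,
    smul_eq_mul]

end Segments

/-! ### Variation of the boundary terms -/

section BoundaryVariation

variable {n : ℕ} {X : Set (Cn n)} {u v : Cn n → ℝ}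

/-- `σ_m(L|_𝓗, …, L|_𝓗, D^{1,1}w|_𝓗, …, D^{1,1}w|_𝓗)` with `q` entries `L|_𝓗`. -/
def mixedSigma (X : Set (Cn n)) (m q : ℕ) (w : Cn n → ℝ) (p : Cn n) : ℂ :=
  sigmaPol fun l : Fin m => if (l : ℕ) < q then leviMatrix X p else tangentHessian X w p

lemma mixedSigma_eq (m q : ℕ) (w : Cn n → ℝ) (p : Cn n) : mixedSigma X m q w p =
    (1 / (m.factorial : ℂ)) * ∑ P : Fin m → Fin n, ∑ Q : Fin m → Fin n,
      (Matrix.of fun a b => ((frameMatrix X p).conjTranspose * frameMatrix X p)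
        (Q b) (P a)).det *
      ∏ l : Fin m, if (l : ℕ) < q then fullLevi X p (P l) (Q l)
        else complexHessian X w p (P l) (Q l) := by
  have h1 (l : Fin m) : (if (l : ℕ) < q then leviMatrix X p else tangentHessian X w p) =
      frameMatrix X p * (if (l : ℕ) < q then fullLevi X p else complexHessian X w p) *
        (frameMatrix X p).conjTranspose := by
    split_ifs
    · exact leviMatrix_eq p
    · exact tangentHessian_eq w p
  rw [mixedSigma]
  simp only [h1]
  rw [sigmaPol_frame]
  congr 1
  refine Finset.sum_congr rfl fun P _ => Finset.sum_congr rfl fun Q _ => ?_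
  congr 1
  refine Finset.prod_congr rfl fun l _ => ?_
  split_ifs <;> rfl

lemma continuousOn_mixedSigma (hX : IsSmoothBoundedDomain X) (hu : SmoothOnClosure X u)
    (hv : SmoothOnClosure X v) (m q : ℕ) :
    ContinuousOn (fun z : ℝ × Cn n => mixedSigma X m q (u + z.1 • v) z.2)
      (univ ×ˢ frontier X) := by
  have hU := hX.hasUnitNormal.uniqueDiffOn_closure hX.isOpen
  have hsnd : MapsTo (Prod.snd : ℝ × Cn n → Cn n) (univ ×ˢ frontier X) (frontier X) :=
    fun z hz => hz.2
  simp only [mixedSigma_eq, Matrix.det_apply', Matrix.of_apply]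
  refine continuousOn_const.mul (continuousOn_finsetSum _ fun P _ => continuousOn_finsetSum _
    fun Q _ => ContinuousOn.mul (continuousOn_finsetSum _ fun σ _ => continuousOn_const.mul
      (continuousOn_finsetProd _ fun b _ => ?_)) (continuousOn_finsetProd _ fun l _ => ?_))
  · exact (continuousOn_conjTranspose_mul_frameMatrix hX _ _).comp continuousOn_snd hsnd
  · split_ifs
    · exact (continuousOn_fullLevi hX _ _).comp continuousOn_snd hsnd
    · exact (continuousOn_complexHessian_add_smul hU hu hv _ _).mono
        (prod_mono subset_rfl frontier_subset_closure)

lemma tangentHessian_add_smul (hU : UniqueDiffOn ℝ (closure X)) (hu : SmoothOnClosure X u)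
    (hv : SmoothOnClosure X v) (t : ℝ) {p : Cn n} (hp : p ∈ closure X) :
    tangentHessian X (u + t • v) p = tangentHessian X u p + (t : ℂ) • tangentHessian X v p := by
  rw [tangentHessian_eq, tangentHessian_eq, tangentHessian_eq,
    complexHessian_add_smul hU hu hv t hp, Matrix.mul_add, Matrix.add_mul, Matrix.mul_smul,
    Matrix.smul_mul]

lemma hasDerivAt_mixedSigma (hX : IsSmoothBoundedDomain X) (hu : SmoothOnClosure X u)
    (hv : SmoothOnClosure X v) (hv0 : ∀ p ∈ frontier X, v p = 0) {m q : ℕ} (hq : q ≤ m) (t : ℝ)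
    {p : Cn n} (hp : p ∈ frontier X) :
    HasDerivAt (fun s : ℝ => mixedSigma X m q (u + s • v) p)
      (((m - q : ℕ) : ℂ) * normalDeriv X v p * mixedSigma X m (q + 1) (u + t • v) p) t := by
  have hU := hX.hasUnitNormal.uniqueDiffOn_closure hX.isOpen
  refine hasDerivAt_sigmaPol_ite hq (leviMatrix X p)
    (H := fun s : ℝ => tangentHessian X (u + s • v) p) fun i j => ?_
  simp only [tangentHessian_add_smul hU hu hv _ (frontier_subset_closure hp),
    tangentHessian_eq_smul hX hv hv0 hp, Matrix.add_apply, Matrix.smul_apply, smul_eq_mul]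
  simpa using ((Complex.ofRealCLM.hasDerivAt (x := t)).mul_const
    ((normalDeriv X v p : ℂ) * leviMatrix X p i j)).const_add (tangentHessian X u p i j)

lemma finrank_real_Cn (n : ℕ) : Module.finrank ℝ (Cn n) = 2 * n := by
  rw [finrank_real_of_complex, finrank_euclideanSpace_fin]

lemma isCompact_frontier (hX : IsSmoothBoundedDomain X) : IsCompact (frontier X) :=
  hX.isBounded.isCompact_closure.of_isClosed_subset isClosed_frontier frontier_subset_closure

lemma measure_frontier_lt_top (hX : IsSmoothBoundedDomain X) :
    Measure.euclideanHausdorffMeasure (2 * n - 1) (frontier X) < ⊤ := by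
  have := hX.hasUnitNormal.measure_frontier_lt_top hX.isOpen hX.isBounded
  rwa [finrank_real_Cn] at this

lemma continuousOn_normalDeriv (hX : IsSmoothBoundedDomain X) (hu : SmoothOnClosure X u) :
    ContinuousOn (normalDeriv X u) (frontier X) := by
  have hU := hX.hasUnitNormal.uniqueDiffOn_closure hX.isOpen
  exact ((ContDiffOn.continuousOn_fderivWithin hu hU (by simp)).mono
    frontier_subset_closure).clm_apply hX.hasUnitNormal.continuousOn

lemma continuousOn_normalDeriv_add_smul (hX : IsSmoothBoundedDomain X)
    (hu : SmoothOnClosure X u) (hv : SmoothOnClosure X v) :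
    ContinuousOn (fun z : ℝ × Cn n => normalDeriv X (u + z.1 • v) z.2) (univ ×ˢ frontier X) := by
  have hU := hX.hasUnitNormal.uniqueDiffOn_closure hX.isOpen
  have h1 : ContinuousOn (fun z : ℝ × Cn n => normalDeriv X u z.2 + z.1 * normalDeriv X v z.2)
      (univ ×ˢ frontier X) :=
    ((continuousOn_normalDeriv hX hu).comp continuousOn_snd fun z hz => hz.2).add
      (continuousOn_fst.mul ((continuousOn_normalDeriv hX hv).comp continuousOn_snd
        fun z hz => hz.2))
  exact h1.congr fun z hz => normalDeriv_add_smul hU hu hv _ (frontier_subset_closure hz.2)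

/-- The integral `∮ u v_ν w_ν^j σ_m(L|_𝓗, …, L|_𝓗, D^{1,1}w|_𝓗, …)` with `j` entries `L|_𝓗`. -/
def boundaryMoment (X : Set (Cn n)) (m j : ℕ) (u v w : Cn n → ℝ) : ℝ :=
  ∫ p, u p * normalDeriv X v p * normalDeriv X w p ^ j * (mixedSigma X m j w p).re
    ∂(surfaceMeasure X)

lemma hasDerivAt_boundaryTerm (hX : IsSmoothBoundedDomain X) (hu : SmoothOnClosure X u)
    (hv : SmoothOnClosure X v) (hv0 : ∀ p ∈ frontier X, v p = 0) {m j : ℕ} (hj : j ≤ m) (t : ℝ) :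
    HasDerivAt (fun s : ℝ => boundaryTerm X (m + 1) (j + 2) (u + s • v))
      ((-1) ^ j * (((m : ℝ) + 1) * (m + 2) / 2) * ((m + 1).choose (j + 1) : ℝ) *
        (((j : ℝ) + 1) * boundaryMoment X m j u v (u + t • v) +
          ((m - j : ℕ) : ℝ) * boundaryMoment X m (j + 1) u v (u + t • v))) t := by
  have hU := hX.hasUnitNormal.uniqueDiffOn_closure hX.isOpen
  have hK := isCompact_frontier hX
  have hm : MeasurableSet (frontier X) := isClosed_frontier.measurableSet
  have huc : ContinuousOn (fun z : ℝ × Cn n => u z.2) (univ ×ˢ frontier X) :=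
    (hu.continuousOn.mono frontier_subset_closure).comp continuousOn_snd fun z hz => hz.2
  have hvc : ContinuousOn (fun z : ℝ × Cn n => normalDeriv X v z.2) (univ ×ˢ frontier X) :=
    (continuousOn_normalDeriv hX hv).comp continuousOn_snd fun z hz => hz.2
  have hnc := continuousOn_normalDeriv_add_smul hX hu hv
  have hσc (q : ℕ) : ContinuousOn (fun z : ℝ × Cn n => (mixedSigma X m q (u + z.1 • v) z.2).re)
      (univ ×ˢ frontier X) :=
    Complex.continuous_re.comp_continuousOn (continuousOn_mixedSigma hX hu hv m q)
  set M : ℕ → ℝ → Cn n → ℝ := fun q s p => u p * normalDeriv X v p *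
    normalDeriv X (u + s • v) p ^ q * (mixedSigma X m q (u + s • v) p).re with hM
  have hMc (q : ℕ) : ContinuousOn (fun z : ℝ × Cn n => M q z.1 z.2) (univ ×ˢ frontier X) :=
    ((huc.mul hvc).mul (hnc.pow q)).mul (hσc q)
  have h1 := hasDerivAt_setIntegral hK hm subset_rfl (measure_frontier_lt_top hX)
    (F := fun s p => u p * normalDeriv X (u + s • v) p ^ (j + 1) *
      (mixedSigma X m j (u + s • v) p).re)
    (F' := fun s p => ((j : ℝ) + 1) * M j s p + ((m - j : ℕ) : ℝ) * M (j + 1) s p)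
    ((huc.mul (hnc.pow _)).mul (hσc j))
    ((continuousOn_const.mul (hMc j)).add (continuousOn_const.mul (hMc (j + 1))))
    (fun s p hp => by
      have h2 : HasDerivAt (fun s : ℝ => normalDeriv X (u + s • v) p) (normalDeriv X v p) s := by
        simp only [normalDeriv_add_smul hU hu hv _ (frontier_subset_closure hp)]
        simpa using ((hasDerivAt_id s).mul_const (normalDeriv X v p)).const_add
          (normalDeriv X u p)
      have h3 : HasDerivAt (fun s : ℝ => (mixedSigma X m j (u + s • v) p).re) _ s :=
        Complex.reCLM.hasFDerivAt.comp_hasDerivAt s (hasDerivAt_mixedSigma hX hu hv hv0 hj s hp)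
      have h4 : Complex.reCLM (((m - j : ℕ) : ℂ) * normalDeriv X v p *
          mixedSigma X m (j + 1) (u + s • v) p) = ((m - j : ℕ) : ℝ) * normalDeriv X v p *
          (mixedSigma X m (j + 1) (u + s • v) p).re := by
        rw [← Complex.ofReal_natCast, ← Complex.ofReal_mul, Complex.reCLM_apply,
          Complex.re_ofReal_mul]
      rw [h4] at h3
      convert! ((h2.pow (j + 1)).const_mul (u p)).mul h3 using 1
      simp only [hM, Pi.pow_apply]
      push_cast
      ring) t
  rw [integral_add ((integrableOn_of_continuousOn hK hm subset_rfl (measure_frontier_lt_top hX)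
      (continuousOn_slice (hMc j) t)).const_mul _)
    ((integrableOn_of_continuousOn hK hm subset_rfl (measure_frontier_lt_top hX)
      (continuousOn_slice (hMc (j + 1)) t)).const_mul _),
    integral_const_mul, integral_const_mul] at h1
  convert! h1.const_mul ((-1) ^ j * (((m : ℝ) + 1) * (m + 2) / 2) *
    ((m + 1).choose (j + 1) : ℝ)) using 1
  funext s
  -- the undifferentiated factor does not vary, since `v = 0` on the boundary
  have h5 : ∫ p, (u + s • v) p * normalDeriv X (u + s • v) p ^ (j + 1) *
      (mixedSigma X m j (u + s • v) p).re ∂(surfaceMeasure X) =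
      ∫ p in frontier X, u p * normalDeriv X (u + s • v) p ^ (j + 1) *
        (mixedSigma X m j (u + s • v) p).re ∂(Measure.euclideanHausdorffMeasure (2 * n - 1)) := by
    refine setIntegral_congr_fun hm fun p hp => ?_
    simp [hv0 p hp]
  rw [← h5, boundaryTerm, show ((m + 1 : ℕ) : ℝ) + 1 = m + 2 by push_cast; ring, pow_add]
  push_cast
  simp only [even_two, Even.neg_pow, one_pow, mul_one]
  rfl

/-- The variations of the boundary terms telescope, because `(j + 1) C(k, j + 1)` and
`(k - 1 - j) C(k, j + 1) = (j + 2) C(k, j + 2)` are consecutive weights. -/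
lemma hasDerivAt_sum_boundaryTerm (hX : IsSmoothBoundedDomain X) (hu : SmoothOnClosure X u)
    (hv : SmoothOnClosure X v) (hv0 : ∀ p ∈ frontier X, v p = 0) (m : ℕ) (t : ℝ) :
    HasDerivAt (fun s : ℝ => 1 / (((m + 1 : ℕ) : ℝ) ^ 2 * ((m + 1 : ℕ) + 1)) *
      ∑ i ∈ Finset.Icc 2 (m + 1 + 1), boundaryTerm X (m + 1) i (u + s • v))
      (1 / 2 * boundaryMoment X m 0 u v (u + t • v)) t := by
  set Q : ℕ → ℝ := fun j => boundaryMoment X m j u v (u + t • v)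
  set d : ℕ → ℝ := fun j => ((m + 1).choose (j + 1) : ℝ) * (j + 1) with hd
  have h1 (s : ℝ) : ∑ i ∈ Finset.Icc 2 (m + 1 + 1), boundaryTerm X (m + 1) i (u + s • v) =
      ∑ j ∈ Finset.range (m + 1), boundaryTerm X (m + 1) (j + 2) (u + s • v) := by
    rw [← Finset.Ico_add_one_right_eq_Icc, Finset.sum_Ico_eq_sum_range]
    exact Finset.sum_congr (by congr 1) fun j _ => by rw [add_comm 2 j]
  -- `S_{j+2}` contributes `d j * Q j + d (j + 1) * Q (j + 1)`, with sign `(-1) ^ j`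
  have h2 : ∀ N, ∑ j ∈ Finset.range N, (-1 : ℝ) ^ j * (d j * Q j + d (j + 1) * Q (j + 1)) =
      d 0 * Q 0 - (-1) ^ N * (d N * Q N) := by
    intro N
    induction N with
    | zero => simp
    | succ N ih =>
      rw [Finset.sum_range_succ, ih, pow_succ]
      ring
  have h3 : ∀ j ∈ Finset.range (m + 1), (-1) ^ j * (((m : ℝ) + 1) * (m + 2) / 2) *
      ((m + 1).choose (j + 1) : ℝ) * (((j : ℝ) + 1) * Q j + ((m - j : ℕ) : ℝ) * Q (j + 1)) =
      (((m : ℝ) + 1) * (m + 2) / 2) * ((-1 : ℝ) ^ j * (d j * Q j + d (j + 1) * Q (j + 1))) := by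
    intro j hj
    have h4 : ((m + 1).choose (j + 1) : ℝ) * ((m - j : ℕ) : ℝ) = d (j + 1) := by
      have := Nat.choose_succ_right_eq (m + 1) (j + 1)
      rw [show m + 1 - (j + 1) = m - j by omega] at this
      rw [← Nat.cast_mul, ← this, hd]
      push_cast
      ring
    rw [← h4, hd]
    ring
  have h5 := (HasDerivAt.fun_sum fun j (hj : j ∈ Finset.range (m + 1)) =>
    hasDerivAt_boundaryTerm hX hu hv hv0 (Nat.lt_succ_iff.1 (Finset.mem_range.1 hj)) t).const_mul
      (1 / (((m + 1 : ℕ) : ℝ) ^ 2 * ((m + 1 : ℕ) + 1)))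
  simp only [h1]
  convert! h5 using 1
  rw [Finset.sum_congr rfl h3, ← Finset.mul_sum, h2]
  have h6 : d (m + 1) = 0 := by simp [hd]
  have h7 : d 0 = m + 1 := by simp [hd]
  rw [h6, h7]
  have hm1 : (m : ℝ) + 1 ≠ 0 := by positivity
  have hm2 : (m : ℝ) + 2 ≠ 0 := by positivity
  have hm3 : (m : ℝ) + 1 + 1 ≠ 0 := by positivity
  push_cast
  field_simp
  ring

end BoundaryVariation

/-! ### Variation of the interior term -/

section InteriorVariation

variable {n : ℕ} {X : Set (Cn n)} {u v : Cn n → ℝ}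

/-- `v_{i j̄} T_m(D^{1,1}w)_{j ī}`, the derivative of `σ_{m+1}(D^{1,1}w)` in the direction `v`. -/
def newtonPairing (X : Set (Cn n)) (m : ℕ) (v w : Cn n → ℝ) (x : Cn n) : ℂ :=
  ∑ i, ∑ j, complexHessian X v x i j * newton m (complexHessian X w x) j i

lemma measure_domain_lt_top (hX : IsSmoothBoundedDomain X) : volume X < ⊤ :=
  hX.isBounded.measure_lt_top

lemma continuousOn_sigma_add_smul (hX : IsSmoothBoundedDomain X) (hu : SmoothOnClosure X u)
    (hv : SmoothOnClosure X v) (k : ℕ) :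
    ContinuousOn (fun z : ℝ × Cn n => sigma k (complexHessian X (u + z.1 • v) z.2))
      (univ ×ˢ closure X) :=
  continuousOn_sigma fun i j => continuousOn_complexHessian_add_smul
    (hX.hasUnitNormal.uniqueDiffOn_closure hX.isOpen) hu hv i j

lemma continuousOn_newtonPairing_add_smul (hX : IsSmoothBoundedDomain X)
    (hu : SmoothOnClosure X u) (hv : SmoothOnClosure X v) (m : ℕ) :
    ContinuousOn (fun z : ℝ × Cn n => newtonPairing X m v (u + z.1 • v) z.2)
      (univ ×ˢ closure X) := by
  have hU := hX.hasUnitNormal.uniqueDiffOn_closure hX.isOpen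
  refine continuousOn_finsetSum _ fun i _ => continuousOn_finsetSum _ fun j _ =>
    ContinuousOn.mul ?_ (continuousOn_newton (fun i j =>
      continuousOn_complexHessian_add_smul hU hu hv i j) i j)
  exact (contDiffOn_complexHessian hU hv i j).continuousOn.comp continuousOn_snd fun z hz => hz.2

lemma hasDerivAt_re_sigma (hX : IsSmoothBoundedDomain X) (hu : SmoothOnClosure X u)
    (hv : SmoothOnClosure X v) (m : ℕ) (t : ℝ) {x : Cn n} (hx : x ∈ closure X) :
    HasDerivAt (fun s : ℝ => (sigma (m + 1) (complexHessian X (u + s • v) x)).re)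
      (newtonPairing X m v (u + t • v) x).re t :=
  Complex.reCLM.hasFDerivAt.comp_hasDerivAt t (hasDerivAt_sigma fun i j =>
    hasDerivAt_complexHessian (hX.hasUnitNormal.uniqueDiffOn_closure hX.isOpen) hu hv t hx i j)

lemma continuousOn_add_smul (hu : SmoothOnClosure X u) (hv : SmoothOnClosure X v) :
    ContinuousOn (fun z : ℝ × Cn n => (u + z.1 • v) z.2) (univ ×ˢ closure X) :=
  (hu.continuousOn.comp continuousOn_snd fun _ hz => hz.2).add
    (continuousOn_fst.mul (hv.continuousOn.comp continuousOn_snd fun _ hz => hz.2))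

lemma hasDerivAt_integral_sigma (hX : IsSmoothBoundedDomain X) (hu : SmoothOnClosure X u)
    (hv : SmoothOnClosure X v) (m : ℕ) (t : ℝ) :
    HasDerivAt (fun s : ℝ => ∫ x in X, (u + s • v) x *
        (sigma (m + 1) (complexHessian X (u + s • v) x)).re)
      ((∫ x in X, v x * (sigma (m + 1) (complexHessian X (u + t • v) x)).re) +
        ∫ x in X, (u + t • v) x * (newtonPairing X m v (u + t • v) x).re) t := by
  have hK := hX.isBounded.isCompact_closure
  have hm := hX.isOpen.measurableSet
  have hvc : ContinuousOn (fun z : ℝ × Cn n => v z.2) (univ ×ˢ closure X) :=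
    hv.continuousOn.comp continuousOn_snd fun _ hz => hz.2
  have huc := continuousOn_add_smul hu hv
  have hσ := Complex.continuous_re.comp_continuousOn (continuousOn_sigma_add_smul hX hu hv (m + 1))
  have hT := Complex.continuous_re.comp_continuousOn
    (continuousOn_newtonPairing_add_smul hX hu hv m)
  have h1 := hasDerivAt_setIntegral hK hm subset_closure (measure_domain_lt_top hX)
    (F := fun s x => (u + s • v) x * (sigma (m + 1) (complexHessian X (u + s • v) x)).re)
    (F' := fun s x => v x * (sigma (m + 1) (complexHessian X (u + s • v) x)).re +
      (u + s • v) x * (newtonPairing X m v (u + s • v) x).re)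
    (huc.mul hσ) ((hvc.mul hσ).add (huc.mul hT))
    (fun s x hx => by
      have h2 : HasDerivAt (fun s : ℝ => (u + s • v) x) (v x) s := by
        simpa using ((hasDerivAt_id s).mul_const (v x)).const_add (u x)
      exact h2.mul (hasDerivAt_re_sigma hX hu hv m s (subset_closure hx))) t
  rwa [integral_add] at h1
  · exact integrableOn_of_continuousOn hK hm subset_closure (measure_domain_lt_top hX)
      (continuousOn_slice (F := fun s x => v x * (sigma (m + 1)
        (complexHessian X (u + s • v) x)).re) (hvc.mul hσ) t)
  · exact integrableOn_of_continuousOn hK hm subset_closure (measure_domain_lt_top hX)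
      (continuousOn_slice (F := fun s x => (u + s • v) x *
        (newtonPairing X m v (u + s • v) x).re) (huc.mul hT) t)

end InteriorVariation

/-! ### Integration by parts against the Newton tensor -/

section GreenIdentities

variable {n : ℕ} {X : Set (Cn n)} {u v w : Cn n → ℝ}

/-- The boundary flux of Green's formula for a function `v` that vanishes on `M`: the Newton tensor
contracted twice with `ν` is `σ_m` of the tangential part. -/
lemma sum_normal_mul_dZ_mul_newton (hX : IsSmoothBoundedDomain X) (hv : SmoothOnClosure X v)
    (hv0 : ∀ p ∈ frontier X, v p = 0) (m : ℕ) (a : ℂ) {p : Cn n} (hp : p ∈ frontier X) :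
    ∑ i, ∑ j, (1 / (Real.sqrt 2 : ℂ)) * (outwardNormal X p j *
        (a * (dZ X v i p * newton m (complexHessian X w p) j i))) =
      1 / 2 * (a * normalDeriv X v p * mixedSigma X m 0 w p) := by
  have hν := hX.hasUnitNormal.norm_eq_one hp
  have h1 (i : Fin n) : dZ X v i p =
      (1 / (Real.sqrt 2 : ℂ)) * (normalDeriv X v p * star (outwardNormal X p i)) := by
    rw [dZ, fderivWithin_eq_normalDeriv_mul hX hv hv0 hp,
      fderivWithin_eq_normalDeriv_mul hX hv hv0 hp, real_inner_comm,
      real_inner_comm (Complex.I • stdVec i), inner_stdVec, inner_I_smul_stdVec,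
      show star (outwardNormal X p i) = ((outwardNormal X p i).re : ℂ) -
        Complex.I * (outwardNormal X p i).im from Complex.ext (by simp) (by simp)]
    push_cast
    ring
  have h2 : ∑ i, star (outwardNormal X p i) * outwardNormal X p i = 1 := by
    have h3 : inner ℂ (outwardNormal X p) (outwardNormal X p) = 1 := by
      rw [inner_self_eq_norm_sq_to_K, hν]
      simp
    rw [PiLp.inner_apply] at h3
    rw [← h3]
    refine Finset.sum_congr rfl fun i _ => ?_
    rw [RCLike.inner_apply, mul_comm]
    rfl
  have h4 : mixedSigma X m 0 w p = ∑ i, ∑ j, star (outwardNormal X p i) * outwardNormal X p j *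
      newton m (complexHessian X w p) j i := by
    rw [← sigmaPol_compression (frameMatrix X p) (fun i => star (outwardNormal X p i))
      (fun j => outwardNormal X p j) h2 fun i j => conjTranspose_mul_frameMatrix hν i j]
    simp only [mixedSigma, Nat.not_lt_zero, if_false, tangentHessian_eq]
  rw [h4, Finset.mul_sum, Finset.mul_sum]
  refine Finset.sum_congr rfl fun i _ => ?_
  rw [Finset.mul_sum, Finset.mul_sum]
  refine Finset.sum_congr rfl fun j _ => ?_
  rw [h1, ← one_div_sqrt_two_mul_self]
  ring

/-- `v_i w_{j̄} T_m(D^{1,1}w')_{j ī}`. -/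
def gradientPairing (X : Set (Cn n)) (m : ℕ) (v w w' : Cn n → ℝ) (x : Cn n) : ℂ :=
  ∑ i, ∑ j, dZ X v i x * dZbar X w j x * newton m (complexHessian X w' x) j i

lemma star_dZ (u : Cn n → ℝ) (i : Fin n) (x : Cn n) : star (dZ X u i x) = dZbar X u i x := by
  rw [dZ, dZbar, RCLike.star_def, map_mul, map_sub, map_mul, Complex.conj_I, Complex.conj_ofReal,
    Complex.conj_ofReal, map_div₀, map_one, Complex.conj_ofReal]
  ring

lemma star_gradientPairing (hX : IsSmoothBoundedDomain X) (hw : SmoothOnClosure X w) (m : ℕ)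
    (u v : Cn n → ℝ) {x : Cn n} (hx : x ∈ closure X) :
    star (gradientPairing X m u v w x) = gradientPairing X m v u w x := by
  have hH := isHermitian_newton (m := m) (isHermitian_complexHessian hX.isOpen
    (hX.hasUnitNormal.uniqueDiffOn_closure hX.isOpen) hw hx)
  simp only [gradientPairing, star_sum, star_mul']
  rw [Finset.sum_comm]
  refine Finset.sum_congr rfl fun i _ => Finset.sum_congr rfl fun j _ => ?_
  rw [star_dZ, ← star_dZ v, star_star, hH.apply]
  ring

lemma continuousOn_gradientPairing (hX : IsSmoothBoundedDomain X) (hu : SmoothOnClosure X u)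
    (hv : SmoothOnClosure X v) (hw : SmoothOnClosure X w) (m : ℕ) :
    ContinuousOn (gradientPairing X m u v w) (closure X) := by
  have hU := hX.hasUnitNormal.uniqueDiffOn_closure hX.isOpen
  exact continuousOn_finsetSum _ fun i _ => continuousOn_finsetSum _ fun j _ =>
    ((contDiffOn_dZ hU hu i).continuousOn.mul (contDiffOn_dZbar hU hv j).continuousOn).mul
      (continuousOn_newton (fun i j => (contDiffOn_complexHessian hU hw i j).continuousOn) i j)

lemma continuousOn_newtonPairing (hX : IsSmoothBoundedDomain X) (hv : SmoothOnClosure X v)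
    (hw : SmoothOnClosure X w) (m : ℕ) : ContinuousOn (newtonPairing X m v w) (closure X) := by
  have hU := hX.hasUnitNormal.uniqueDiffOn_closure hX.isOpen
  exact continuousOn_finsetSum _ fun i _ => continuousOn_finsetSum _ fun j _ =>
    (contDiffOn_complexHessian hU hv i j).continuousOn.mul
      (continuousOn_newton (fun i j => (contDiffOn_complexHessian hU hw i j).continuousOn) i j)

lemma integrableOn_domain {G : Type*} [NormedAddCommGroup G] (hX : IsSmoothBoundedDomain X)
    {f : Cn n → G} (hf : ContinuousOn f (closure X)) : IntegrableOn f X :=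
  integrableOn_of_continuousOn hX.isBounded.isCompact_closure hX.isOpen.measurableSet
    subset_closure (measure_domain_lt_top hX) hf

/-- Real part of Green's formula. -/
lemma integral_re_gradientPairing_add (hX : IsSmoothBoundedDomain X) {a b : Cn n → ℝ}
    (ha : SmoothOnClosure X a) (hb : SmoothOnClosure X b) (hw : SmoothOnClosure X w) (m : ℕ) :
    (∫ x in X, (gradientPairing X m b a w x).re) + ∫ x in X, a x * (newtonPairing X m b w x).re =
      (∫ p in frontier X, ∑ i, ∑ j, (1 / (Real.sqrt 2 : ℂ)) * (outwardNormal X p j *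
        (a p * (dZ X b i p * newton m (complexHessian X w p) j i)))
        ∂(Measure.euclideanHausdorffMeasure (2 * n - 1))).re := by
  have h1 := integral_newton_green hX.hasUnitNormal hX.isOpen hX.isBounded ha hb hw m
  rw [finrank_real_Cn] at h1
  rw [← h1]
  have hac : ContinuousOn (fun x => (a x : ℂ)) (closure X) :=
    Complex.continuous_ofReal.comp_continuousOn ha.continuousOn
  have h2 := integrableOn_domain hX (continuousOn_gradientPairing hX hb ha hw m)
  have h3 : IntegrableOn (fun x => (a x : ℂ) * newtonPairing X m b w x) X :=
    integrableOn_domain hX (hac.mul (continuousOn_newtonPairing hX hb hw m))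
  have h4 (x : Cn n) : ∑ i, ∑ j, (dZ X b i x * dZbar X a j x *
      newton m (complexHessian X w x) j i + a x * (complexHessian X b x i j *
        newton m (complexHessian X w x) j i)) =
      gradientPairing X m b a w x + a x * newtonPairing X m b w x := by
    simp only [gradientPairing, newtonPairing, Finset.sum_add_distrib, Finset.mul_sum]
  simp only [h4]
  rw [integral_add h2 h3, Complex.add_re]
  congr 1
  · exact Complex.reCLM.integral_comp_comm h2
  · refine Eq.trans ?_ (Complex.reCLM.integral_comp_comm h3)
    simp only [Complex.reCLM_apply, Complex.re_ofReal_mul]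

lemma newtonPairing_self (m : ℕ) (w : Cn n → ℝ) (x : Cn n) :
    newtonPairing X m w w x = ((m : ℂ) + 1) * sigma (m + 1) (complexHessian X w x) :=
  sum_mul_newton_self _

/-- Green's formula without a boundary term, for `v` that vanishes on the boundary. -/
lemma integral_re_gradientPairing_eq_neg (hX : IsSmoothBoundedDomain X) {b : Cn n → ℝ}
    (hv : SmoothOnClosure X v) (hv0 : ∀ p ∈ frontier X, v p = 0) (hb : SmoothOnClosure X b)
    (hw : SmoothOnClosure X w) (m : ℕ) :
    ∫ x in X, (gradientPairing X m b v w x).re = -∫ x in X, v x * (newtonPairing X m b w x).re := by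
  have h1 := integral_re_gradientPairing_add hX hv hb hw m
  rw [setIntegral_congr_fun (g := fun _ => (0 : ℂ)) isClosed_frontier.measurableSet
    (fun p hp => by simp [hv0 p hp])] at h1
  simp only [integral_zero, Complex.zero_re] at h1
  linarith

/-- Integrating by parts twice moves both derivatives from `v` to `w`. Only the first step has a
boundary term, because `v` vanishes on the boundary. -/
lemma integral_mul_re_newtonPairing (hX : IsSmoothBoundedDomain X) (hv : SmoothOnClosure X v)
    (hv0 : ∀ p ∈ frontier X, v p = 0) (hw : SmoothOnClosure X w) (m : ℕ)
    (huw : ∀ p ∈ frontier X, w p = u p) :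
    ∫ x in X, w x * (newtonPairing X m v w x).re =
      ((m : ℝ) + 1) * (∫ x in X, v x * (sigma (m + 1) (complexHessian X w x)).re) +
        1 / 2 * boundaryMoment X m 0 u v w := by
  have h1 := integral_re_gradientPairing_add hX hw hv hw m
  have h2 := integral_re_gradientPairing_eq_neg hX hv hv0 hw hw m
  -- the two gradient pairings are conjugate, since the Newton tensor is Hermitian
  have h3 : ∫ x in X, (gradientPairing X m v w w x).re =
      ∫ x in X, (gradientPairing X m w v w x).re := by
    refine setIntegral_congr_fun hX.isOpen.measurableSet fun x hx => ?_
    simp only [← star_gradientPairing hX hw m w v (subset_closure hx), RCLike.star_def,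
      Complex.conj_re]
  have h4 : ∫ x in X, v x * (newtonPairing X m w w x).re =
      ((m : ℝ) + 1) * ∫ x in X, v x * (sigma (m + 1) (complexHessian X w x)).re := by
    rw [← integral_const_mul]
    congr 1
    funext x
    rw [newtonPairing_self, show (m : ℂ) + 1 = (((m : ℝ) + 1 : ℝ) : ℂ) by push_cast; rfl,
      Complex.re_ofReal_mul]
    ring
  have h5 : ∫ p in frontier X, ∑ i, ∑ j, (1 / (Real.sqrt 2 : ℂ)) * (outwardNormal X p j *
        (w p * (dZ X v i p * newton m (complexHessian X w p) j i)))
        ∂(Measure.euclideanHausdorffMeasure (2 * n - 1)) =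
      ∫ p in frontier X, (1 / 2 : ℂ) * (w p * normalDeriv X v p * mixedSigma X m 0 w p)
        ∂(Measure.euclideanHausdorffMeasure (2 * n - 1)) :=
    setIntegral_congr_fun isClosed_frontier.measurableSet fun p hp =>
      sum_normal_mul_dZ_mul_newton hX hv hv0 m (w p) hp
  have hσc : ContinuousOn (mixedSigma X m 0 w) (frontier X) := by
    have := continuousOn_slice (F := fun s p => mixedSigma X m 0 (w + s • v) p)
      (continuousOn_mixedSigma hX hw hv m 0) 0
    simpa using this
  have hc : ContinuousOn (fun p => (1 / 2 : ℂ) * ((w p : ℂ) * normalDeriv X v p *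
      mixedSigma X m 0 w p)) (frontier X) :=
    continuousOn_const.mul (((Complex.continuous_ofReal.comp_continuousOn
      (hw.continuousOn.mono frontier_subset_closure)).mul
      (Complex.continuous_ofReal.comp_continuousOn (continuousOn_normalDeriv hX hv))).mul hσc)
  have h6 : (∫ p in frontier X, (1 / 2 : ℂ) * (w p * normalDeriv X v p * mixedSigma X m 0 w p)
        ∂(Measure.euclideanHausdorffMeasure (2 * n - 1))).re =
      1 / 2 * boundaryMoment X m 0 u v w := by
    rw [← Complex.reCLM_apply, ← Complex.reCLM.integral_comp_comm
      (integrableOn_of_continuousOn (isCompact_frontier hX) isClosed_frontier.measurableSet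
        subset_rfl (measure_frontier_lt_top hX) hc), boundaryMoment, ← integral_const_mul]
    refine setIntegral_congr_fun isClosed_frontier.measurableSet fun p hp => ?_
    simp only [Complex.reCLM_apply]
    rw [show (1 / 2 : ℂ) * (w p * normalDeriv X v p * mixedSigma X m 0 w p) =
      ((1 / 2 * (w p * normalDeriv X v p) : ℝ) : ℂ) * mixedSigma X m 0 w p by push_cast; ring,
      Complex.re_ofReal_mul, huw p hp]
    ring
  rw [h5, h6] at h1
  linarith

end GreenIdentities

/-! ### First and second variation of the energy -/

section EnergyVariation

variable {n : ℕ} {X : Set (Cn n)} {u v : Cn n → ℝ}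

/-- First variation: the boundary terms of the energy cancel those of the integrations by parts. -/
lemma hasDerivAt_energy (hX : IsSmoothBoundedDomain X) (hu : SmoothOnClosure X u)
    (hv : SmoothOnClosure X v) (hv0 : ∀ p ∈ frontier X, v p = 0) (m : ℕ) (t : ℝ) :
    HasDerivAt (fun s : ℝ => energy X (m + 1) (u + s • v))
      (-((m : ℝ) + 2) * ∫ x in X, v x * (sigma (m + 1) (complexHessian X (u + t • v) x)).re) t := by
  have h1 := (hasDerivAt_integral_sigma hX hu hv m t).neg.add
    (hasDerivAt_sum_boundaryTerm hX hu hv hv0 m t)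
  rw [integral_mul_re_newtonPairing (u := u) hX hv hv0 (smoothOnClosure_add_smul hu hv t) m
    (fun p hp => by simp [hv0 p hp])] at h1
  convert! h1 using 1
  ring

/-- Second variation: the linearization of `σ_{m+1}` is integrated by parts against `v`, which kills
the boundary term. -/
lemma hasDerivAt_integral_mul_sigma (hX : IsSmoothBoundedDomain X) (hu : SmoothOnClosure X u)
    (hv : SmoothOnClosure X v) (hv0 : ∀ p ∈ frontier X, v p = 0) (m : ℕ) (t : ℝ) :
    HasDerivAt (fun s : ℝ => -((m : ℝ) + 2) *
        ∫ x in X, v x * (sigma (m + 1) (complexHessian X (u + s • v) x)).re)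
      (((m : ℝ) + 2) * ∫ x in X, (gradientPairing X m v v (u + t • v) x).re) t := by
  have hvc : ContinuousOn (fun z : ℝ × Cn n => v z.2) (univ ×ˢ closure X) :=
    hv.continuousOn.comp continuousOn_snd fun _ hz => hz.2
  have h1 := hasDerivAt_setIntegral hX.isBounded.isCompact_closure hX.isOpen.measurableSet
    subset_closure (measure_domain_lt_top hX)
    (F := fun s x => v x * (sigma (m + 1) (complexHessian X (u + s • v) x)).re)
    (F' := fun s x => v x * (newtonPairing X m v (u + s • v) x).re)
    (hvc.mul (Complex.continuous_re.comp_continuousOn (continuousOn_sigma_add_smul hX hu hv _)))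
    (hvc.mul (Complex.continuous_re.comp_continuousOn
      (continuousOn_newtonPairing_add_smul hX hu hv m)))
    (fun s x hx => (hasDerivAt_re_sigma hX hu hv m s (subset_closure hx)).const_mul _) t
  rw [integral_re_gradientPairing_eq_neg hX hv hv0 hv (smoothOnClosure_add_smul hu hv t)]
  convert! h1.const_mul (-((m : ℝ) + 2)) using 1
  ring

lemma continuous_integral_re_gradientPairing (hX : IsSmoothBoundedDomain X)
    (hu : SmoothOnClosure X u) (hv : SmoothOnClosure X v) (hv0 : ∀ p ∈ frontier X, v p = 0)
    (m : ℕ) : Continuous fun t : ℝ =>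
      ((m : ℝ) + 2) * ∫ x in X, (gradientPairing X m v v (u + t • v) x).re := by
  have hvc : ContinuousOn (fun z : ℝ × Cn n => v z.2) (univ ×ˢ closure X) :=
    hv.continuousOn.comp continuousOn_snd fun _ hz => hz.2
  have h1 := continuous_setIntegral hX.isBounded.isCompact_closure hX.isOpen.measurableSet
    subset_closure (measure_domain_lt_top hX)
    (F := fun s x => v x * (newtonPairing X m v (u + s • v) x).re)
    (hvc.mul (Complex.continuous_re.comp_continuousOn
      (continuousOn_newtonPairing_add_smul hX hu hv m)))
  have h2 (t : ℝ) := integral_re_gradientPairing_eq_neg hX hv hv0 hv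
    (smoothOnClosure_add_smul hu hv t) m
  simp only [h2]
  exact continuous_const.mul h1.neg

lemma iteratedDeriv_two_energy (hX : IsSmoothBoundedDomain X) (hu : SmoothOnClosure X u)
    (hv : SmoothOnClosure X v) (hv0 : ∀ p ∈ frontier X, v p = 0) (m : ℕ) :
    iteratedDeriv 2 (fun s : ℝ => energy X (m + 1) (u + s • v)) = fun t =>
      ((m : ℝ) + 2) * ∫ x in X, (gradientPairing X m v v (u + t • v) x).re := by
  rw [iteratedDeriv_succ, iteratedDeriv_one,
    funext fun t => (hasDerivAt_energy hX hu hv hv0 m t).deriv]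
  exact funext fun t => (hasDerivAt_integral_mul_sigma hX hu hv hv0 m t).deriv

lemma contDiff_two_energy (hX : IsSmoothBoundedDomain X) (hu : SmoothOnClosure X u)
    (hv : SmoothOnClosure X v) (hv0 : ∀ p ∈ frontier X, v p = 0) (m : ℕ) :
    ContDiff ℝ 2 fun s : ℝ => energy X (m + 1) (u + s • v) := by
  rw [show (2 : WithTop ℕ∞) = 1 + 1 by norm_num, contDiff_succ_iff_deriv]
  refine ⟨fun t => (hasDerivAt_energy hX hu hv hv0 m t).differentiableAt, by simp, ?_⟩
  rw [funext fun t => (hasDerivAt_energy hX hu hv hv0 m t).deriv, contDiff_one_iff_deriv]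
  refine ⟨fun t => (hasDerivAt_integral_mul_sigma hX hu hv hv0 m t).differentiableAt, ?_⟩
  rw [funext fun t => (hasDerivAt_integral_mul_sigma hX hu hv hv0 m t).deriv]
  exact continuous_integral_re_gradientPairing hX hu hv hv0 m

lemma integral_re_gradientPairing_nonneg (hX : IsSmoothBoundedDomain X) {w : Cn n → ℝ} {m : ℕ}
    (hw : w ∈ ellipticCone X (m + 1)) :
    0 ≤ ∫ x in X, (gradientPairing X m v v w x).re := by
  refine setIntegral_nonneg hX.isOpen.measurableSet fun x hx => ?_
  have h1 := newton_nonneg (by omega) (hw.2 x hx) fun i => dZ X v i x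
  simp only [star_dZ] at h1
  exact h1

end EnergyVariation

end HessianEnergy

end

theorem proposition5p2 (n k : ℕ) (hk : 1 ≤ k)
    (X : Set (HessianEnergy.Cn n)) (hX : HessianEnergy.IsSmoothBoundedDomain X)
    (u v : HessianEnergy.Cn n → ℝ)
    (hu : HessianEnergy.SmoothOnClosure X u) (hv : HessianEnergy.SmoothOnClosure X v)
    (hv0 : ∀ p ∈ frontier X, v p = 0) :
    -- the second variation exists and is given by the integral formula
    ContDiff ℝ 2 (fun t : ℝ => HessianEnergy.energy X k (u + t • v)) ∧
    IntegrableOn (HessianEnergy.variationDensity X k u v) X ∧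
    ((iteratedDeriv 2 (fun t : ℝ => HessianEnergy.energy X k (u + t • v)) 0 : ℝ) : ℂ) =
      ((k : ℂ) + 1) * ∫ x in X, HessianEnergy.variationDensity X k u v x ∧
    -- it is nonnegative at points of the elliptic cone
    (u ∈ HessianEnergy.ellipticCone X k →
      0 ≤ iteratedDeriv 2 (fun t : ℝ => HessianEnergy.energy X k (u + t • v)) 0) ∧
    -- the energy is convex along segments in direction `v` that stay in the elliptic cone
    (∀ s : Set ℝ, Convex ℝ s → (∀ t ∈ s, u + t • v ∈ HessianEnergy.ellipticCone X k) →
      ConvexOn ℝ s (fun t : ℝ => HessianEnergy.energy X k (u + t • v))) := by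
  obtain ⟨m, rfl⟩ : ∃ m, k = m + 1 := ⟨k - 1, by omega⟩
  have hm : (0 : ℝ) ≤ (m : ℝ) + 2 := by positivity
  have hd2 := HessianEnergy.iteratedDeriv_two_energy hX hu hv hv0 m
  have hC2 := HessianEnergy.contDiff_two_energy hX hu hv hv0 m
  have hint : IntegrableOn (HessianEnergy.variationDensity X (m + 1) u v) X :=
    HessianEnergy.integrableOn_domain hX (HessianEnergy.continuousOn_gradientPairing hX hv hv hu m)
  have hpos (t : ℝ) (ht : u + t • v ∈ HessianEnergy.ellipticCone X (m + 1)) :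
      0 ≤ iteratedDeriv 2 (fun t : ℝ => HessianEnergy.energy X (m + 1) (u + t • v)) t := by
    rw [hd2]
    exact mul_nonneg hm (HessianEnergy.integral_re_gradientPairing_nonneg hX ht)
  refine ⟨hC2, hint, ?_, fun h => hpos 0 (by simpa using h), fun s hs hcone => ?_⟩
  · have h1 : ∫ x in X, HessianEnergy.variationDensity X (m + 1) u v x =
        ((∫ x in X, (HessianEnergy.gradientPairing X m v v u x).re : ℝ) : ℂ) := by
      rw [← integral_complex_ofReal]
      refine setIntegral_congr_fun hX.isOpen.measurableSet fun x hx => ?_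
      -- the density is real since the Newton tensor is Hermitian
      exact (Complex.conj_eq_iff_re.1
        (HessianEnergy.star_gradientPairing hX hu m v v (subset_closure hx))).symm
    rw [hd2, h1]
    simp only [zero_smul, add_zero]
    push_cast
    ring
  · have hdiff : Differentiable ℝ fun t : ℝ => HessianEnergy.energy X (m + 1) (u + t • v) :=
      hC2.differentiable (by norm_num)
    have hdiff2 :
        Differentiable ℝ (deriv fun t : ℝ => HessianEnergy.energy X (m + 1) (u + t • v)) :=
      hC2.differentiable_deriv_two
    refine convexOn_of_deriv2_nonneg hs hdiff.continuous.continuousOn hdiff.differentiableOn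
      hdiff2.differentiableOn fun t ht => ?_
    have := hpos t (hcone t (interior_subset ht))
    rwa [iteratedDeriv_eq_iterate] at this
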